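/- Fix an integer $d\ge 2$. Let $\mathcal C^{1+}$ be the set of orientation-preserving circle endomorphisms $f$ of degree $d$ with $f(1)=1$ that are $C^{1+\alpha}$ for some $0<\alpha\le 1$ and expanding; $f$ is given by its lift $F:\mathbb R\to\mathbb R$, an increasing homeomorphism with $F(0)=0$, $F(x+1)=F(x)+d$, and expanding means $(F^n)'\ge C\lambda^n$ for all $n\ge1$, for some $C>0$, $\lambda>1$. For a word $i_0\cdots i_{n-1}$ in $\{0,\dots,d-1\}$ let $I_{i_0\cdots i_{n-1}}=G_{i_0}\circ\cdots\circ G_{i_{n-1}}([0,1])$, where $G_i(x)=F^{-1}(x+i)$. Let $\Sigma$ be the space of sequences $w=i_0i_1i_2\cdots$ with the left shift $\sigma$, and $\Sigma^*$ the space of sequences $w^*=\cdots j_2j_1j_0$ with the right shift $\sigma^*(\cdots j_2j_1j_0)=\cdots j_2j_1$, both with the product topology; $[w_n]$ and $[w_n^*]$ denote the cylinders given by the $n$ first, respectively the $n$ rightmost, digits. The dual derivative of $f$ is $$D^*(f)(w^*)=\lim_{n\to\infty}\frac{|I_{j_{n-1}\cdots j_1}|}{|I_{j_{n-1}\cdots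 j_1j_0}|},\qquad w^*\in\Sigma^*,$$ and $\mathcal T\mathcal C^{1+}=\{D^*(f): f\in\mathcal C^{1+}\}$. A Gibbs measure for a potential $\phi$ with constant (pressure) $P$ is a shift-invariant Borel probability measure $m$ such that for some $C>0$, $C^{-1}\le m([x_n])/\exp(-Pn+\sum_{i<n}\phi(T^ix))\le C$ for all $n$ and all points $x$, where $T$ is the shift and $[x_n]$ the cylinder of length $n$ about $x$. The metric induced on $\Sigma^*$ by a probability measure $\mu$ without atoms and with full support is $d_\mu(x,y)=\mu(\text{smallest cylinder containing }x\text{ and }y)$ for $x\ne y$, $d_\mu(x,x)=0$. The derivative of $\sigma^*$ at $w^*$ with respect to $d_\mu$ is $\lim_{n\to\infty}\mu(\sigma^*([w_n^*]))/\mu([w_n^*])$; equivalently, $\lim_{y\to w^*,\,y\ne w^*}d_\mu(\sigma^*y,\sigma^*w^*)/d_\mu(y,w^*)$. **Theorem.** Every $f\in\mathcal C^{1+}$ has a dual derivative. Let $\Psi^*\in\mathcal T\mathcal C^{1+}$. Then there is a Borel probability measure $\mu^*$ on $\Sigma^*$, without atoms and with support $\Sigma^*$, such that: 1. $\sigma^*$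 is $C^{1+}$ for the metric $d_{\mu^*}$, with derivative $\Psi^*$: the derivative exists and equals $\Psi^*(w^*)$ at every $w^*\in\Sigma^*$, and $\Psi^*$ is positive and Hölder continuous, both in the symbolic sense ($|\Psi^*(x)-\Psi^*(y)|\le C\tau^n$ for some $C>0$, $0<\tau<1$ whenever the $n$ rightmost digits of $x,y$ agree) and with respect to $d_{\mu^*}$. 2. $\mu^*$ is the only Borel probability measure without atoms and with full support for which $\sigma^*$ has derivative $\Psi^*$ at every point. 3. For every $f\in\mathcal C^{1+}$ with $D^*(f)=\Psi^*$, there is a unique Gibbs measure $m$ on $\Sigma$ with constant $0$ for the potential $\log\psi_f$, $\psi_f(w)=1/F'(x_w)$, $\{x_w\}=\bigcap_n I_{i_0\cdots i_{n-1}}$; and $\mu^*$ is its dual measure: $\mu^*([(j_{n-1}\cdots j_0)^*])=m([j_{n-1}\cdots j_0])$ for every word. 4. $\mu^*$ is a Gibbs measure for $-\log\Psi^*$ with constant $0$, and any Gibbs measure for $-\log\Psi^*$, with any constant $P$, has $P=0$ and equals $\mu^*$. The topological pressure of $-\log\Psi^*$, $\lim_n\frac1n\log\sum_{w_n^*}\sup_{[w_n^*]}\exp(\sum_{i<n}-\log\Psi^*\circ(\sigma^*)^i)$,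 is $0$. 5. $1/\Psi^*$ is a $g$-function, i.e. it is continuous and nonnegative and $\sum_{\sigma^*y=x}1/\Psi^*(y)=1$ for all $x$; and $\mu^*$ is a $g$-measure for it, i.e. $\int\sum_{\sigma^*y=x}\frac{\varphi(y)}{\Psi^*(y)}\,d\mu^*(x)=\int\varphi\,d\mu^*$ for every continuous $\varphi$. With $\tilde\mu^*(B)=\sum_{j=0}^{d-1}\mu^*(\sigma^*(B\cap[j]))$ one has $\mu^*\ll\tilde\mu^*$ and $d\mu^*/d\tilde\mu^*=1/\Psi^*$ $\tilde\mu^*$-a.e. 6. $\mu^*$ is the unique equilibrium state for $-\log\Psi^*$: $$0=h_{\mu^*}(\sigma^*)-\int\log\Psi^*\,d\mu^*=\sup_\nu\Big\{h_\nu(\sigma^*)-\int\log\Psi^*\,d\nu\Big\},$$ the supremum being over all $\sigma^*$-invariant Borel probability measures $\nu$ and $h_\nu$ the measure-theoretic (Kolmogorov–Sinai) entropy; and no other invariant probability measure attains it. -/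

import Mathlib

open MeasureTheory Filter Topology

namespace DualGibbs

noncomputable section

/-! ## The symbolic space and the dual symbolic space -/

/-- The symbolic space: `w = i₀ i₁ i₂ ⋯` is the sequence `k ↦ i_k`, with the product topology. -/
abbrev SymSpace (d : ℕ) : Type := ℕ → Fin d

/-- The dual symbolic space: `w* = ⋯ j₂ j₁ j₀` is the sequence `k ↦ j_k` (digits are numbered from
the right). The topology generated by the right cylinders is the product topology. -/
abbrev DualSymSpace (d : ℕ) : Type := ℕ → Fin d

/-- Dropping the digit number `0`: this is the left shift `i₀ i₁ i₂ ⋯ ↦ i₁ i₂ ⋯` of the symbolic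
space and the right shift `⋯ j₂ j₁ j₀ ↦ ⋯ j₂ j₁` of the dual symbolic space. -/
def shift {d : ℕ} (x : ℕ → Fin d) : ℕ → Fin d := fun k => x (k + 1)

/-- Putting the digit `j` in the position `0`. -/
def prepend {d : ℕ} (j : Fin d) (x : ℕ → Fin d) : ℕ → Fin d
  | 0 => j
  | k + 1 => x k

/-- The preimages of `x` under the shift are the points `prepend j x`. -/
theorem shift_eq_iff {d : ℕ} (x y : ℕ → Fin d) : shift y = x ↔ ∃ j, y = prepend j x := by
  constructor
  · rintro rfl
    refine ⟨y 0, funext fun k => ?_⟩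
    cases k <;> rfl
  · rintro ⟨j, rfl⟩
    rfl

/-! ## Circle endomorphisms -/

/-- A circle endomorphism of degree `d` fixing `1`, given by its lift to the real line that
fixes `0` (an order isomorphism of `ℝ` is the same as an orientation-preserving homeomorphism). -/
structure CircleEndo (d : ℕ) where
  lift : ℝ ≃o ℝ
  map_zero : lift 0 = 0
  map_add_one : ∀ x : ℝ, lift (x + 1) = lift x + d

/-- The class `𝒞^{1+}`: circle endomorphisms which are `C^{1+α}` for some `0 < α ≤ 1`
and expanding. -/
structure CircleEndo.IsC1PlusExpanding {d : ℕ} (f : CircleEndo d) : Prop where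
  contDiff : ContDiff ℝ 1 f.lift
  holder : ∃ α : ℝ, 0 < α ∧ α ≤ 1 ∧ ∃ K : ℝ, ∀ x y : ℝ,
    |deriv f.lift x - deriv f.lift y| ≤ K * |x - y| ^ α
  expanding : ∃ C : ℝ, 0 < C ∧ ∃ lam : ℝ, 1 < lam ∧
    ∀ n : ℕ, 1 ≤ n → ∀ x : ℝ, C * lam ^ n ≤ deriv (f.lift^[n]) x

/-- `G_{i₀} ∘ ⋯ ∘ G_{i_{n-1}}` for the word `i₀ ⋯ i_{n-1}`, where `G_i x = F⁻¹ (x + i)`. -/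
def CircleEndo.branch {d : ℕ} (f : CircleEndo d) : List (Fin d) → ℝ → ℝ
  | [], x => x
  | i :: w, x => f.lift.symm (f.branch w x + (i : ℕ))

/-- The interval `I_w = G_w([0,1])` of the Markov partition of `[0,1]` labelled by the word `w`. -/
def CircleEndo.interval {d : ℕ} (f : CircleEndo d) (w : List (Fin d)) : Set ℝ :=
  Set.Icc (f.branch w 0) (f.branch w 1)

/-- The length of `I_w`. -/
def CircleEndo.length {d : ℕ} (f : CircleEndo d) (w : List (Fin d)) : ℝ :=
  f.branch w 1 - f.branch w 0

/-- The word `i₀ i₁ ⋯ i_{n-1}` of the first `n` digits of a point of the symbolic space. -/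
def leftWord {d : ℕ} (w : SymSpace d) (n : ℕ) : List (Fin d) := (List.range n).map w

/-- The word `j_{n-1} ⋯ j₁ j₀` of the last `n` digits of a point of the dual symbolic space. -/
def rightWord {d : ℕ} (x : DualSymSpace d) (n : ℕ) : List (Fin d) := ((List.range n).map x).reverse

/-- `Ψ` is the dual derivative `D*(f)`: for every `w* = ⋯ j₁ j₀`, the quotients
`|I_{j_{n-1} ⋯ j₁}| / |I_{j_{n-1} ⋯ j₁ j₀}|` converge to `Ψ(w*)`. -/
def CircleEndo.IsDualDerivative {d : ℕ} (f : CircleEndo d) (Ψ : DualSymSpace d → ℝ) : Prop :=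
  ∀ x : DualSymSpace d,
    Tendsto (fun n : ℕ => f.length (rightWord (shift x) n) / f.length (rightWord x (n + 1)))
      atTop (𝓝 (Ψ x))

/-- The Teichmüller space `𝒯𝒞^{1+}` of degree `d`, represented as the set of the dual derivatives
of all `f ∈ 𝒞^{1+}`. -/
def teichC1Plus (d : ℕ) : Set (DualSymSpace d → ℝ) :=
  {Ψ | ∃ f : CircleEndo d, f.IsC1PlusExpanding ∧ f.IsDualDerivative Ψ}

/-- The lift to `[0,1]` of the projection `π_f`: the limit of the left end points of the nested
intervals `I_{w_n}`. -/
def CircleEndo.proj {d : ℕ} (f : CircleEndo d) (w : SymSpace d) : ℝ :=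
  ⨆ n : ℕ, f.branch (leftWord w n) 0

theorem CircleEndo.branch_strictMono {d : ℕ} (f : CircleEndo d) (w : List (Fin d)) :
    StrictMono (f.branch w) := by
  induction w with
  | nil => exact fun _ _ h => h
  | cons i w ih =>
    intro a b h
    exact f.lift.symm.strictMono (by simpa using ih h)

theorem CircleEndo.branch_append {d : ℕ} (f : CircleEndo d) (v w : List (Fin d)) (x : ℝ) :
    f.branch (v ++ w) x = f.branch v (f.branch w x) := by
  induction v with
  | nil => rfl
  | cons i v ih => simp [branch, ih]

theorem CircleEndo.lift_natCast {d : ℕ} (f : CircleEndo d) (k : ℕ) :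
    f.lift (k : ℝ) = (k : ℝ) * d := by
  induction k with
  | zero => simpa using f.map_zero
  | succ k ih => rw [Nat.cast_succ, f.map_add_one, ih]; ring

/-- `π_f(w)` lies in all the intervals `I_{w_n}`. -/
theorem CircleEndo.proj_mem {d : ℕ} (f : CircleEndo d) (w : SymSpace d) (n : ℕ) :
    f.proj w ∈ f.interval (leftWord w n) := by
  have hs : ∀ i : Fin d, 0 ≤ f.branch [i] 0 ∧ f.branch [i] 1 ≤ 1 := by
    intro i
    have h0 : f.lift 0 = 0 := f.map_zero
    have h1 : f.lift 1 = d := by simpa using f.lift_natCast 1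
    have hi : ((i : ℕ) : ℝ) + 1 ≤ d := by exact_mod_cast i.2
    constructor
    · simp only [branch]
      rw [f.lift.le_symm_apply, h0]
      positivity
    · simp only [branch]
      rw [f.lift.symm_apply_le, h1]
      linarith
  have hsucc : ∀ m, leftWord w (m + 1) = leftWord w m ++ [w m] := by
    intro m
    simp [leftWord, List.range_succ]
  have hL : Monotone fun m => f.branch (leftWord w m) 0 := by
    refine monotone_nat_of_le_succ fun m => ?_
    simp only [hsucc, branch_append]
    exact (f.branch_strictMono _).monotone (hs _).1
  have hR : Antitone fun m => f.branch (leftWord w m) 1 := by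
    refine antitone_nat_of_succ_le fun m => ?_
    simp only [hsucc, branch_append]
    exact (f.branch_strictMono _).monotone (hs _).2
  have hLR : ∀ a b, f.branch (leftWord w a) 0 ≤ f.branch (leftWord w b) 1 := fun a b =>
    (hL (le_max_left a b)).trans
      (((f.branch_strictMono _).monotone zero_le_one).trans (hR (le_max_right a b)))
  refine ⟨le_ciSup (f := fun m => f.branch (leftWord w m) 0) ⟨f.branch (leftWord w n) 1, ?_⟩ n,
    ciSup_le fun a => hLR a n⟩
  rintro _ ⟨a, rfl⟩
  exact hLR a n

/-- The function `ψ_f(w) = 1 / f'(π_f(w))` on the symbolic space. -/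
def CircleEndo.weight {d : ℕ} (f : CircleEndo d) (w : SymSpace d) : ℝ :=
  1 / deriv f.lift (f.proj w)

/-! ## The metric induced by a measure, and differentiability of the shift -/

/-- The metric induced by `μ`: the measure of the smallest cylinder containing both points. -/
def inducedDist {d : ℕ} (μ : Measure (DualSymSpace d)) (x y : DualSymSpace d) : ℝ :=
  open scoped Classical in
  if x = y then 0 else μ.real (PiNat.cylinder x (PiNat.firstDiff x y))

theorem inducedDist_self {d : ℕ} (μ : Measure (DualSymSpace d)) (x : DualSymSpace d) :
    inducedDist μ x x = 0 := by
  simp [inducedDist]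

theorem inducedDist_comm {d : ℕ} (μ : Measure (DualSymSpace d)) (x y : DualSymSpace d) :
    inducedDist μ x y = inducedDist μ y x := by
  by_cases h : x = y
  · rw [h]
  · rw [inducedDist, inducedDist, if_neg h, if_neg (Ne.symm h), PiNat.firstDiff_comm y x,
      PiNat.cylinder_eq_cylinder_of_le_firstDiff x y le_rfl]

theorem inducedDist_nonneg {d : ℕ} (μ : Measure (DualSymSpace d)) (x y : DualSymSpace d) :
    0 ≤ inducedDist μ x y := by
  unfold inducedDist
  split_ifs
  · exact le_rfl
  · exact measureReal_nonneg

/-- The induced distance satisfies the strong triangle inequality. -/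
theorem inducedDist_le_max {d : ℕ} (μ : Measure (DualSymSpace d)) [IsFiniteMeasure μ]
    (x y z : DualSymSpace d) :
    inducedDist μ x z ≤ max (inducedDist μ x y) (inducedDist μ y z) := by
  by_cases hxz : x = z
  · rw [hxz, inducedDist_self]
    exact le_max_of_le_left (inducedDist_nonneg _ _ _)
  by_cases hxy : x = y
  · rw [hxy]
    exact le_max_right _ _
  by_cases hyz : y = z
  · rw [hyz]
    exact le_max_left _ _
  rw [inducedDist, inducedDist, inducedDist, if_neg hxz, if_neg hxy, if_neg hyz, le_max_iff]
  rcases min_le_iff.1 (PiNat.min_firstDiff_le x y z hxz) with h | h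
  · exact Or.inl (measureReal_mono (PiNat.cylinder_anti x h))
  · right
    rw [PiNat.cylinder_eq_cylinder_of_le_firstDiff x z le_rfl,
      PiNat.cylinder_eq_cylinder_of_le_firstDiff y z le_rfl]
    exact measureReal_mono (PiNat.cylinder_anti z h)

/-- If `μ` has full support, distinct points have positive distance. -/
theorem inducedDist_pos {d : ℕ} (μ : Measure (DualSymSpace d)) [IsFiniteMeasure μ]
    [μ.IsOpenPosMeasure] {x y : DualSymSpace d} (h : x ≠ y) : 0 < inducedDist μ x y := by
  rw [inducedDist, if_neg h]
  exact ENNReal.toReal_pos ((PiNat.isOpen_cylinder _ x _).measure_pos μ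
    ⟨x, PiNat.self_mem_cylinder x _⟩).ne' (measure_ne_top _ _)

/-- The derivative of the shift at `x` in the metric induced by `μ` is `L`:
`d(σ y, σ x) / d(y, x) → L` as `y → x`. -/
def HasMetricDerivAt {d : ℕ} (μ : Measure (DualSymSpace d)) (x : DualSymSpace d) (L : ℝ) : Prop :=
  Tendsto (fun y => inducedDist μ (shift y) (shift x) / inducedDist μ y x) (𝓝[≠] x) (𝓝 L)

/-- The derivative of the shift at `x` expressed with cylinders:
`μ(σ[w_n]) / μ([w_n]) → L`, where `[w_n]` is the cylinder of length `n` about `x`. -/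
def HasCylinderDerivAt {d : ℕ} (μ : Measure (DualSymSpace d)) (x : DualSymSpace d) (L : ℝ) : Prop :=
  Tendsto (fun n : ℕ => μ.real (shift '' PiNat.cylinder x n) / μ.real (PiNat.cylinder x n))
    atTop (𝓝 L)

/-- Hölder continuity on the dual symbolic space, in terms of the number of common digits. -/
def IsSymbolicHolder {d : ℕ} (φ : DualSymSpace d → ℝ) : Prop :=
  ∃ C : ℝ, 0 < C ∧ ∃ τ : ℝ, 0 < τ ∧ τ < 1 ∧
    ∀ (n : ℕ) (x y : DualSymSpace d), (∀ k < n, x k = y k) → |φ x - φ y| ≤ C * τ ^ n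

/-- Hölder continuity with respect to the metric induced by `μ`. -/
def IsInducedHolder {d : ℕ} (μ : Measure (DualSymSpace d)) (φ : DualSymSpace d → ℝ) : Prop :=
  ∃ C : ℝ, 0 < C ∧ ∃ β : ℝ, 0 < β ∧ β ≤ 1 ∧
    ∀ x y : DualSymSpace d, |φ x - φ y| ≤ C * inducedDist μ x y ^ β

/-! ## Entropy, pressure, Gibbs measures and equilibrium states -/

/-- The entropy of the finite partition of `X` into the fibres of `p`. -/
def partitionEntropy {X ι : Type*} [MeasurableSpace X] [Fintype ι] (ν : Measure X) (p : X → ι) :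
    ℝ :=
  ∑ a : ι, Real.negMulLog (ν.real (p ⁻¹' {a}))

/-- The measure-theoretic (Kolmogorov–Sinai) entropy `h_ν(T)`: the supremum over all finite
measurable partitions `p` of `lim (1/n) H(p ∨ T⁻¹ p ∨ ⋯ ∨ T^{-(n-1)} p)`
(the limit exists when `ν` is `T`-invariant). -/
def ksEntropy {X : Type*} [MeasurableSpace X] (T : X → X) (ν : Measure X) : EReal :=
  ⨆ (k : ℕ) (p : X → Fin k) (_ : Measurable p),
    limsup (fun n : ℕ =>
      ((partitionEntropy ν (fun x (i : Fin n) => p (T^[i] x)) / n : ℝ) : EReal)) atTop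

/-- `h_ν(σ) + ∫ φ dν`. -/
def freeEnergy {d : ℕ} (φ : (ℕ → Fin d) → ℝ) (ν : Measure (ℕ → Fin d)) : EReal :=
  ksEntropy shift ν + ((∫ x, φ x ∂ν : ℝ) : EReal)

/-- `ν` is a shift-invariant Borel probability measure. -/
structure IsInvariantProb {d : ℕ} (ν : Measure (ℕ → Fin d)) : Prop where
  prob : IsProbabilityMeasure ν
  invariant : MeasurePreserving shift ν ν

/-- The Birkhoff sum `∑_{i<n} φ(σ^i x)`. -/
def birkhoff {d : ℕ} (φ : (ℕ → Fin d) → ℝ) (n : ℕ) (x : ℕ → Fin d) : ℝ :=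
  ∑ i ∈ Finset.range n, φ (shift^[i] x)

/-- The topological pressure of the continuous potential `φ` is `P`:
`(1/n) log ∑_w sup_{[w]} exp (∑_{i<n} φ ∘ σ^i) → P`, the sum being over all words of length `n`. -/
def HasPressure {d : ℕ} (φ : (ℕ → Fin d) → ℝ) (P : ℝ) : Prop :=
  Tendsto (fun n : ℕ =>
    Real.log (∑ w : Fin n → Fin d,
      sSup ((fun x => Real.exp (birkhoff φ n x)) '' {x | ∀ i : Fin n, x i = w i})) / n)
    atTop (𝓝 P)

/-- `μ` is a Gibbs measure for the potential `φ`, with the constant `P` (the pressure). -/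
structure IsGibbsMeasure {d : ℕ} (φ : (ℕ → Fin d) → ℝ) (P : ℝ) (μ : Measure (ℕ → Fin d)) :
    Prop where
  invariantProb : IsInvariantProb μ
  gibbs : ∃ C : ℝ, 0 < C ∧ ∀ (n : ℕ) (x : ℕ → Fin d),
    C⁻¹ ≤ μ.real (PiNat.cylinder x n) / Real.exp (-P * n + birkhoff φ n x) ∧
      μ.real (PiNat.cylinder x n) / Real.exp (-P * n + birkhoff φ n x) ≤ C

/-- `μ` is an equilibrium state for `φ` with value `P`:
`P = h_μ(σ) + ∫ φ dμ = sup {h_ν(σ) + ∫ φ dν | ν invariant}`. -/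
structure IsEquilibriumState {d : ℕ} (φ : (ℕ → Fin d) → ℝ) (P : ℝ) (μ : Measure (ℕ → Fin d)) :
    Prop where
  invariantProb : IsInvariantProb μ
  value : freeEnergy φ μ = (P : EReal)
  isLUB : IsLUB {e : EReal | ∃ ν : Measure (ℕ → Fin d), IsInvariantProb ν ∧ e = freeEnergy φ ν}
    (P : EReal)

/-- The transfer operator `(L_g φ)(x) = ∑_{σ y = x} g(y) φ(y)`. -/
def transfer {d : ℕ} (g φ : (ℕ → Fin d) → ℝ) (x : ℕ → Fin d) : ℝ :=
  ∑ j : Fin d, g (prepend j x) * φ (prepend j x)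

/-- `g` is a `g`-function: continuous, nonnegative, and `∑_{σ y = x} g(y) = 1`. -/
structure IsGFunction {d : ℕ} (g : (ℕ → Fin d) → ℝ) : Prop where
  continuous : Continuous g
  nonneg : ∀ x, 0 ≤ g x
  sum_eq_one : ∀ x, ∑ j : Fin d, g (prepend j x) = 1

/-- `μ` is a `g`-measure for the `g`-function `g`: a probability measure with `L_g^* μ = μ`. -/
structure IsGMeasure {d : ℕ} (g : (ℕ → Fin d) → ℝ) (μ : Measure (ℕ → Fin d)) : Prop where
  isGFunction : IsGFunction g
  prob : IsProbabilityMeasure μ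
  fixed : ∀ φ : (ℕ → Fin d) → ℝ, Continuous φ → ∫ x, transfer g φ x ∂μ = ∫ x, φ x ∂μ

/-- The measure `L_1^* μ`, that is, `B ↦ ∑_j μ(σ(B ∩ [j]))`. -/
def tildeMeasure {d : ℕ} (μ : Measure (ℕ → Fin d)) : Measure (ℕ → Fin d) :=
  ∑ j : Fin d, μ.map (prepend j)

/-- `μ` (on the dual symbolic space) is the dual of `m` (on the symbolic space): the right cylinder
of `j_{n-1} ⋯ j₀` has the `μ`-measure that the left cylinder of the same word has for `m`. -/
def IsDualMeasure {d : ℕ} (m : Measure (SymSpace d)) (μ : Measure (DualSymSpace d)) : Prop :=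
  ∀ (n : ℕ) (j : Fin n → Fin d),
    μ {x | ∀ i : Fin n, x i = j i} = m {w | ∀ i : Fin n, w i = j i.rev}

end

end DualGibbs

open DualGibbs

/-! Everything is reduced to the single function `g = 1 / Ψ`. Prolonging a word on the left by one
digit pulls its interval back by a branch of `F⁻¹`, so by the mean value theorem its length is
divided by a value of `F'`. In the quotient `|I_v| / |I_{vj}|` the two values of `F'` are taken in
one short interval, and `log F'` is Hölder while interval lengths decay exponentially. Hence the
logarithms of the quotients form a Cauchy sequence with geometric rate (`exists_tendsto_logRatio`),
the limit `log Ψ` is Hölder, and, since the intervals `I_{vj}` tile `I_v`, the values of `1 / Ψ` at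
the preimages of a point add up to one. So `g` is a positive Hölder `g`-function
(`IsDualDerivative.isHolderG`).

For such a `g`, bounded distortion makes the iterates of the transfer operator contract
oscillations. This gives existence and uniqueness of the `g`-measure `μ`. Testing `L_g^* μ = μ` on
cylinders expresses `μ [x_{n+1}]` as the integral of `y ↦ g (x₀ y)` over the cylinder `[(σx)_n]`:
this yields the derivative of the shift, and in iterated form the Gibbs bounds. Conversely, a
measure with derivative `1 / g` at every point satisfies `L_g^* ν = ν`, by a differentiation
argument along cylinders (`eq_of_tendsto_ratio`), so it is `μ`.

Gibbs measures mix cylinders up to a constant factor, hence are ergodic; two of them for one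
potential and one constant are mutually comparable, hence equal. The duality with `f` holds because
the interval of a word can be measured in two ways: stripping digits on the right approximates `log
|I_w|` by a Birkhoff sum of `-log Ψ`, stripping them on the left by one of `-log F'`. Reversing the
digits of `μ` thus gives the Gibbs measure of `log ψ_f`.

For the variational principle, Gibbs' inequality against `μ` bounds the cylinder entropies of any
invariant `ν`, and the Kolmogorov–Sinai entropy is at most every increment of the cylinder
entropies. If `ν` attains the supremum, the relative entropy between `ν` and its one-step prediction
by `g` on long cylinders tends to zero; Pinsker's inequality then makes `ν` a `g`-measure, so `ν =
μ`. -/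

namespace DualGibbs

/-! ## Words, cylinders and continuous functions -/

section Words

variable {d : ℕ}

/-- The word of the first `n` digits. -/
def pre (n : ℕ) (x : ℕ → Fin d) : Fin n → Fin d := fun i => x i

/-- The word `w` followed by the sequence `x`. -/
def app {n : ℕ} (w : Fin n → Fin d) (x : ℕ → Fin d) : ℕ → Fin d :=
  fun k => if h : k < n then w ⟨k, h⟩ else x (k - n)

theorem pre_app {n : ℕ} (w : Fin n → Fin d) (x : ℕ → Fin d) : pre n (app w x) = w := by
  ext i
  simp [pre, app]

theorem app_zero (w : Fin 0 → Fin d) (x : ℕ → Fin d) : app w x = x := by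
  funext k
  exact dif_neg (Nat.not_lt_zero k)

theorem app_cons {n : ℕ} (j : Fin d) (w : Fin n → Fin d) (x : ℕ → Fin d) :
    app (Fin.cons j w : Fin (n + 1) → Fin d) x = prepend j (app w x) := by
  funext k
  cases k with
  | zero => simp [app, prepend]
  | succ k =>
    by_cases h : k < n
    · simp only [app, prepend, h, Nat.succ_lt_succ h, dite_true]
      exact Fin.cons_succ (α := fun _ => Fin d) j w ⟨k, h⟩
    · simp [app, prepend, h]

theorem shift_prepend (j : Fin d) (x : ℕ → Fin d) : shift (prepend j x) = x := rfl

theorem prepend_shift (x : ℕ → Fin d) : prepend (x 0) (shift x) = x := by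
  funext k
  cases k <;> rfl

theorem shift_iterate_apply (n : ℕ) (x : ℕ → Fin d) (k : ℕ) : shift^[n] x k = x (k + n) := by
  induction n generalizing x k with
  | zero => rfl
  | succ n ih => rw [Function.iterate_succ_apply, ih]; rfl

theorem shift_iterate_app {n : ℕ} (w : Fin n → Fin d) (x : ℕ → Fin d) :
    shift^[n] (app w x) = x := by
  funext k
  simp [shift_iterate_apply, app]

theorem pre_eq_iff {n : ℕ} {x y : ℕ → Fin d} : pre n x = pre n y ↔ ∀ k < n, x k = y k :=
  ⟨fun h k hk => congrFun h ⟨k, hk⟩, fun h => funext fun i => h i i.2⟩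

theorem mem_cylinder_iff_pre {n : ℕ} {x y : ℕ → Fin d} :
    y ∈ PiNat.cylinder x n ↔ pre n y = pre n x := by
  rw [pre_eq_iff]; rfl

theorem cylinder_eq_preimage (n : ℕ) (x : ℕ → Fin d) :
    PiNat.cylinder x n = pre n ⁻¹' {pre n x} := by
  ext y; rw [mem_cylinder_iff_pre]; rfl

theorem preimage_pre_eq_cylinder {n : ℕ} (w : Fin n → Fin d) (x : ℕ → Fin d) :
    pre n ⁻¹' {w} = PiNat.cylinder (app w x) n := by
  rw [cylinder_eq_preimage, pre_app]

theorem cylinder_congr {n : ℕ} {x y : ℕ → Fin d} (h : pre n x = pre n y) :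
    PiNat.cylinder x n = PiNat.cylinder y n := by
  rw [cylinder_eq_preimage, cylinder_eq_preimage, h]

theorem mem_cylinder_succ {n : ℕ} {x y : ℕ → Fin d} :
    y ∈ PiNat.cylinder x (n + 1) ↔ y 0 = x 0 ∧ shift y ∈ PiNat.cylinder (shift x) n := by
  refine ⟨fun h => ⟨h 0 (by omega), fun k hk => h (k + 1) (by omega)⟩, fun h k hk => ?_⟩
  cases k with
  | zero => exact h.1
  | succ k => exact h.2 k (by omega)

theorem shift_image_cylinder_succ (n : ℕ) (x : ℕ → Fin d) :
    shift '' PiNat.cylinder x (n + 1) = PiNat.cylinder (shift x) n := by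
  ext y
  constructor
  · rintro ⟨z, hz, rfl⟩
    exact (mem_cylinder_succ.1 hz).2
  · intro hy
    exact ⟨prepend (x 0) y, mem_cylinder_succ.2 ⟨rfl, hy⟩, rfl⟩

theorem continuous_pre (n : ℕ) : Continuous (pre n : (ℕ → Fin d) → Fin n → Fin d) :=
  continuous_pi fun i => continuous_apply (i : ℕ)

theorem measurable_pre (n : ℕ) : Measurable (pre n : (ℕ → Fin d) → Fin n → Fin d) :=
  (continuous_pre n).measurable

theorem continuous_shift : Continuous (shift : (ℕ → Fin d) → ℕ → Fin d) :=
  continuous_pi fun k => continuous_apply (k + 1)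

theorem measurable_shift : Measurable (shift : (ℕ → Fin d) → ℕ → Fin d) :=
  continuous_shift.measurable

theorem continuous_prepend (j : Fin d) : Continuous (prepend j) := by
  refine continuous_pi fun k => ?_
  cases k with
  | zero => exact continuous_const
  | succ k => exact continuous_apply k

theorem measurable_prepend (j : Fin d) : Measurable (prepend j) :=
  (continuous_prepend j).measurable

theorem continuous_app {n : ℕ} (w : Fin n → Fin d) : Continuous (app w) := by
  refine continuous_pi fun k => ?_
  by_cases h : k < n
  · simp only [app, h, dite_true]; exact continuous_const
  · simp only [app, h, dite_false]; exact continuous_apply _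

theorem measurableSet_cylinder (x : ℕ → Fin d) (n : ℕ) : MeasurableSet (PiNat.cylinder x n) :=
  (PiNat.isOpen_cylinder _ x n).measurableSet

theorem isClopen_cylinder (x : ℕ → Fin d) (n : ℕ) : IsClopen (PiNat.cylinder x n) := by
  rw [cylinder_eq_preimage]
  exact (isClopen_discrete _).preimage (continuous_pre n)

theorem sum_word_succ {n : ℕ} {M : Type*} [AddCommMonoid M] (F : (Fin (n + 1) → Fin d) → M) :
    ∑ w, F w = ∑ w : Fin n → Fin d, ∑ j : Fin d, F (Fin.cons j w) := by
  rw [← (Fin.consEquiv fun _ => Fin d).sum_comp, Fintype.sum_prod_type, Finset.sum_comm]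
  rfl

/-- A continuous function is uniformly close to its values on cylinders. -/
theorem exists_close_of_continuous {φ : (ℕ → Fin d) → ℝ} (hφ : Continuous φ) {ε : ℝ}
    (hε : 0 < ε) : ∃ N : ℕ, ∀ n ≥ N, ∀ x y : ℕ → Fin d, pre n x = pre n y → |φ x - φ y| < ε := by
  let : MetricSpace (ℕ → Fin d) := PiNat.metricSpace
  obtain ⟨δ, hδ, h⟩ := Metric.uniformContinuous_iff.1
    (CompactSpace.uniformContinuous_of_continuous hφ) ε hε
  obtain ⟨N, hN⟩ := exists_pow_lt_of_lt_one hδ (by norm_num : (1 / 2 : ℝ) < 1)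
  refine ⟨N, fun n hn x y hxy => h (lt_of_le_of_lt ?_ hN)⟩
  refine PiNat.mem_cylinder_iff_dist_le.1 (mem_cylinder_iff_pre.2 ?_)
  exact pre_eq_iff.2 fun k hk => pre_eq_iff.1 hxy k (by omega)

theorem exists_bound_of_continuous {φ : (ℕ → Fin d) → ℝ} (hφ : Continuous φ) :
    ∃ B : ℝ, 0 < B ∧ ∀ x, |φ x| ≤ B := by
  obtain ⟨B, hB⟩ := isCompact_univ.exists_bound_of_continuousOn hφ.continuousOn
  exact ⟨max B 1, by positivity, fun x => (hB x trivial).trans (le_max_left _ _)⟩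

theorem continuous_of_holder {φ : (ℕ → Fin d) → ℝ} (hφ : IsSymbolicHolder φ) : Continuous φ := by
  obtain ⟨C, hC, τ, h0, h1, h⟩ := hφ
  rw [continuous_iff_continuousAt]
  intro x
  rw [ContinuousAt, Metric.tendsto_nhds]
  intro ε hε
  have ht : Tendsto (fun n : ℕ => C * τ ^ n) atTop (𝓝 0) := by
    simpa using (tendsto_pow_atTop_nhds_zero_of_lt_one h0.le h1).const_mul C
  obtain ⟨n, hn⟩ := (ht.eventually (gt_mem_nhds hε)).exists
  filter_upwards [(PiNat.isOpen_cylinder _ x n).mem_nhds (PiNat.self_mem_cylinder x n)] with y hy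
  rw [Real.dist_eq]
  exact (h n y x hy).trans_lt hn

theorem integrable_of_continuous {φ : (ℕ → Fin d) → ℝ} (hφ : Continuous φ)
    (ν : Measure (ℕ → Fin d)) [IsFiniteMeasure ν] : Integrable φ ν := by
  obtain ⟨B, -, hB⟩ := exists_bound_of_continuous hφ
  exact Integrable.of_bound hφ.aestronglyMeasurable B (ae_of_all _ hB)

/-! ## Birkhoff sums -/

theorem birkhoff_zero (φ : (ℕ → Fin d) → ℝ) (x : ℕ → Fin d) : birkhoff φ 0 x = 0 := by
  simp [birkhoff]

theorem birkhoff_succ (φ : (ℕ → Fin d) → ℝ) (n : ℕ) (x : ℕ → Fin d) :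
    birkhoff φ (n + 1) x = φ x + birkhoff φ n (shift x) := by
  simp [birkhoff, Finset.sum_range_succ', add_comm]

theorem birkhoff_add (φ : (ℕ → Fin d) → ℝ) (m n : ℕ) (x : ℕ → Fin d) :
    birkhoff φ (m + n) x = birkhoff φ m x + birkhoff φ n (shift^[m] x) := by
  simp only [birkhoff, Finset.sum_range_add, ← Function.iterate_add_apply]
  congr 1
  exact Finset.sum_congr rfl fun i _ => by rw [add_comm]

theorem continuous_birkhoff {φ : (ℕ → Fin d) → ℝ} (hφ : Continuous φ) (n : ℕ) :
    Continuous (birkhoff φ n) :=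
  continuous_finsetSum _ fun i _ => hφ.comp (continuous_shift.iterate i)

/-- Bounded distortion of the Birkhoff sums of a Hölder function. -/
theorem exists_distortion {φ : (ℕ → Fin d) → ℝ} (hφ : IsSymbolicHolder φ) :
    ∃ D : ℝ, 0 ≤ D ∧ ∀ (n : ℕ) (x y : ℕ → Fin d), pre n x = pre n y →
      |birkhoff φ n x - birkhoff φ n y| ≤ D := by
  obtain ⟨C, hC, τ, h0, h1, h⟩ := hφ
  -- The factor `1 - τ ^ n` records the partial geometric sum, so that the induction closes exactly.
  have key : ∀ (n : ℕ) (x y : ℕ → Fin d), (∀ k < n, x k = y k) →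
      |birkhoff φ n x - birkhoff φ n y| ≤ C * (1 / (1 - τ)) * (1 - τ ^ n) := by
    intro n
    induction n with
    | zero => intro x y _; simp [birkhoff]
    | succ n ih =>
      intro x y hxy
      rw [birkhoff_succ, birkhoff_succ]
      have e1 := h (n + 1) x y hxy
      have e2 := ih (shift x) (shift y) fun k hk => hxy (k + 1) (by omega)
      have e3 : C * τ ^ (n + 1) ≤ C * τ ^ n := by
        have := pow_le_pow_of_le_one h0.le h1.le (Nat.le_succ n)
        gcongr
      have e4 : C * (1 / (1 - τ)) * (1 - τ ^ (n + 1))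
          = C * (1 / (1 - τ)) * (1 - τ ^ n) + C * τ ^ n := by
        have : (1 - τ) ≠ 0 := by linarith
        field_simp
        ring
      rw [e4]
      have := abs_add_le (φ x - φ y) (birkhoff φ n (shift x) - birkhoff φ n (shift y))
      rw [show φ x + birkhoff φ n (shift x) - (φ y + birkhoff φ n (shift y))
        = (φ x - φ y) + (birkhoff φ n (shift x) - birkhoff φ n (shift y)) by ring]
      linarith
  have hτ : 0 < 1 - τ := by linarith
  refine ⟨C * (1 / (1 - τ)), by positivity, fun n x y hxy =>
    (key n x y (pre_eq_iff.1 hxy)).trans ?_⟩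
  have : 0 ≤ τ ^ n := by positivity
  exact mul_le_of_le_one_right (by positivity) (by linarith)

/-! ## Measures and cylinders -/

theorem integral_comp_pre {n : ℕ} (ν : Measure (ℕ → Fin d)) [IsFiniteMeasure ν]
    (F : (Fin n → Fin d) → ℝ) :
    ∫ x, F (pre n x) ∂ν = ∑ w, ν.real (pre n ⁻¹' {w}) * F w := by
  rw [← integral_map (measurable_pre n).aemeasurable (Measurable.of_discrete).aestronglyMeasurable,
    integral_fintype Integrable.of_finite]
  refine Finset.sum_congr rfl fun w _ => ?_
  rw [map_measureReal_apply (measurable_pre n) (MeasurableSet.singleton w), smul_eq_mul]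

theorem sum_measureReal_pre (n : ℕ) (ν : Measure (ℕ → Fin d)) [IsProbabilityMeasure ν] :
    ∑ w, ν.real (pre n ⁻¹' {w}) = 1 := by
  have := integral_comp_pre (n := n) ν fun _ => 1
  simpa using this.symm

/-- Finite measures that are ordered on cylinders are ordered. -/
theorem le_of_cylinder_le {κ₁ κ₂ : Measure (ℕ → Fin d)} [IsFiniteMeasure κ₁] [IsFiniteMeasure κ₂]
    (h : ∀ (n : ℕ) (x : ℕ → Fin d), κ₁ (PiNat.cylinder x n) ≤ κ₂ (PiNat.cylinder x n)) :
    κ₁ ≤ κ₂ := by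
  have hclosed : ∀ K : Set (ℕ → Fin d), IsClosed K → κ₁ K ≤ κ₂ K := by
    intro K hK
    -- `U n` is the union of the cylinders of length `n` that meet `K`. These sets decrease to `K`
    -- because `K` is closed, and each is a finite disjoint union of cylinders.
    let U : ℕ → Set (ℕ → Fin d) := fun n => pre n ⁻¹' (pre n '' K)
    have hU : ∀ n, MeasurableSet (U n) := fun n => measurable_pre n (Set.toFinite _).measurableSet
    have hanti : Antitone U := by
      refine antitone_nat_of_succ_le fun n => ?_
      rintro x ⟨y, hy, hxy⟩
      exact ⟨y, hy, pre_eq_iff.2 fun k hk => pre_eq_iff.1 hxy k (by omega)⟩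
    have hinter : ⋂ n, U n = K := by
      refine Set.Subset.antisymm (fun x hx => ?_) fun x hx => Set.mem_iInter.2 fun n => ⟨x, hx, rfl⟩
      by_contra hxK
      obtain ⟨s, ⟨z, n, rfl⟩, hxs, hs⟩ :=
        (PiNat.isTopologicalBasis_cylinders fun _ : ℕ => Fin d).exists_subset_of_mem_open
          (show x ∈ Kᶜ from hxK) hK.isOpen_compl
      obtain ⟨y, hy, hxy⟩ := Set.mem_iInter.1 hx n
      refine hs (a := y) ?_ hy
      rw [mem_cylinder_iff_pre] at hxs ⊢
      rw [hxy, hxs]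
    have hle : ∀ n, κ₁ (U n) ≤ κ₂ (U n) := by
      intro n
      have hsum : ∀ κ : Measure (ℕ → Fin d),
          κ (U n) = ∑ w ∈ (Set.toFinite (pre n '' K)).toFinset, κ (pre n ⁻¹' {w}) := by
        intro κ
        rw [sum_measure_preimage_singleton _ fun w _ => measurable_pre n (MeasurableSet.singleton w)]
        simp [U]
      rw [hsum, hsum]
      refine Finset.sum_le_sum fun w hw => ?_
      obtain ⟨y, -, rfl⟩ := (Set.Finite.mem_toFinset _).1 hw
      rw [← cylinder_eq_preimage]
      exact h n y
    have t : ∀ κ : Measure (ℕ → Fin d), IsFiniteMeasure κ →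
        Tendsto (fun n => κ (U n)) atTop (𝓝 (κ K)) := by
      intro κ _
      rw [← hinter]
      exact tendsto_measure_iInter_atTop (fun n => (hU n).nullMeasurableSet) hanti
        ⟨0, measure_ne_top _ _⟩
    exact le_of_tendsto_of_tendsto' (t κ₁ ‹_›) (t κ₂ ‹_›) hle
  refine Measure.le_iff.2 fun s hs => ?_
  -- Inner regularity by closed sets passes from closed to measurable sets.
  rw [hs.measure_eq_iSup_isClosed_of_ne_top (measure_ne_top _ _)]
  exact iSup₂_le fun K hKs => iSup_le fun hK => (hclosed K hK).trans (measure_mono hKs)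

theorem le_of_cylinder_real_le {κ₁ κ₂ : Measure (ℕ → Fin d)} [IsFiniteMeasure κ₁]
    [IsFiniteMeasure κ₂]
    (h : ∀ (n : ℕ) (x : ℕ → Fin d), κ₁.real (PiNat.cylinder x n) ≤ κ₂.real (PiNat.cylinder x n)) :
    κ₁ ≤ κ₂ :=
  le_of_cylinder_le fun n x =>
    (ENNReal.toReal_le_toReal (measure_ne_top _ _) (measure_ne_top _ _)).1 (h n x)

theorem eq_of_cylinder_real_eq {κ₁ κ₂ : Measure (ℕ → Fin d)} [IsFiniteMeasure κ₁]
    [IsFiniteMeasure κ₂]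
    (h : ∀ (n : ℕ) (x : ℕ → Fin d), κ₁.real (PiNat.cylinder x n) = κ₂.real (PiNat.cylinder x n)) :
    κ₁ = κ₂ :=
  le_antisymm (le_of_cylinder_real_le fun n x => (h n x).le)
    (le_of_cylinder_real_le fun n x => (h n x).ge)

theorem integral_indicator_cylinder (ν : Measure (ℕ → Fin d)) (x : ℕ → Fin d) (n : ℕ) :
    ∫ y, (PiNat.cylinder x n).indicator 1 y ∂ν = ν.real (PiNat.cylinder x n) :=
  integral_indicator_one (measurableSet_cylinder x n)

theorem continuous_indicator_cylinder (x : ℕ → Fin d) (n : ℕ) :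
    Continuous ((PiNat.cylinder x n).indicator (1 : (ℕ → Fin d) → ℝ)) :=
  continuous_one.indicator fun a ha => by rw [(isClopen_cylinder x n).frontier_eq] at ha; exact ha.elim

theorem integral_comp_shift {ν : Measure (ℕ → Fin d)} (hν : MeasurePreserving shift ν ν)
    (n : ℕ) {φ : (ℕ → Fin d) → ℝ} (hφ : StronglyMeasurable φ) :
    ∫ x, φ (shift^[n] x) ∂ν = ∫ x, φ x ∂ν := by
  conv_rhs => rw [← (hν.iterate n).map_eq]
  rw [integral_map (hν.iterate n).measurable.aemeasurable hφ.aestronglyMeasurable]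

end Words

/-! ## Transfer operators of positive Hölder `g`-functions -/

/-- A positive function with Hölder logarithm whose values at the preimages of a point add up
to one. -/
structure IsHolderG {d : ℕ} (g : (ℕ → Fin d) → ℝ) : Prop where
  pos : ∀ x, 0 < g x
  holder : IsSymbolicHolder fun x => Real.log (g x)
  sum_eq_one : ∀ x, ∑ j : Fin d, g (prepend j x) = 1

section Transfer

variable {d : ℕ} {g : (ℕ → Fin d) → ℝ}

theorem IsHolderG.continuous_log (hg : IsHolderG g) : Continuous fun x => Real.log (g x) :=
  continuous_of_holder hg.holder

theorem IsHolderG.continuous (hg : IsHolderG g) : Continuous g := by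
  have : g = fun x => Real.exp (Real.log (g x)) := funext fun x => (Real.exp_log (hg.pos x)).symm
  rw [this]
  exact Real.continuous_exp.comp hg.continuous_log

theorem IsHolderG.isGFunction (hg : IsHolderG g) : IsGFunction g :=
  ⟨hg.continuous, fun x => (hg.pos x).le, hg.sum_eq_one⟩

theorem continuous_transfer (hg : Continuous g) {φ : (ℕ → Fin d) → ℝ} (hφ : Continuous φ) :
    Continuous (transfer g φ) :=
  continuous_finsetSum _ fun j _ =>
    (hg.comp (continuous_prepend j)).mul (hφ.comp (continuous_prepend j))

theorem continuous_transfer_iterate (hg : Continuous g) {φ : (ℕ → Fin d) → ℝ}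
    (hφ : Continuous φ) (n : ℕ) : Continuous ((transfer g)^[n] φ) := by
  induction n generalizing φ with
  | zero => exact hφ
  | succ n ih => exact ih (continuous_transfer hg hφ)

theorem exp_birkhoff_succ (hg : IsHolderG g) (n : ℕ) (x : ℕ → Fin d) :
    Real.exp (birkhoff (fun x => Real.log (g x)) (n + 1) x)
      = g x * Real.exp (birkhoff (fun x => Real.log (g x)) n (shift x)) := by
  rw [birkhoff_succ, Real.exp_add, Real.exp_log (hg.pos x)]

theorem transfer_iterate (hg : IsHolderG g) (n : ℕ) (φ : (ℕ → Fin d) → ℝ) (x : ℕ → Fin d) :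
    (transfer g)^[n] φ x = ∑ w : Fin n → Fin d,
      Real.exp (birkhoff (fun x => Real.log (g x)) n (app w x)) * φ (app w x) := by
  induction n generalizing φ with
  | zero => simp [birkhoff_zero, app_zero]
  | succ n ih =>
    rw [Function.iterate_succ_apply, ih, sum_word_succ]
    refine Finset.sum_congr rfl fun w _ => ?_
    rw [transfer, Finset.mul_sum]
    refine Finset.sum_congr rfl fun j _ => ?_
    rw [app_cons, exp_birkhoff_succ hg, shift_prepend]
    ring

theorem transfer_iterate_one (hg : IsHolderG g) (n : ℕ) :
    (transfer g)^[n] (fun _ => 1) = fun _ => 1 := by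
  refine Function.iterate_fixed (funext fun x => ?_) n
  simp [transfer, hg.sum_eq_one]

theorem sum_exp_birkhoff (hg : IsHolderG g) (n : ℕ) (x : ℕ → Fin d) :
    ∑ w : Fin n → Fin d, Real.exp (birkhoff (fun x => Real.log (g x)) n (app w x)) = 1 := by
  have := transfer_iterate hg n (fun _ => 1) x
  rw [transfer_iterate_one hg] at this
  simpa using this.symm

/-- The transfer operator contracts oscillations, up to a small error. -/
theorem exists_osc_transfer_le (hg : IsHolderG g) :
    ∃ c : ℝ, 0 < c ∧ c ≤ 1 ∧ ∀ φ : (ℕ → Fin d) → ℝ, Continuous φ → ∀ B : ℝ,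
      (∀ x y, φ x - φ y ≤ B) → ∀ ε > 0, ∃ N : ℕ, ∀ n ≥ N, ∀ x y,
        (transfer g)^[n] φ x - (transfer g)^[n] φ y ≤ (1 - c) * B + ε := by
  obtain ⟨D, hD, hdist⟩ := exists_distortion hg.holder
  have hc1 : Real.exp (-D) ≤ 1 := Real.exp_le_one_iff.2 (by linarith)
  refine ⟨Real.exp (-D), Real.exp_pos _, hc1, fun φ hφ B hB ε hε => ?_⟩
  set c := Real.exp (-D) with hc
  obtain ⟨N, hN⟩ := exists_close_of_continuous hφ hε
  refine ⟨N, fun n hn x y => ?_⟩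
  rw [transfer_iterate hg, transfer_iterate hg]
  set p : (Fin n → Fin d) → ℝ :=
    fun w => Real.exp (birkhoff (fun x => Real.log (g x)) n (app w x)) with hp
  set q : (Fin n → Fin d) → ℝ :=
    fun w => Real.exp (birkhoff (fun x => Real.log (g x)) n (app w y)) with hq
  have hp1 : ∑ w, p w = 1 := sum_exp_birkhoff hg n x
  have hq1 : ∑ w, q w = 1 := sum_exp_birkhoff hg n y
  have hq0 : ∀ w, 0 ≤ q w := fun w => (Real.exp_pos _).le
  -- Bounded distortion: the weights seen from `x` dominate `c` times those seen from `y`. This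
  -- common mass `c` can be matched word by word.
  have hpq : ∀ w, 0 ≤ p w - c * q w := by
    intro w
    have := (abs_le.1 (hdist n (app w x) (app w y) (by rw [pre_app, pre_app]))).1
    rw [sub_nonneg, hc, hp, hq]
    simp only
    rw [← Real.exp_add]
    exact Real.exp_le_exp.2 (by linarith)
  set S := ∑ w, q w * φ (app w y) with hS
  -- The unmatched mass `1 - c` contributes at most the full oscillation `B`; the matched part,
  -- estimated next, compares `φ` within one cylinder and costs at most `ε`.
  have h1 : ∑ w, (p w - c * q w) * (φ (app w x) - S) ≤ ∑ w, (p w - c * q w) * B := by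
    refine Finset.sum_le_sum fun w _ => mul_le_mul_of_nonneg_left ?_ (hpq w)
    have : φ (app w x) - S = ∑ v, q v * (φ (app w x) - φ (app v y)) := by
      simp only [mul_sub, Finset.sum_sub_distrib, ← Finset.sum_mul, hq1, one_mul, hS]
    rw [this]
    calc _ ≤ ∑ v, q v * B := Finset.sum_le_sum fun v _ => mul_le_mul_of_nonneg_left (hB _ _) (hq0 v)
      _ = B := by rw [← Finset.sum_mul, hq1, one_mul]
  have h2 : ∑ w, c * (q w * (φ (app w x) - φ (app w y))) ≤ ε := by
    rw [← Finset.mul_sum]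
    have : ∑ w, q w * (φ (app w x) - φ (app w y)) ≤ ε := by
      calc _ ≤ ∑ v, q v * ε := Finset.sum_le_sum fun v _ => mul_le_mul_of_nonneg_left
            (le_of_abs_le (hN n hn _ _ (by rw [pre_app, pre_app])).le) (hq0 v)
        _ = ε := by rw [← Finset.sum_mul, hq1, one_mul]
    nlinarith [Real.exp_pos (-D)]
  have h3 : ∑ w, (p w - c * q w) = 1 - c := by
    rw [Finset.sum_sub_distrib, ← Finset.mul_sum, hp1, hq1, mul_one]
  have h4 : ∑ w, p w * φ (app w x) - S = ∑ w, (p w - c * q w) * (φ (app w x) - S)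
      + ∑ w, c * (q w * (φ (app w x) - φ (app w y))) := by
    have e : ∀ w, (p w - c * q w) * (φ (app w x) - S) + c * (q w * (φ (app w x) - φ (app w y)))
        = p w * φ (app w x) - (p w - c * q w) * S - c * (q w * φ (app w y)) := fun w => by ring
    rw [← Finset.sum_add_distrib, Finset.sum_congr rfl fun w _ => e w, Finset.sum_sub_distrib,
      Finset.sum_sub_distrib, ← Finset.sum_mul, h3, ← Finset.mul_sum, ← hS]
    ring
  rw [← Finset.sum_mul, h3] at h1
  linarith

/-- The iterates of the transfer operator become uniformly constant. -/
theorem exists_osc_transfer_le_eps (hg : IsHolderG g) {φ : (ℕ → Fin d) → ℝ} (hφ : Continuous φ)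
    {ε : ℝ} (hε : 0 < ε) : ∃ N : ℕ, ∀ n ≥ N, ∀ x y,
      |(transfer g)^[n] φ x - (transfer g)^[n] φ y| ≤ ε := by
  obtain ⟨c, hc0, hc1, hc⟩ := exists_osc_transfer_le hg
  obtain ⟨B, hB0, hB⟩ := exists_bound_of_continuous hφ
  have key : ∀ k : ℕ, ∃ N : ℕ, ∀ n ≥ N, ∀ x y,
      (transfer g)^[n] φ x - (transfer g)^[n] φ y ≤ (1 - c / 2) ^ k * (2 * B) := by
    intro k
    induction k with
    | zero =>
      obtain ⟨N, hN⟩ := hc φ hφ (2 * B)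
        (fun x y => by linarith [(abs_le.1 (hB x)).2, (abs_le.1 (hB y)).1]) (c * (2 * B))
        (by positivity)
      exact ⟨N, fun n hn x y => (hN n hn x y).trans (by linarith)⟩
    | succ k ih =>
      obtain ⟨N, hN⟩ := ih
      have hpos : 0 < (1 - c / 2) ^ k * (2 * B) := by
        have : 0 < 1 - c / 2 := by linarith
        positivity
      -- The allowed error is `c / 2` times the current bound, so each round still contracts by `1 -
      -- c / 2`.
      obtain ⟨M, hM⟩ := hc _ (continuous_transfer_iterate hg.continuous hφ N) _ (hN N le_rfl)
        (c / 2 * ((1 - c / 2) ^ k * (2 * B))) (by positivity)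
      refine ⟨M + N, fun n hn x y => ?_⟩
      have := hM (n - N) (by omega) x y
      rw [← Function.iterate_add_apply, Nat.sub_add_cancel (by omega)] at this
      refine this.trans (le_of_eq ?_)
      ring
  have ht : Tendsto (fun k : ℕ => (1 - c / 2) ^ k * (2 * B)) atTop (𝓝 0) := by
    simpa using (tendsto_pow_atTop_nhds_zero_of_lt_one (r := 1 - c / 2) (by linarith)
      (by linarith)).mul_const (2 * B)
  obtain ⟨k, hk⟩ := (ht.eventually (gt_mem_nhds hε)).exists
  obtain ⟨N, hN⟩ := key k
  exact ⟨N, fun n hn x y => abs_le.2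
    ⟨by linarith [hN n hn y x], (hN n hn x y).trans hk.le⟩⟩

theorem abs_integral_sub_le {ν : Measure (ℕ → Fin d)} [IsProbabilityMeasure ν]
    {F : (ℕ → Fin d) → ℝ} {c ε : ℝ} (h : ∀ x, |F x - c| ≤ ε) (hF : Continuous F) :
    |∫ x, F x ∂ν - c| ≤ ε := by
  have : ∫ x, F x ∂ν - c = ∫ x, (F x - c) ∂ν := by
    rw [integral_sub (integrable_of_continuous hF ν) (integrable_const c)]
    simp
  rw [this, ← Real.norm_eq_abs]
  simpa using norm_integral_le_of_norm_le_const (μ := ν) (f := fun x => F x - c)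
    (ae_of_all _ h)

theorem IsGMeasure.integral_iterate {ν : Measure (ℕ → Fin d)} (hν : IsGMeasure g ν)
    {φ : (ℕ → Fin d) → ℝ} (hφ : Continuous φ) (n : ℕ) :
    ∫ x, (transfer g)^[n] φ x ∂ν = ∫ x, φ x ∂ν := by
  induction n generalizing φ with
  | zero => rfl
  | succ n ih =>
    rw [Function.iterate_succ_apply, ih (continuous_transfer hν.isGFunction.continuous hφ),
      hν.fixed φ hφ]

/-- Neither integral changes when the test function is replaced by a high iterate of the transfer
operator, and that iterate is almost the constant given by its value at `z`. -/
theorem IsGMeasure.eq {μ ν : Measure (ℕ → Fin d)} (hg : IsHolderG g) (hμ : IsGMeasure g μ)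
    (hν : IsGMeasure g ν) : μ = ν := by
  have := hμ.prob
  have := hν.prob
  refine ext_of_forall_integral_eq_of_IsFiniteMeasure fun f => ?_
  obtain ⟨z⟩ : Nonempty (ℕ → Fin d) := nonempty_of_isProbabilityMeasure μ
  refine eq_of_forall_dist_le fun ε hε => ?_
  rw [Real.dist_eq]
  obtain ⟨N, hN⟩ := exists_osc_transfer_le_eps hg f.continuous (half_pos hε)
  have hc := continuous_transfer_iterate hg.continuous f.continuous N
  have h1 := abs_integral_sub_le (ν := μ) (fun x => hN N le_rfl x z) hc
  have h2 := abs_integral_sub_le (ν := ν) (fun x => hN N le_rfl x z) hc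
  rw [hμ.integral_iterate f.continuous] at h1
  rw [hν.integral_iterate f.continuous] at h2
  rw [abs_le] at *
  constructor <;> linarith

/-- Compactness of the space of probability measures; a limit along an ultrafilter replaces the
choice of a subsequence. -/
theorem exists_tendsto_hyperfilter (μs : ℕ → ProbabilityMeasure (ℕ → Fin d)) :
    ∃ μ : ProbabilityMeasure (ℕ → Fin d), Tendsto μs (hyperfilter ℕ) (𝓝 μ) := by
  let : Nonempty (ProbabilityMeasure (ℕ → Fin d)) := ⟨μs 0⟩
  exact ⟨_, ((hyperfilter ℕ).map μs).le_nhds_lim⟩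

theorem tendsto_integral_of_tendsto {μs : ℕ → ProbabilityMeasure (ℕ → Fin d)}
    {μ : ProbabilityMeasure (ℕ → Fin d)} {l : Filter ℕ} (h : Tendsto μs l (𝓝 μ))
    {φ : (ℕ → Fin d) → ℝ} (hφ : Continuous φ) :
    Tendsto (fun n => ∫ x, φ x ∂(μs n : Measure (ℕ → Fin d))) l
      (𝓝 (∫ x, φ x ∂(μ : Measure (ℕ → Fin d)))) :=
  ProbabilityMeasure.tendsto_iff_forall_integral_tendsto.1 h
    (BoundedContinuousFunction.mkOfCompact ⟨φ, hφ⟩)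

/-- The measure is a limit point of the dual iterates of the Dirac mass at `z`. No averaging is
needed: `L^{n+1} φ z - L^n φ z` is a weighted mean of differences of values of `L^n φ`, which tend
to zero uniformly. -/
theorem exists_isGMeasure [NeZero d] (hg : IsHolderG g) : ∃ μ, IsGMeasure g μ := by
  let z : ℕ → Fin d := fun _ => 0
  let p : (n : ℕ) → (Fin n → Fin d) → ℝ :=
    fun n w => Real.exp (birkhoff (fun x => Real.log (g x)) n (app w z))
  have hp : ∀ n w, 0 ≤ p n w := fun n w => (Real.exp_pos _).le
  let κ : ℕ → Measure (ℕ → Fin d) :=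
    fun n => ∑ w : Fin n → Fin d, ENNReal.ofReal (p n w) • Measure.dirac (app w z)
  have hκ : ∀ n, IsProbabilityMeasure (κ n) := by
    intro n
    refine ⟨?_⟩
    simp only [κ, Measure.coe_finsetSum, Finset.sum_apply, Measure.smul_apply, measure_univ,
      smul_eq_mul, mul_one]
    rw [← ENNReal.ofReal_sum_of_nonneg fun w _ => hp n w, sum_exp_birkhoff hg, ENNReal.ofReal_one]
  have hint : ∀ n (φ : (ℕ → Fin d) → ℝ), ∫ x, φ x ∂κ n = (transfer g)^[n] φ z := by
    intro n φ
    rw [transfer_iterate hg, integral_finsetSum_measure]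
    · refine Finset.sum_congr rfl fun w _ => ?_
      rw [integral_smul_measure, integral_dirac, ENNReal.toReal_ofReal (hp n w), smul_eq_mul]
    · exact fun w _ => (integrable_dirac (by simp)).smul_measure ENNReal.ofReal_ne_top
  obtain ⟨μ, hμ⟩ := exists_tendsto_hyperfilter fun n => (⟨κ n, hκ n⟩ : ProbabilityMeasure _)
  refine ⟨μ, hg.isGFunction, inferInstance, fun φ hφ => ?_⟩
  have h1 := tendsto_integral_of_tendsto hμ (continuous_transfer hg.continuous hφ)
  have h2 := tendsto_integral_of_tendsto hμ hφ
  have h3 : Tendsto (fun n => (transfer g)^[n] (transfer g φ) z - (transfer g)^[n] φ z) atTop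
      (𝓝 0) := by
    rw [Metric.tendsto_atTop]
    intro ε hε
    obtain ⟨N, hN⟩ := exists_osc_transfer_le_eps hg hφ (half_pos hε)
    refine ⟨N, fun n hn => ?_⟩
    rw [dist_zero_right, Real.norm_eq_abs, ← Function.iterate_succ_apply,
      Function.iterate_succ_apply']
    have e : transfer g ((transfer g)^[n] φ) z - (transfer g)^[n] φ z = ∑ j : Fin d,
        g (prepend j z) * ((transfer g)^[n] φ (prepend j z) - (transfer g)^[n] φ z) := by
      simp only [transfer, mul_sub, Finset.sum_sub_distrib, ← Finset.sum_mul, hg.sum_eq_one, one_mul]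
    rw [e]
    refine (Finset.abs_sum_le_sum_abs _ _).trans_lt (lt_of_le_of_lt ?_ (half_lt_self hε))
    calc _ ≤ ∑ j : Fin d, g (prepend j z) * (ε / 2) := by
          refine Finset.sum_le_sum fun j _ => ?_
          rw [abs_mul, abs_of_pos (hg.pos _)]
          exact mul_le_mul_of_nonneg_left (hN n hn _ _) (hg.pos _).le
      _ = ε / 2 := by rw [← Finset.sum_mul, hg.sum_eq_one, one_mul]
  simp only [ProbabilityMeasure.coe_mk, hint] at h1 h2
  have h4 := tendsto_nhds_unique (h1.sub h2) (h3.mono_left Nat.hyperfilter_le_atTop)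
  exact sub_eq_zero.1 h4

end Transfer

/-! ## Uniqueness of Gibbs measures -/

section Gibbs

variable {d : ℕ}

theorem cylinder_inter_preimage (n m : ℕ) (x y : ℕ → Fin d) :
    PiNat.cylinder x n ∩ shift^[n] ⁻¹' PiNat.cylinder y m
      = PiNat.cylinder (app (pre n x) y) (n + m) := by
  ext z
  constructor
  · rintro ⟨h1, h2⟩ k hk
    by_cases hkn : k < n
    · simpa [app, pre, hkn] using h1 k hkn
    · have := h2 (k - n) (by omega)
      rw [shift_iterate_apply, Nat.sub_add_cancel (by omega)] at this
      simpa [app, hkn] using this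
  · intro h
    refine ⟨fun k hk => ?_, fun k hk => ?_⟩
    · simpa [app, pre, hk] using h k (by omega)
    · rw [shift_iterate_apply]
      simpa [app] using h (k + n) (by omega)

/-- Cylinders are mixed by the shift, up to a constant. -/
def IsQuasiBernoulli (μ : Measure (ℕ → Fin d)) : Prop :=
  ∃ c : ℝ, 0 < c ∧ ∀ (n m : ℕ) (x y : ℕ → Fin d),
    c * μ.real (PiNat.cylinder x n) * μ.real (PiNat.cylinder y m) ≤
      μ.real (PiNat.cylinder (app (pre n x) y) (n + m))

theorem measureReal_smul_ofReal {κ : Measure (ℕ → Fin d)} {c : ℝ} (hc : 0 ≤ c)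
    (s : Set (ℕ → Fin d)) : (ENNReal.ofReal c • κ).real s = c * κ.real s := by
  simp [measureReal_def, ENNReal.toReal_ofReal hc]

theorem isFiniteMeasure_smul_ofReal (κ : Measure (ℕ → Fin d)) [IsFiniteMeasure κ] (c : ℝ) :
    IsFiniteMeasure (ENNReal.ofReal c • κ) :=
  ⟨by simpa using ENNReal.mul_lt_top ENNReal.ofReal_lt_top (measure_lt_top κ _)⟩

/-- An invariant set `A` fills at least the proportion `c μ(A)` of every cylinder, hence of every
measurable set; applied to its complement this forces `A` to be null or conull. -/
theorem IsQuasiBernoulli.ergodic {μ : Measure (ℕ → Fin d)} (h : IsQuasiBernoulli μ)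
    (hμ : IsInvariantProb μ) : Ergodic shift μ := by
  have := hμ.prob
  obtain ⟨c, hc, h⟩ := h
  refine { hμ.invariant with aeconst_set := fun A hA hinv => ?_ }
  have hinvn : ∀ n, shift^[n] ⁻¹' A = A := by
    intro n
    induction n with
    | zero => rfl
    | succ n ih => rw [Function.iterate_succ, Set.preimage_comp, ih, hinv]
  -- The mixing inequality with the first cylinder fixed is a comparison of measures in the second
  -- variable, so the second cylinder may be replaced by `A`.
  have key1 : ∀ (n : ℕ) (x : ℕ → Fin d),
      ENNReal.ofReal (c * μ.real (PiNat.cylinder x n)) • μ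
        ≤ (μ.restrict (PiNat.cylinder x n)).map shift^[n] := by
    intro n x
    have := isFiniteMeasure_smul_ofReal μ (c * μ.real (PiNat.cylinder x n))
    refine le_of_cylinder_real_le fun m y => ?_
    rw [measureReal_smul_ofReal (by positivity), map_measureReal_apply (measurable_shift.iterate n)
      (measurableSet_cylinder y m), measureReal_restrict_apply
      (measurable_shift.iterate n (measurableSet_cylinder y m)), Set.inter_comm,
      cylinder_inter_preimage]
    exact h n m x y
  have key2 : ENNReal.ofReal (c * μ.real A) • μ ≤ μ.restrict A := by
    have := isFiniteMeasure_smul_ofReal μ (c * μ.real A)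
    refine le_of_cylinder_real_le fun n x => ?_
    have := isFiniteMeasure_smul_ofReal μ (c * μ.real (PiNat.cylinder x n))
    have h1 := ENNReal.toReal_mono (measure_ne_top _ _) (key1 n x A)
    rw [← measureReal_def, ← measureReal_def, measureReal_smul_ofReal (by positivity),
      map_measureReal_apply (measurable_shift.iterate n) hA, hinvn,
      measureReal_restrict_apply hA] at h1
    rw [measureReal_smul_ofReal (by positivity),
      measureReal_restrict_apply (measurableSet_cylinder x n), Set.inter_comm]
    linarith
  have h3 := key2 Aᶜ
  rw [Measure.restrict_apply hA.compl, Set.compl_inter_self, measure_empty, nonpos_iff_eq_zero,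
    Measure.smul_apply, smul_eq_mul, mul_eq_zero] at h3
  rcases h3 with h3 | h3
  · rw [ENNReal.ofReal_eq_zero] at h3
    have h4 : μ.real A = 0 := le_antisymm (by nlinarith [hc]) measureReal_nonneg
    rw [measureReal_eq_zero_iff] at h4
    exact (eventuallyConst_set'.2 (Or.inl (ae_eq_empty.2 h4)))
  · exact (eventuallyConst_set'.2 (Or.inr (ae_eq_univ.2 h3)))

/-- Domination on cylinders gives absolute continuity, and an ergodic measure is the only invariant
probability measure absolutely continuous with respect to itself. -/
theorem IsQuasiBernoulli.eq_of_le {μ ν : Measure (ℕ → Fin d)} (h : IsQuasiBernoulli μ)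
    (hμ : IsInvariantProb μ) (hν : IsInvariantProb ν) {K : ℝ} (hK : 0 ≤ K)
    (hle : ∀ n x, ν.real (PiNat.cylinder x n) ≤ K * μ.real (PiNat.cylinder x n)) : ν = μ := by
  have := hμ.prob
  have := hν.prob
  refine (h.ergodic hμ).eq_of_absolutelyContinuous hν.invariant ?_
  have := isFiniteMeasure_smul_ofReal μ K
  have hle' : ν ≤ ENNReal.ofReal K • μ := le_of_cylinder_real_le fun n x => by
    rw [measureReal_smul_ofReal hK]
    exact hle n x
  exact (Measure.absolutelyContinuous_of_le hle').trans Measure.smul_absolutelyContinuous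

theorem IsGibbsMeasure.exists_bounds {φ : (ℕ → Fin d) → ℝ} {P : ℝ} {μ : Measure (ℕ → Fin d)}
    (h : IsGibbsMeasure φ P μ) : ∃ C : ℝ, 0 < C ∧ ∀ (n : ℕ) (x : ℕ → Fin d),
      Real.exp (-P * n + birkhoff φ n x) ≤ C * μ.real (PiNat.cylinder x n) ∧
      μ.real (PiNat.cylinder x n) ≤ C * Real.exp (-P * n + birkhoff φ n x) := by
  obtain ⟨C, hC, h⟩ := h.gibbs
  refine ⟨C, hC, fun n x => ⟨?_, ?_⟩⟩
  · have := (h n x).1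
    rw [le_div_iff₀ (Real.exp_pos _), inv_mul_le_iff₀ hC] at this
    exact this
  · have := (h n x).2
    rwa [div_le_iff₀ (Real.exp_pos _)] at this

theorem IsGibbsMeasure.of_bounds {φ : (ℕ → Fin d) → ℝ} {μ : Measure (ℕ → Fin d)}
    (hμ : IsInvariantProb μ) {C : ℝ} (hC : 0 < C) (h : ∀ (n : ℕ) (x : ℕ → Fin d),
      Real.exp (birkhoff φ n x) ≤ C * μ.real (PiNat.cylinder x n) ∧
      μ.real (PiNat.cylinder x n) ≤ C * Real.exp (birkhoff φ n x)) : IsGibbsMeasure φ 0 μ := by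
  refine ⟨hμ, C, hC, fun n x => ?_⟩
  simp only [neg_zero, zero_mul, zero_add]
  constructor
  · rw [le_div_iff₀ (Real.exp_pos _), inv_mul_le_iff₀ hC]
    exact (h n x).1
  · rw [div_le_iff₀ (Real.exp_pos _)]
    exact (h n x).2

theorem IsGibbsMeasure.isQuasiBernoulli {φ : (ℕ → Fin d) → ℝ} {P : ℝ} {μ : Measure (ℕ → Fin d)}
    (hφ : IsSymbolicHolder φ) (h : IsGibbsMeasure φ P μ) : IsQuasiBernoulli μ := by
  obtain ⟨C, hC, h⟩ := h.exists_bounds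
  obtain ⟨D, hD, hdist⟩ := exists_distortion hφ
  -- One factor `C` for each of the three cylinders, and `exp D` for moving the first Birkhoff sum
  -- from `x` to the concatenated point.
  refine ⟨(C ^ 3 * Real.exp D)⁻¹, by positivity, fun n m x y => ?_⟩
  rw [mul_assoc, inv_mul_le_iff₀ (by positivity)]
  have h1 := (h n x).2
  have h2 := (h m y).2
  have h3 := (h (n + m) (app (pre n x) y)).1
  rw [birkhoff_add, shift_iterate_app] at h3
  have h4 := (abs_le.1 (hdist n x (app (pre n x) y) (pre_app _ _).symm)).2
  have h5 : Real.exp (-P * n + birkhoff φ n x) * Real.exp (-P * m + birkhoff φ m y)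
      ≤ Real.exp D * Real.exp (-P * (n + m : ℕ) +
        (birkhoff φ n (app (pre n x) y) + birkhoff φ m y)) := by
    rw [← Real.exp_add, ← Real.exp_add]
    refine Real.exp_le_exp.2 ?_
    push_cast
    linarith
  calc μ.real (PiNat.cylinder x n) * μ.real (PiNat.cylinder y m)
      ≤ (C * Real.exp (-P * n + birkhoff φ n x)) * (C * Real.exp (-P * m + birkhoff φ m y)) := by
        gcongr
    _ = C ^ 2 * (Real.exp (-P * n + birkhoff φ n x) * Real.exp (-P * m + birkhoff φ m y)) := by
        ring
    _ ≤ C ^ 2 * (Real.exp D * (C * μ.real (PiNat.cylinder (app (pre n x) y) (n + m)))) := by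
        exact mul_le_mul_of_nonneg_left
          (h5.trans (mul_le_mul_of_nonneg_left h3 (Real.exp_pos _).le)) (by positivity)
    _ = _ := by ring

theorem IsGibbsMeasure.eq {φ : (ℕ → Fin d) → ℝ} {P : ℝ} {μ ν : Measure (ℕ → Fin d)}
    (hφ : IsSymbolicHolder φ) (hμ : IsGibbsMeasure φ P μ) (hν : IsGibbsMeasure φ P ν) : ν = μ := by
  obtain ⟨C, hC, h⟩ := hμ.exists_bounds
  obtain ⟨C', hC', h'⟩ := hν.exists_bounds
  refine (hμ.isQuasiBernoulli hφ).eq_of_le hμ.invariantProb hν.invariantProb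
    (K := C' * C) (by positivity) fun n x => (h' n x).2.trans ?_
  rw [mul_assoc]
  exact mul_le_mul_of_nonneg_left (h n x).1 hC'.le

/-- Summing the comparison of the two measures over all words of length `n` gives `1 ≤ C C' exp ((Q
- P) n)` for every `n`, which excludes `Q < P`. -/
theorem IsGibbsMeasure.le_constant {φ : (ℕ → Fin d) → ℝ} {P Q : ℝ} {μ ν : Measure (ℕ → Fin d)}
    (hμ : IsGibbsMeasure φ P μ) (hν : IsGibbsMeasure φ Q ν) : P ≤ Q := by
  have := hμ.invariantProb.prob
  have := hν.invariantProb.prob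
  obtain ⟨z⟩ := nonempty_of_isProbabilityMeasure μ
  obtain ⟨C, hC, h⟩ := hμ.exists_bounds
  obtain ⟨C', hC', h'⟩ := hν.exists_bounds
  have key : ∀ n : ℕ, 1 ≤ C * C' * Real.exp ((Q - P) * n) := by
    intro n
    rw [← sum_measureReal_pre n μ]
    calc ∑ w, μ.real (pre n ⁻¹' {w})
        ≤ ∑ w, C * C' * Real.exp ((Q - P) * n) * ν.real (pre n ⁻¹' {w}) := by
          refine Finset.sum_le_sum fun w _ => ?_
          rw [preimage_pre_eq_cylinder w z]
          refine (h n _).2.trans ?_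
          have e : Real.exp (-P * n + birkhoff φ n (app w z))
              = Real.exp ((Q - P) * n) * Real.exp (-Q * n + birkhoff φ n (app w z)) := by
            rw [← Real.exp_add]; ring_nf
          rw [e]
          have := (h' n (app w z)).1
          calc C * (Real.exp ((Q - P) * n) * Real.exp (-Q * n + birkhoff φ n (app w z)))
              ≤ C * (Real.exp ((Q - P) * n) * (C' * ν.real (PiNat.cylinder (app w z) n))) := by
                gcongr
            _ = _ := by ring
      _ = C * C' * Real.exp ((Q - P) * n) := by
          rw [← Finset.mul_sum, sum_measureReal_pre, mul_one]
  by_contra! hlt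
  have ht : Tendsto (fun n : ℕ => C * C' * Real.exp ((Q - P) * n)) atTop (𝓝 (C * C' * 0)) := by
    refine Tendsto.const_mul _ (Real.tendsto_exp_atBot.comp ?_)
    exact tendsto_natCast_atTop_atTop.const_mul_atTop_of_neg (by linarith)
  have := ge_of_tendsto' ht key
  linarith

/-! ## Differentiation along cylinders -/

theorem cylinder_eq_iUnion (x : ℕ → Fin d) (n : ℕ) (κ : Measure (ℕ → Fin d)) [IsFiniteMeasure κ] :
    κ.real (PiNat.cylinder x n)
      = ∑ j : Fin d, κ.real (PiNat.cylinder (Function.update x n j) (n + 1)) := by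
  rw [← PiNat.iUnion_cylinder_update, measureReal_iUnion_fintype]
  · intro i j hij
    refine Set.disjoint_left.2 fun y hi hj => hij ?_
    have h1 := hi n (by omega)
    have h2 := hj n (by omega)
    simp only [Function.update_self] at h1 h2
    rw [← h1, h2]
  · exact fun j => measurableSet_cylinder _ _

/-- By additivity, a cylinder violating the inequality contains a violating cylinder with one more
digit. Descending through these yields a point at which the inequality fails for all large `n`. -/
theorem le_of_frequently_le {κ₁ κ₂ : Measure (ℕ → Fin d)} [IsFiniteMeasure κ₁]
    [IsFiniteMeasure κ₂] (h : ∀ x, ∃ᶠ n in atTop,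
      κ₁.real (PiNat.cylinder x n) ≤ κ₂.real (PiNat.cylinder x n)) : κ₁ ≤ κ₂ := by
  refine le_of_cylinder_real_le fun n x => ?_
  by_contra! hbad
  have step : ∀ (y : ℕ → Fin d) (m : ℕ),
      ∃ j : Fin d, κ₂.real (PiNat.cylinder y m) < κ₁.real (PiNat.cylinder y m) →
        κ₂.real (PiNat.cylinder (Function.update y m j) (m + 1))
          < κ₁.real (PiNat.cylinder (Function.update y m j) (m + 1)) := by
    intro y m
    by_contra! hcon
    have hlt := (hcon (y m)).1
    rw [cylinder_eq_iUnion, cylinder_eq_iUnion] at hlt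
    exact absurd (Finset.sum_le_sum fun j _ => (hcon j).2) (not_le.2 hlt)
  choose f hf using step
  let u : ℕ → ℕ → Fin d := fun k =>
    Nat.rec x (fun k y => Function.update y (n + k) (f y (n + k))) k
  have hu : ∀ k, u (k + 1) = Function.update (u k) (n + k) (f (u k) (n + k)) := fun _ => rfl
  have hb : ∀ k, κ₂.real (PiNat.cylinder (u k) (n + k)) < κ₁.real (PiNat.cylinder (u k) (n + k)) := by
    intro k
    induction k with
    | zero => exact hbad
    | succ k ih => rw [hu]; exact hf _ _ ih
  have hagree : ∀ k l, k ≤ l → ∀ i < n + k, u l i = u k i := by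
    intro k l hkl
    induction l, hkl using Nat.le_induction with
    | base => exact fun _ _ => rfl
    | succ l hkl ih =>
      intro i hi
      rw [hu, Function.update_of_ne (by omega), ih i hi]
  -- Digits below `n + k` are frozen from `u k` on, so digit `i` has its final value in `u (i + 1)`.
  let z : ℕ → Fin d := fun i => u (i + 1) i
  have hz : ∀ k, PiNat.cylinder z (n + k) = PiNat.cylinder (u k) (n + k) := by
    intro k
    refine cylinder_congr (pre_eq_iff.2 fun i hi => ?_)
    rcases le_total (i + 1) k with hik | hik
    · exact (hagree _ _ hik i (by omega)).symm
    · exact hagree _ _ hik i hi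
  obtain ⟨N, hN, hle⟩ := frequently_atTop.1 (h z) n
  obtain ⟨k, rfl⟩ := Nat.exists_eq_add_of_le hN
  rw [hz] at hle
  exact absurd (hb k) (not_lt.2 hle)

/-- For each `t > 1` the measure `t • κ₂` eventually dominates `κ₁` along the cylinders about any
point, hence everywhere; then `t` decreases to `1`. -/
theorem le_of_tendsto_ratio {κ₁ κ₂ : Measure (ℕ → Fin d)} [IsFiniteMeasure κ₁]
    [IsFiniteMeasure κ₂] (hpos : ∀ x n, 0 < κ₂.real (PiNat.cylinder x n))
    (h : ∀ x, Tendsto (fun n => κ₁.real (PiNat.cylinder x n) / κ₂.real (PiNat.cylinder x n))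
      atTop (𝓝 1)) : κ₁ ≤ κ₂ := by
  have key : ∀ t : ℝ, 1 < t → κ₁ ≤ ENNReal.ofReal t • κ₂ := by
    intro t ht
    have := isFiniteMeasure_smul_ofReal κ₂ t
    refine le_of_frequently_le fun x => Eventually.frequently ?_
    filter_upwards [(h x).eventually (gt_mem_nhds ht)] with n hn
    rw [measureReal_smul_ofReal (by linarith)]
    exact ((div_lt_iff₀ (hpos x n)).1 hn).le
  refine le_of_cylinder_real_le fun n x => ?_
  have ht : Tendsto (fun t : ℝ => t * κ₂.real (PiNat.cylinder x n)) (𝓝[>] 1)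
      (𝓝 (1 * κ₂.real (PiNat.cylinder x n))) :=
    (tendsto_id.mono_left nhdsWithin_le_nhds).mul_const _
  rw [one_mul] at ht
  refine ge_of_tendsto ht ?_
  filter_upwards [self_mem_nhdsWithin] with t (ht : 1 < t)
  have := isFiniteMeasure_smul_ofReal κ₂ t
  rw [← measureReal_smul_ofReal (by linarith)]
  exact ENNReal.toReal_mono (measure_ne_top _ _) (key t ht _)

theorem eq_of_tendsto_ratio {κ₁ κ₂ : Measure (ℕ → Fin d)} [IsFiniteMeasure κ₁]
    [IsFiniteMeasure κ₂] (h₁ : ∀ x n, 0 < κ₁.real (PiNat.cylinder x n))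
    (h₂ : ∀ x n, 0 < κ₂.real (PiNat.cylinder x n))
    (h : ∀ x, Tendsto (fun n => κ₁.real (PiNat.cylinder x n) / κ₂.real (PiNat.cylinder x n))
      atTop (𝓝 1)) : κ₁ = κ₂ := by
  refine le_antisymm (le_of_tendsto_ratio h₂ h) (le_of_tendsto_ratio h₁ fun x => ?_)
  simpa using (h x).inv₀ one_ne_zero

/-! ## The induced metric -/

theorem firstDiff_eq {x y : ℕ → Fin d} {n : ℕ} (h : ∀ k < n, x k = y k) (hn : x n ≠ y n) :
    PiNat.firstDiff x y = n := by
  have hxy : x ≠ y := fun e => hn (by rw [e])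
  rcases lt_trichotomy (PiNat.firstDiff x y) n with hlt | heq | hgt
  · exact absurd (h _ hlt) (PiNat.apply_firstDiff_ne hxy)
  · exact heq
  · exact absurd (PiNat.apply_eq_of_lt_firstDiff hgt) hn

/-- If `y` first differs from `x` at position `n ≥ 1`, the shifted points first differ at `n - 1`,
so the metric quotient is the cylinder quotient at `n`; and `n → ∞` as `y → x`. -/
theorem HasCylinderDerivAt.hasMetricDerivAt {μ : Measure (ℕ → Fin d)} {x : ℕ → Fin d} {L : ℝ}
    (h : HasCylinderDerivAt μ x L) : HasMetricDerivAt μ x L := by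
  have ht : Tendsto (fun y => PiNat.firstDiff y x) (𝓝[≠] x) atTop := by
    refine tendsto_atTop.2 fun n => ?_
    filter_upwards [self_mem_nhdsWithin, nhdsWithin_le_nhds
      ((PiNat.isOpen_cylinder _ x n).mem_nhds (PiNat.self_mem_cylinder x n))] with y hy hyn
    exact (PiNat.mem_cylinder_iff_le_firstDiff hy n).1 hyn
  refine (h.comp ht).congr' ?_
  filter_upwards [self_mem_nhdsWithin, ht.eventually_ge_atTop 1] with y (hy : y ≠ x) h1
  obtain ⟨k, hk⟩ := Nat.exists_eq_add_of_le' h1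
  have hne := PiNat.apply_firstDiff_ne hy
  rw [hk] at hne
  have heq : ∀ i < k + 1, y i = x i := fun i hi =>
    PiNat.apply_eq_of_lt_firstDiff (by rw [hk]; exact hi)
  have hs : PiNat.firstDiff (shift y) (shift x) = k :=
    firstDiff_eq (fun i hi => heq (i + 1) (by omega)) hne
  have hsne : shift y ≠ shift x := fun e => hne (congrFun e k)
  rw [Function.comp_apply, hk, inducedDist, inducedDist, if_neg hy, if_neg hsne, hs, hk,
    shift_image_cylinder_succ, cylinder_congr (pre_eq_iff.2 heq),
    cylinder_congr (n := k) (x := shift y) (y := shift x)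
      (pre_eq_iff.2 fun i hi => heq (i + 1) (by omega))]

theorem isInducedHolder_of_le {μ : Measure (ℕ → Fin d)} {φ : (ℕ → Fin d) → ℝ}
    (hφ : IsSymbolicHolder φ) {A γ : ℝ} (hA : 0 < A) (hA1 : A ≤ 1) (hγ0 : 0 < γ) (hγ1 : γ < 1)
    (h : ∀ n x, A * γ ^ n ≤ μ.real (PiNat.cylinder x n)) : IsInducedHolder μ φ := by
  obtain ⟨C, hC, τ, h0, h1, hφ⟩ := hφ
  have hlγ : Real.log γ < 0 := Real.log_neg hγ0 hγ1
  have hlτ : Real.log τ < 0 := Real.log_neg h0 h1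
  -- Chosen so that `τ ≤ γ ^ β`: the symbolic rate is absorbed by the power `β` of the lower bound
  -- for the cylinder measures.
  set β := min 1 (Real.log τ / Real.log γ) with hβ
  have hβ0 : 0 < β := lt_min one_pos (div_pos_of_neg_of_neg hlτ hlγ)
  have hβ1 : β ≤ 1 := min_le_left _ _
  have hτβ : τ ≤ γ ^ β := by
    rw [← Real.log_le_log_iff h0 (Real.rpow_pos_of_pos hγ0 _), Real.log_rpow hγ0]
    have : β ≤ Real.log τ / Real.log γ := min_le_right _ _
    rwa [le_div_iff_of_neg hlγ] at this
  refine ⟨C / A, by positivity, β, hβ0, hβ1, fun x y => ?_⟩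
  by_cases hxy : x = y
  · rw [hxy, sub_self, abs_zero, inducedDist_self, Real.zero_rpow hβ0.ne', mul_zero]
  · rw [inducedDist, if_neg hxy]
    set n := PiNat.firstDiff x y with hn
    refine (hφ n x y fun k hk => PiNat.apply_eq_of_lt_firstDiff hk).trans ?_
    have e1 : (A * γ ^ n) ^ β ≤ μ.real (PiNat.cylinder x n) ^ β :=
      Real.rpow_le_rpow (by positivity) (h n x) hβ0.le
    have e2 : A * τ ^ n ≤ (A * γ ^ n) ^ β := by
      rw [Real.mul_rpow hA.le (by positivity), ← Real.rpow_natCast, ← Real.rpow_natCast γ,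
        ← Real.rpow_mul hγ0.le, mul_comm (n : ℝ) β, Real.rpow_mul hγ0.le]
      have : A ≤ A ^ β := by
        simpa using Real.rpow_le_rpow_of_exponent_ge hA hA1 hβ1
      gcongr
    calc C * τ ^ n = C / A * (A * τ ^ n) := by field_simp
      _ ≤ C / A * μ.real (PiNat.cylinder x n) ^ β := by gcongr; exact e2.trans e1

end Gibbs

/-! ## The `g`-measure of a positive Hölder `g`-function -/

section GMeasure

variable {d : ℕ} {g : (ℕ → Fin d) → ℝ} {μ : Measure (ℕ → Fin d)}

theorem IsGMeasure.isInvariantProb (hμ : IsGMeasure g μ) : IsInvariantProb μ := by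
  have := hμ.prob
  refine ⟨hμ.prob, measurable_shift, ?_⟩
  have := Measure.isProbabilityMeasure_map (μ := μ) measurable_shift.aemeasurable
  refine ext_of_forall_integral_eq_of_IsFiniteMeasure fun f => ?_
  rw [integral_map measurable_shift.aemeasurable f.continuous.aestronglyMeasurable,
    -- Normalisation of `g` gives `L_g (f ∘ σ) = f`.
    ← hμ.fixed (fun x => f (shift x)) (f.continuous.comp continuous_shift)]
  congr 1
  funext x
  simp [transfer, shift_prepend, ← Finset.sum_mul, hμ.isGFunction.sum_eq_one]

theorem indicator_cylinder_app {n : ℕ} (x y : ℕ → Fin d) (w : Fin n → Fin d) :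
    (PiNat.cylinder x n).indicator (1 : (ℕ → Fin d) → ℝ) (app w y)
      = if w = pre n x then 1 else 0 := by
  by_cases h : w = pre n x
  · rw [if_pos h, Set.indicator_of_mem (mem_cylinder_iff_pre.2 (by rw [pre_app, h])), Pi.one_apply]
  · rw [if_neg h, Set.indicator_of_notMem]
    rwa [mem_cylinder_iff_pre, pre_app]

/-- In the `n`-th iterate of the transfer operator on the indicator of a cylinder only one word
survives. Bounded distortion of the integrand then gives the Gibbs bounds. -/
theorem IsGMeasure.measureReal_cylinder (hg : IsHolderG g) (hμ : IsGMeasure g μ) (n : ℕ)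
    (x : ℕ → Fin d) : μ.real (PiNat.cylinder x n) =
      ∫ y, Real.exp (birkhoff (fun x => Real.log (g x)) n (app (pre n x) y)) ∂μ := by
  rw [← integral_indicator_cylinder, ← hμ.integral_iterate (continuous_indicator_cylinder x n) n]
  congr 1
  funext y
  rw [transfer_iterate hg]
  simp [indicator_cylinder_app]

theorem IsGMeasure.exists_bounds (hg : IsHolderG g) (hμ : IsGMeasure g μ) :
    ∃ D : ℝ, 0 ≤ D ∧ ∀ (n : ℕ) (x : ℕ → Fin d),
      Real.exp (-D) * Real.exp (birkhoff (fun x => Real.log (g x)) n x)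
        ≤ μ.real (PiNat.cylinder x n) ∧
      μ.real (PiNat.cylinder x n)
        ≤ Real.exp D * Real.exp (birkhoff (fun x => Real.log (g x)) n x) := by
  have := hμ.prob
  obtain ⟨D, hD, hdist⟩ := exists_distortion hg.holder
  refine ⟨D, hD, fun n x => ?_⟩
  rw [hμ.measureReal_cylinder hg, ← Real.exp_add, ← Real.exp_add]
  have hint := integrable_of_continuous (Real.continuous_exp.comp
    ((continuous_birkhoff hg.continuous_log n).comp (continuous_app (pre n x)))) μ
  have hd := fun y => abs_le.1 (hdist n (app (pre n x) y) x (pre_app _ _))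
  constructor
  · simpa using integral_mono (integrable_const _) hint fun y =>
      Real.exp_le_exp.2 (by linarith [(hd y).1] :
        -D + birkhoff (fun x => Real.log (g x)) n x
          ≤ birkhoff (fun x => Real.log (g x)) n (app (pre n x) y))
  · simpa using integral_mono hint (integrable_const _) fun y =>
      Real.exp_le_exp.2 (by linarith [(hd y).2] :
        birkhoff (fun x => Real.log (g x)) n (app (pre n x) y)
          ≤ D + birkhoff (fun x => Real.log (g x)) n x)

theorem IsGMeasure.isGibbsMeasure (hg : IsHolderG g) (hμ : IsGMeasure g μ) :
    IsGibbsMeasure (fun x => Real.log (g x)) 0 μ := by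
  obtain ⟨D, -, h⟩ := hμ.exists_bounds hg
  refine IsGibbsMeasure.of_bounds hμ.isInvariantProb (Real.exp_pos D) fun n x => ⟨?_, (h n x).2⟩
  have := (h n x).1
  rwa [Real.exp_neg, inv_mul_le_iff₀ (Real.exp_pos _)] at this

theorem IsHolderG.exists_lower_bound (hd : 2 ≤ d) (hg : IsHolderG g) :
    ∃ γ : ℝ, 0 < γ ∧ γ < 1 ∧ ∀ x, γ ≤ g x ∧ g x ≤ 1 - γ := by
  obtain ⟨B, hB, h⟩ := exists_bound_of_continuous hg.continuous_log
  have hlow : ∀ x, Real.exp (-B) ≤ g x := fun x => by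
    rw [← Real.le_log_iff_exp_le (hg.pos x)]
    exact (abs_le.1 (h x)).1
  refine ⟨Real.exp (-B), Real.exp_pos _, Real.exp_lt_one_iff.2 (by linarith), fun x => ⟨hlow x, ?_⟩⟩
  have : Nontrivial (Fin d) := Fin.nontrivial_iff_two_le.2 hd
  -- As `d ≥ 2`, another preimage of `shift x` takes at least `γ` of the total weight one; this
  -- keeps `g` away from `1`.
  obtain ⟨j, hj⟩ := exists_ne (x 0)
  have h1 := hg.sum_eq_one (shift x)
  have h2 : g (prepend j (shift x)) + g (prepend (x 0) (shift x)) ≤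
      ∑ i : Fin d, g (prepend i (shift x)) := by
    rw [← Finset.sum_pair hj (f := fun i => g (prepend i (shift x)))]
    exact Finset.sum_le_sum_of_subset_of_nonneg (Finset.subset_univ _) fun i _ _ => (hg.pos _).le
  rw [prepend_shift] at h2
  linarith [hlow (prepend j (shift x))]

theorem birkhoff_bounds {φ : (ℕ → Fin d) → ℝ} {a b : ℝ} (h : ∀ x, a ≤ φ x ∧ φ x ≤ b) (n : ℕ)
    (x : ℕ → Fin d) : n * a ≤ birkhoff φ n x ∧ birkhoff φ n x ≤ n * b := by
  constructor
  · simpa [birkhoff] using Finset.card_nsmul_le_sum (Finset.range n) (fun i => φ (shift^[i] x)) a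
      fun i _ => (h _).1
  · simpa [birkhoff] using Finset.sum_le_card_nsmul (Finset.range n) (fun i => φ (shift^[i] x)) b
      fun i _ => (h _).2

theorem IsGMeasure.cylinder_pos (hg : IsHolderG g) (hμ : IsGMeasure g μ) (x : ℕ → Fin d)
    (n : ℕ) : 0 < μ.real (PiNat.cylinder x n) := by
  obtain ⟨D, -, h⟩ := hμ.exists_bounds hg
  exact lt_of_lt_of_le (by positivity) (h n x).1

theorem IsGMeasure.isOpenPosMeasure (hg : IsHolderG g) (hμ : IsGMeasure g μ) :
    μ.IsOpenPosMeasure := by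
  refine ⟨fun U hU ⟨x, hx⟩ h0 => ?_⟩
  obtain ⟨s, ⟨z, n, rfl⟩, -, hs⟩ :=
    (PiNat.isTopologicalBasis_cylinders fun _ : ℕ => Fin d).exists_subset_of_mem_open hx hU
  have := hμ.cylinder_pos hg z n
  rw [measureReal_def, measure_mono_null hs h0] at this
  simp at this

theorem IsGMeasure.nullSingletonClass (hd : 2 ≤ d) (hg : IsHolderG g) (hμ : IsGMeasure g μ) :
    NullSingletonClass μ := by
  have := hμ.prob
  obtain ⟨D, -, h⟩ := hμ.exists_bounds hg
  obtain ⟨γ, hγ0, hγ1, hγ⟩ := hg.exists_lower_bound hd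
  refine ⟨fun x => ?_⟩
  have hle : ∀ n : ℕ, μ.real {x} ≤ Real.exp D * (1 - γ) ^ n := by
    intro n
    refine (measureReal_mono (Set.singleton_subset_iff.2 (PiNat.self_mem_cylinder x n))).trans
      ((h n x).2.trans ?_)
    refine mul_le_mul_of_nonneg_left ?_ (Real.exp_pos _).le
    have hb := (birkhoff_bounds (φ := fun x => Real.log (g x)) (a := Real.log γ)
      (b := Real.log (1 - γ)) (fun y => ⟨Real.log_le_log hγ0 (hγ y).1,
        Real.log_le_log (hg.pos y) (hγ y).2⟩) n x).2
    calc _ ≤ Real.exp (n * Real.log (1 - γ)) := Real.exp_le_exp.2 hb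
      _ = (1 - γ) ^ n := by rw [Real.exp_nat_mul, Real.exp_log (by linarith)]
  have ht : Tendsto (fun n : ℕ => Real.exp D * (1 - γ) ^ n) atTop (𝓝 0) := by
    simpa using (tendsto_pow_atTop_nhds_zero_of_lt_one (r := 1 - γ) (by linarith)
      (by linarith)).const_mul (Real.exp D)
  have h0 : μ.real {x} = 0 := le_antisymm (ge_of_tendsto' ht hle) measureReal_nonneg
  exact (measureReal_eq_zero_iff (measure_ne_top _ _)).1 h0

theorem IsGMeasure.isInducedHolder (hd : 2 ≤ d) (hg : IsHolderG g) (hμ : IsGMeasure g μ)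
    {φ : (ℕ → Fin d) → ℝ} (hφ : IsSymbolicHolder φ) : IsInducedHolder μ φ := by
  obtain ⟨D, hD, h⟩ := hμ.exists_bounds hg
  obtain ⟨γ, hγ0, hγ1, hγ⟩ := hg.exists_lower_bound hd
  refine isInducedHolder_of_le hφ (Real.exp_pos (-D)) (Real.exp_le_one_iff.2 (by linarith))
    hγ0 hγ1 fun n x => le_trans ?_ (h n x).1
  refine mul_le_mul_of_nonneg_left ?_ (Real.exp_pos _).le
  have hb := (birkhoff_bounds (φ := fun x => Real.log (g x)) (a := Real.log γ)
    (b := Real.log (1 - γ)) (fun y => ⟨Real.log_le_log hγ0 (hγ y).1,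
      Real.log_le_log (hg.pos y) (hγ y).2⟩) n x).1
  calc γ ^ n = Real.exp (n * Real.log γ) := by rw [Real.exp_nat_mul, Real.exp_log hγ0]
    _ ≤ _ := Real.exp_le_exp.2 hb

theorem transfer_indicator_cylinder_succ (n : ℕ) (x y : ℕ → Fin d) :
    transfer g ((PiNat.cylinder x (n + 1)).indicator 1) y
      = (PiNat.cylinder (shift x) n).indicator (fun y => g (prepend (x 0) y)) y := by
  rw [transfer, Finset.sum_eq_single (x 0)]
  · by_cases hy : y ∈ PiNat.cylinder (shift x) n
    · have hy' : prepend (x 0) y ∈ PiNat.cylinder x (n + 1) := mem_cylinder_succ.2 ⟨rfl, hy⟩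
      rw [Set.indicator_of_mem hy, Set.indicator_of_mem hy', Pi.one_apply, mul_one]
    · rw [Set.indicator_of_notMem hy,
        Set.indicator_of_notMem fun h => hy (mem_cylinder_succ.1 h).2, mul_zero]
  · intro j _ hj
    rw [Set.indicator_of_notMem fun h => hj (mem_cylinder_succ.1 h).1, mul_zero]
  · simp

theorem IsGMeasure.measureReal_cylinder_succ (hμ : IsGMeasure g μ) (n : ℕ) (x : ℕ → Fin d) :
    μ.real (PiNat.cylinder x (n + 1))
      = ∫ y in PiNat.cylinder (shift x) n, g (prepend (x 0) y) ∂μ := by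
  rw [← integral_indicator_cylinder, ← hμ.fixed _ (continuous_indicator_cylinder x (n + 1)),
    ← integral_indicator (measurableSet_cylinder _ _)]
  simp only [transfer_indicator_cylinder_succ]

/-- Averages of a continuous function over shrinking cylinders. -/
theorem tendsto_setIntegral_div {ν : Measure (ℕ → Fin d)} [IsFiniteMeasure ν]
    (hpos : ∀ x n, 0 < ν.real (PiNat.cylinder x n)) {F : (ℕ → Fin d) → ℝ} (hF : Continuous F)
    (x : ℕ → Fin d) : Tendsto (fun n => (∫ y in PiNat.cylinder x n, F y ∂ν)
      / ν.real (PiNat.cylinder x n)) atTop (𝓝 (F x)) := by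
  rw [Metric.tendsto_atTop]
  intro ε hε
  obtain ⟨N, hN⟩ := exists_close_of_continuous hF (half_pos hε)
  refine ⟨N, fun n hn => lt_of_le_of_lt ?_ (half_lt_self hε)⟩
  have hp := hpos x n
  rw [Real.dist_eq, div_sub' hp.ne', abs_div, abs_of_pos hp, div_le_iff₀ hp]
  have e : (∫ y in PiNat.cylinder x n, F y ∂ν) - ν.real (PiNat.cylinder x n) * F x
      = ∫ y in PiNat.cylinder x n, (F y - F x) ∂ν := by
    rw [integral_sub (integrable_of_continuous hF _) (integrable_const _), setIntegral_const,
      smul_eq_mul]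
  rw [e, ← Real.norm_eq_abs]
  refine norm_setIntegral_le_of_norm_le_const (measure_lt_top _ _) fun y hy => ?_
  exact (hN n hn y x (mem_cylinder_iff_pre.1 hy)).le

/-! ### The derivative of the shift characterises the `g`-measure -/

theorem IsGMeasure.hasCylinderDerivAt (hg : IsHolderG g) (hμ : IsGMeasure g μ)
    (x : ℕ → Fin d) : HasCylinderDerivAt μ x (1 / g x) := by
  have := hμ.prob
  have h := tendsto_setIntegral_div (hμ.cylinder_pos hg)
    (hg.continuous.comp (continuous_prepend (x 0))) (shift x)
  simp only [Function.comp_apply, prepend_shift, ← hμ.measureReal_cylinder_succ] at h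
  have h' := h.inv₀ (hg.pos x).ne'
  rw [HasCylinderDerivAt, ← tendsto_add_atTop_iff_nat 1, one_div]
  refine h'.congr fun n => ?_
  rw [inv_div, shift_image_cylinder_succ]

/-- For each digit `j`, the part of `ν` on `[j]` transported by the shift (`κ₁ j`) and the measure
with density `g (j ·)` (`κ₂ j`) have cylinder ratios tending to one at every point, so they
coincide. Adding over `j` gives `L_g^* ν = ν`. -/
theorem isGMeasure_of_hasCylinderDerivAt (hg : IsHolderG g) {ν : Measure (ℕ → Fin d)}
    [IsProbabilityMeasure ν] [ν.IsOpenPosMeasure]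
    (h : ∀ x, HasCylinderDerivAt ν x (1 / g x)) : IsGMeasure g ν := by
  have hpos : ∀ x n, 0 < ν.real (PiNat.cylinder x n) := fun x n =>
    ENNReal.toReal_pos ((PiNat.isOpen_cylinder _ x n).measure_pos ν
      ⟨x, PiNat.self_mem_cylinder x n⟩).ne' (measure_ne_top _ _)
  have hgj : ∀ j, Continuous fun y => g (prepend j y) := fun j =>
    hg.continuous.comp (continuous_prepend j)
  have hset : ∀ j : Fin d, MeasurableSet {x : ℕ → Fin d | x 0 = j} := fun j =>
    (measurable_pi_apply (X := fun _ => Fin d) 0) (MeasurableSet.singleton j)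
  let κ₁ : Fin d → Measure (ℕ → Fin d) := fun j => (ν.restrict {x | x 0 = j}).map shift
  let κ₂ : Fin d → Measure (ℕ → Fin d) :=
    fun j => ν.withDensity fun y => ENNReal.ofReal (g (prepend j y))
  have hfin : ∀ j, IsFiniteMeasure (κ₂ j) := fun j =>
    isFiniteMeasure_withDensity_ofReal (integrable_of_continuous (hgj j) ν).2
  have e1 : ∀ j y n, (κ₁ j).real (PiNat.cylinder y n)
      = ν.real (PiNat.cylinder (prepend j y) (n + 1)) := by
    intro j y n
    rw [map_measureReal_apply measurable_shift (measurableSet_cylinder _ _),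
      measureReal_restrict_apply (measurable_shift (measurableSet_cylinder _ _))]
    congr 1
    ext z
    rw [mem_cylinder_succ, and_comm]
    rfl
  have e2 : ∀ j y n, (κ₂ j).real (PiNat.cylinder y n)
      = ∫ z in PiNat.cylinder y n, g (prepend j z) ∂ν := by
    intro j y n
    rw [measureReal_def, withDensity_apply _ (measurableSet_cylinder _ _),
      ← ofReal_integral_eq_lintegral_ofReal (integrable_of_continuous (hgj j) _)
        (ae_of_all _ fun z => (hg.pos _).le),
      ENNReal.toReal_ofReal (integral_nonneg fun z => (hg.pos _).le)]
  have hlim : ∀ j y, Tendsto (fun n => (κ₂ j).real (PiNat.cylinder y n)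
      / ν.real (PiNat.cylinder y n)) atTop (𝓝 (g (prepend j y))) := fun j y => by
    simp only [e2]
    exact tendsto_setIntegral_div hpos (hgj j) y
  have hκ : ∀ j, κ₁ j = κ₂ j := by
    intro j
    refine eq_of_tendsto_ratio (fun y n => by rw [e1]; exact hpos _ _) (fun y n => ?_) fun y => ?_
    · rw [e2]
      obtain ⟨B, -, hB⟩ := exists_bound_of_continuous hg.continuous_log
      have : Real.exp (-B) * ν.real (PiNat.cylinder y n)
          ≤ ∫ z in PiNat.cylinder y n, g (prepend j z) ∂ν := by
        rw [mul_comm, ← smul_eq_mul, ← setIntegral_const]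
        refine integral_mono (integrable_const _) (integrable_of_continuous (hgj j) _) fun z => ?_
        rw [← Real.le_log_iff_exp_le (hg.pos _)]
        exact (abs_le.1 (hB _)).1
      exact lt_of_lt_of_le (mul_pos (Real.exp_pos _) (hpos y n)) this
    · have h1 := (tendsto_add_atTop_iff_nat 1).2 (h (prepend j y))
      simp only [shift_image_cylinder_succ, shift_prepend] at h1
      have h2 := ((h1.mul (hlim j y)).inv₀ (by
        rw [one_div, inv_mul_cancel₀ (hg.pos _).ne']; exact one_ne_zero))
      rw [one_div, inv_mul_cancel₀ (hg.pos _).ne', inv_one] at h2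
      refine h2.congr fun n => ?_
      rw [e1]
      have := (hpos y n).ne'
      field_simp
  refine ⟨hg.isGFunction, inferInstance, fun φ hφ => ?_⟩
  have hφj : ∀ j, Continuous fun y => φ (prepend j y) := fun j => hφ.comp (continuous_prepend j)
  calc ∫ x, transfer g φ x ∂ν = ∑ j, ∫ y, g (prepend j y) * φ (prepend j y) ∂ν := by
        simp only [transfer]
        exact integral_finsetSum _ fun j _ => integrable_of_continuous ((hgj j).mul (hφj j)) ν
    _ = ∑ j, ∫ y, φ (prepend j y) ∂κ₂ j := by
        refine Finset.sum_congr rfl fun j _ => ?_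
        rw [integral_withDensity_eq_integral_toReal_smul (hgj j).measurable.ennreal_ofReal
          (ae_of_all _ fun _ => ENNReal.ofReal_lt_top)]
        refine integral_congr_ae (ae_of_all _ fun y => ?_)
        simp only [ENNReal.toReal_ofReal (hg.pos _).le, smul_eq_mul]
    _ = ∑ j, ∫ x in {x | x 0 = j}, φ x ∂ν := by
        refine Finset.sum_congr rfl fun j _ => ?_
        rw [← hκ j, integral_map measurable_shift.aemeasurable (hφj j).aestronglyMeasurable]
        refine setIntegral_congr_fun (hset j) fun x hx => ?_
        have hx' : x 0 = j := hx
        simp only [← hx', prepend_shift]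
    _ = ∫ x, φ x ∂ν := by
        rw [← integral_iUnion_fintype hset]
        · have : ⋃ j, {x : ℕ → Fin d | x 0 = j} = Set.univ :=
            Set.eq_univ_of_forall fun x => Set.mem_iUnion.2 ⟨x 0, rfl⟩
          rw [this, setIntegral_univ]
        · exact fun i j hij => Set.disjoint_left.2 fun x hi hj => hij (hi.symm.trans hj)
        · exact fun j => (integrable_of_continuous hφ ν).integrableOn

theorem IsGMeasure.eq_withDensity_tildeMeasure (hg : IsHolderG g) (hμ : IsGMeasure g μ) :
    μ = (tildeMeasure μ).withDensity fun x => ENNReal.ofReal (g x) := by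
  have := hμ.prob
  have hfin : IsFiniteMeasure (tildeMeasure μ) := by unfold tildeMeasure; infer_instance
  have := isFiniteMeasure_withDensity_ofReal
    (integrable_of_continuous hg.continuous (tildeMeasure μ)).2
  refine ext_of_forall_integral_eq_of_IsFiniteMeasure fun f => ?_
  rw [integral_withDensity_eq_integral_toReal_smul hg.continuous.measurable.ennreal_ofReal
    (ae_of_all _ fun _ => ENNReal.ofReal_lt_top)]
  simp only [ENNReal.toReal_ofReal (hg.pos _).le, smul_eq_mul]
  have hc : Continuous fun x => g x * f x := hg.continuous.mul f.continuous
  rw [tildeMeasure, integral_finsetSum_measure fun j _ => integrable_of_continuous hc _,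
    ← hμ.fixed f f.continuous]
  simp only [transfer]
  rw [integral_finsetSum (f := fun j x => g (prepend j x) * f (prepend j x)) _ fun j _ =>
    integrable_of_continuous (hc.comp (continuous_prepend j)) μ]
  refine Finset.sum_congr rfl fun j _ => ?_
  rw [integral_map (measurable_prepend j).aemeasurable hc.aestronglyMeasurable]

theorem IsHolderG.hasPressure [NeZero d] (hg : IsHolderG g) :
    HasPressure (fun x => Real.log (g x)) 0 := by
  obtain ⟨D, hD, hdist⟩ := exists_distortion hg.holder
  let z : ℕ → Fin d := fun _ => 0
  let S : ℕ → ℝ := fun n => ∑ w : Fin n → Fin d,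
    sSup ((fun x => Real.exp (birkhoff (fun x => Real.log (g x)) n x)) ''
      {x | ∀ i : Fin n, x i = w i})
  have hup : ∀ (n : ℕ) (w : Fin n → Fin d),
      ∀ t ∈ ((fun x => Real.exp (birkhoff (fun x => Real.log (g x)) n x)) ''
        {x | ∀ i : Fin n, x i = w i}),
      t ≤ Real.exp D * Real.exp (birkhoff (fun x => Real.log (g x)) n (app w z)) := by
    rintro n w _ ⟨x, hx, rfl⟩
    have hx' : pre n x = w := funext hx
    rw [← Real.exp_add]
    exact Real.exp_le_exp.2
      (by linarith [(abs_le.1 (hdist n x (app w z) (by rw [pre_app, hx']))).2])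
  have hmem : ∀ (n : ℕ) (w : Fin n → Fin d),
      Real.exp (birkhoff (fun x => Real.log (g x)) n (app w z)) ∈
      ((fun x => Real.exp (birkhoff (fun x => Real.log (g x)) n x)) ''
        {x | ∀ i : Fin n, x i = w i}) := fun n w =>
    ⟨app w z, fun i => congrFun (pre_app w z) i, rfl⟩
  -- The suprema differ from the values at the points `app w z`, which add up to one, by a factor at
  -- most `exp D`. So `S n` stays in `[1, exp D]` and the growth rate is zero.
  have h1 : ∀ n, 1 ≤ S n := fun n => by
    rw [← sum_exp_birkhoff hg n z]
    exact Finset.sum_le_sum fun w _ => le_csSup ⟨_, hup n w⟩ (hmem n w)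
  have h2 : ∀ n, S n ≤ Real.exp D := fun n => by
    calc S n ≤ ∑ w, Real.exp D * Real.exp (birkhoff (fun x => Real.log (g x)) n (app w z)) :=
          Finset.sum_le_sum fun w _ => csSup_le ⟨_, hmem n w⟩ (hup n w)
      _ = Real.exp D := by rw [← Finset.mul_sum, sum_exp_birkhoff hg, mul_one]
  have ht : Tendsto (fun n : ℕ => D / n) atTop (𝓝 0) := tendsto_const_div_atTop_nhds_zero_nat D
  refine tendsto_of_tendsto_of_tendsto_of_le_of_le tendsto_const_nhds ht (fun n => ?_) fun n => ?_
  · exact div_nonneg (Real.log_nonneg (h1 n)) n.cast_nonneg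
  · refine div_le_div_of_nonneg_right ?_ n.cast_nonneg
    exact (Real.log_le_iff_le_exp (by linarith [h1 n])).2 (h2 n)

end GMeasure

/-! ## Entropy of invariant measures of the shift -/

section Entropy

variable {d : ℕ}

theorem integral_comp_fintype {X ι : Type*} [MeasurableSpace X] [Fintype ι] [MeasurableSpace ι]
    [DiscreteMeasurableSpace ι] {ν : Measure X} [IsFiniteMeasure ν] {p : X → ι} (hp : Measurable p)
    (F : ι → ℝ) : ∫ x, F (p x) ∂ν = ∑ a, ν.real (p ⁻¹' {a}) * F a := by
  rw [← integral_map hp.aemeasurable (Measurable.of_discrete).aestronglyMeasurable,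
    integral_fintype Integrable.of_finite]
  refine Finset.sum_congr rfl fun w _ => ?_
  rw [map_measureReal_apply hp (MeasurableSet.singleton w), smul_eq_mul]

theorem sum_measureReal_fiber {X ι : Type*} [MeasurableSpace X] [Fintype ι] [MeasurableSpace ι]
    [DiscreteMeasurableSpace ι] {ν : Measure X} [IsProbabilityMeasure ν] {p : X → ι}
    (hp : Measurable p) : ∑ a, ν.real (p ⁻¹' {a}) = 1 := by
  simpa using (integral_comp_fintype (ν := ν) hp fun _ => (1 : ℝ)).symm

theorem partitionEntropy_eq_integral {X ι : Type*} [MeasurableSpace X] [Fintype ι]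
    [MeasurableSpace ι] [DiscreteMeasurableSpace ι] {ν : Measure X} [IsFiniteMeasure ν] {p : X → ι}
    (hp : Measurable p) :
    partitionEntropy ν p = -∫ x, Real.log (ν.real (p ⁻¹' {p x})) ∂ν := by
  rw [integral_comp_fintype hp fun a => Real.log (ν.real (p ⁻¹' {a})), partitionEntropy,
    ← Finset.sum_neg_distrib]
  simp [Real.negMulLog]

/-- Gibbs' inequality. -/
theorem partitionEntropy_le {X ι : Type*} [MeasurableSpace X] [Fintype ι]
    [MeasurableSpace ι] [DiscreteMeasurableSpace ι] {ν : Measure X} [IsProbabilityMeasure ν]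
    {p : X → ι} (hp : Measurable p) {Q : ι → ℝ} (hQ0 : ∀ a, 0 ≤ Q a) (hQ1 : ∑ a, Q a ≤ 1)
    (hpos : ∀ᵐ x ∂ν, 0 < Q (p x)) :
    partitionEntropy ν p ≤ -∫ x, Real.log (Q (p x)) ∂ν := by
  rw [integral_comp_fintype hp fun a => Real.log (Q a), ← sub_nonpos, sub_neg_eq_add,
    partitionEntropy, ← Finset.sum_add_distrib]
  have h1 := sum_measureReal_fiber (ν := ν) hp
  calc _ ≤ ∑ a, (Q a - ν.real (p ⁻¹' {a})) := by
        refine Finset.sum_le_sum fun a _ => ?_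
        rcases eq_or_lt_of_le (measureReal_nonneg (μ := ν) (s := p ⁻¹' {a})) with h0 | h0
        · rw [← h0]; simpa using hQ0 a
        · have hQa : 0 < Q a := by
            by_contra hcon
            have : ν (p ⁻¹' {a}) = 0 := by
              refine measure_mono_null ?_ hpos
              rintro x rfl
              exact hcon
            rw [measureReal_def, this] at h0
            exact lt_irrefl _ h0
          -- The inequality `log t ≤ t - 1` for the likelihood ratio `t`; atoms of measure zero were
          -- handled separately.
          have h2 := Real.log_le_sub_one_of_pos (div_pos hQa h0)
          rw [Real.log_div hQa.ne' h0.ne'] at h2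
          have h3 := mul_le_mul_of_nonneg_left h2 h0.le
          have h4 : ν.real (p ⁻¹' {a}) * (Q a / ν.real (p ⁻¹' {a}) - 1)
              = Q a - ν.real (p ⁻¹' {a}) := by field_simp
          rw [h4] at h3
          rw [Real.negMulLog]
          linarith
    _ ≤ 0 := by rw [Finset.sum_sub_distrib, h1]; linarith

/-- The entropy of the partition into the cylinders of length `n`. -/
noncomputable def blockEntropy (ν : Measure (ℕ → Fin d)) (n : ℕ) : ℝ := partitionEntropy ν (pre n)

theorem continuous_comp_pre {n : ℕ} (F : (Fin n → Fin d) → ℝ) :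
    Continuous fun x : ℕ → Fin d => F (pre n x) :=
  continuous_of_discreteTopology.comp (continuous_pre n)

theorem continuous_log_cylinder (ν : Measure (ℕ → Fin d)) (n : ℕ) :
    Continuous fun x : ℕ → Fin d => Real.log (ν.real (PiNat.cylinder x n)) := by
  simp only [cylinder_eq_preimage]
  exact continuous_comp_pre fun w => Real.log (ν.real (pre n ⁻¹' {w}))

theorem blockEntropy_eq (ν : Measure (ℕ → Fin d)) [IsFiniteMeasure ν] (n : ℕ) :
    blockEntropy ν n = -∫ x, Real.log (ν.real (PiNat.cylinder x n)) ∂ν := by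
  rw [blockEntropy, partitionEntropy_eq_integral (measurable_pre n)]
  simp only [cylinder_eq_preimage]

theorem ae_cylinder_pos (ν : Measure (ℕ → Fin d)) [IsFiniteMeasure ν] (n : ℕ) :
    ∀ᵐ x ∂ν, 0 < ν.real (PiNat.cylinder x n) := by
  have h : ∀ w : Fin n → Fin d, ∀ᵐ x ∂ν, pre n x = w → 0 < ν.real (pre n ⁻¹' {w}) := by
    intro w
    rcases eq_or_lt_of_le (measureReal_nonneg (μ := ν) (s := pre n ⁻¹' {w})) with h0 | h0
    · have h1 : ν (pre n ⁻¹' {w}) = 0 := (measureReal_eq_zero_iff (measure_ne_top _ _)).1 h0.symm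
      filter_upwards [measure_eq_zero_iff_ae_notMem.1 h1] with x hx hw
      exact absurd hw hx
    · exact ae_of_all _ fun _ _ => h0
  filter_upwards [ae_all_iff.2 h] with x hx
  rw [cylinder_eq_preimage]
  exact hx _ rfl

theorem measureReal_shift_preimage_cylinder (ν : Measure (ℕ → Fin d)) [IsFiniteMeasure ν] (n : ℕ)
    (y : ℕ → Fin d) : ν.real (shift ⁻¹' PiNat.cylinder y n)
      = ∑ j : Fin d, ν.real (PiNat.cylinder (prepend j y) (n + 1)) := by
  have h : shift ⁻¹' PiNat.cylinder y n = ⋃ j, PiNat.cylinder (prepend j y) (n + 1) := by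
    ext z
    simp only [Set.mem_iUnion, mem_cylinder_succ, shift_prepend, Set.mem_preimage]
    exact ⟨fun h => ⟨z 0, rfl, h⟩, fun ⟨_, _, h⟩ => h⟩
  rw [h, measureReal_iUnion_fintype]
  · intro i j hij
    exact Set.disjoint_left.2 fun z hi hj => hij
      ((mem_cylinder_succ.1 hi).1.symm.trans (mem_cylinder_succ.1 hj).1)
  · exact fun j => measurableSet_cylinder _ _

theorem sum_cylinder_prepend {ν : Measure (ℕ → Fin d)} (hν : IsInvariantProb ν) (n : ℕ)
    (y : ℕ → Fin d) :
    ∑ j : Fin d, ν.real (PiNat.cylinder (prepend j y) (n + 1)) = ν.real (PiNat.cylinder y n) := by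
  have := hν.prob
  rw [← measureReal_shift_preimage_cylinder,
    hν.invariant.measureReal_preimage (measurableSet_cylinder y n).nullMeasurableSet]

theorem cylinder_le_shift {ν : Measure (ℕ → Fin d)} (hν : IsInvariantProb ν) (n : ℕ)
    (x : ℕ → Fin d) :
    ν.real (PiNat.cylinder x (n + 1)) ≤ ν.real (PiNat.cylinder (shift x) n) := by
  rw [← sum_cylinder_prepend hν n (shift x)]
  conv_lhs => rw [← prepend_shift x]
  exact Finset.single_le_sum
    (f := fun j => ν.real (PiNat.cylinder (prepend j (shift x)) (n + 1)))
    (fun _ _ => measureReal_nonneg) (Finset.mem_univ (x 0))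

theorem integral_log_cylinder_shift {ν : Measure (ℕ → Fin d)} (hν : IsInvariantProb ν) (n : ℕ) :
    ∫ x, Real.log (ν.real (PiNat.cylinder (shift x) n)) ∂ν = -blockEntropy ν n := by
  have := hν.prob
  rw [blockEntropy_eq, neg_neg]
  exact integral_comp_shift hν.invariant 1 (continuous_log_cylinder ν n).stronglyMeasurable

theorem sum_cylinder_app (ν : Measure (ℕ → Fin d)) [IsProbabilityMeasure ν] (n : ℕ)
    (z : ℕ → Fin d) : ∑ w : Fin n → Fin d, ν.real (PiNat.cylinder (app w z) n) = 1 := by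
  simp only [← preimage_pre_eq_cylinder]
  exact sum_measureReal_pre n ν

theorem cylinder_app_pre (n m : ℕ) (hm : m ≤ n) (x z : ℕ → Fin d) :
    PiNat.cylinder (app (pre n x) z) m = PiNat.cylinder x m :=
  cylinder_congr (pre_eq_iff.2 fun k hk =>
    pre_eq_iff.1 (pre_app (pre n x) z) k (lt_of_lt_of_le hk hm))

theorem cylinder_shift_app_pre (n m : ℕ) (hm : m + 1 ≤ n) (x z : ℕ → Fin d) :
    PiNat.cylinder (shift (app (pre n x) z)) m = PiNat.cylinder (shift x) m :=
  cylinder_congr (pre_eq_iff.2 fun k hk =>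
    pre_eq_iff.1 (pre_app (pre n x) z) (k + 1) (by omega))

/-- Gibbs' inequality against the Markov approximation `q`, which glues two overlapping words of
length `n + 1` as if they were independent given their common `n` digits. -/
theorem blockEntropy_concave {ν : Measure (ℕ → Fin d)} (hν : IsInvariantProb ν) (n : ℕ) :
    blockEntropy ν (n + 2) - blockEntropy ν (n + 1) ≤ blockEntropy ν (n + 1) - blockEntropy ν n := by
  have := hν.prob
  obtain ⟨z⟩ := nonempty_of_isProbabilityMeasure ν
  let q : (ℕ → Fin d) → ℝ := fun x => ν.real (PiNat.cylinder x (n + 1)) *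
    ν.real (PiNat.cylinder (shift x) (n + 1)) / ν.real (PiNat.cylinder (shift x) n)
  let Q : (Fin (n + 2) → Fin d) → ℝ := fun a => q (app a z)
  have hQq : ∀ x, Q (pre (n + 2) x) = q x := fun x => by
    simp only [Q, q]
    rw [cylinder_app_pre _ _ (by omega), cylinder_shift_app_pre _ _ le_rfl,
      cylinder_shift_app_pre _ _ (by omega)]
  have hae : ∀ᵐ x ∂ν, 0 < ν.real (PiNat.cylinder x (n + 1)) ∧
      0 < ν.real (PiNat.cylinder (shift x) (n + 1)) ∧
      0 < ν.real (PiNat.cylinder (shift x) n) := by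
    filter_upwards [ae_cylinder_pos ν (n + 1), ae_cylinder_pos ν (n + 2)] with x h1 h2
    exact ⟨h1, h2.trans_le (cylinder_le_shift hν _ _), h1.trans_le (cylinder_le_shift hν _ _)⟩
  -- Summing over the first digit cancels the denominator by invariance. A zero denominator makes
  -- the quotient zero, hence only an inequality.
  have hQ1 : ∑ a, Q a ≤ 1 := by
    rw [sum_word_succ, ← sum_cylinder_app ν (n + 1) z]
    refine Finset.sum_le_sum fun b _ => ?_
    simp only [Q, q, app_cons, shift_prepend]
    rw [← Finset.sum_div, ← Finset.sum_mul, sum_cylinder_prepend hν, mul_div_right_comm]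
    exact mul_le_of_le_one_left measureReal_nonneg (div_self_le_one _)
  have h := partitionEntropy_le (ν := ν) (measurable_pre (n + 2)) (Q := Q)
    (fun a => by positivity) hQ1 (by
      filter_upwards [hae] with x hx
      rw [hQq]
      exact div_pos (mul_pos hx.1 hx.2.1) hx.2.2)
  have e : ∫ x, Real.log (Q (pre (n + 2) x)) ∂ν
      = ∫ x, (Real.log (ν.real (PiNat.cylinder x (n + 1)))
        + Real.log (ν.real (PiNat.cylinder (shift x) (n + 1)))
        - Real.log (ν.real (PiNat.cylinder (shift x) n))) ∂ν := by
    refine integral_congr_ae ?_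
    filter_upwards [hae] with x hx
    rw [hQq, Real.log_div (mul_pos hx.1 hx.2.1).ne' hx.2.2.ne', Real.log_mul hx.1.ne' hx.2.1.ne']
  have i1 := integrable_of_continuous (continuous_log_cylinder ν (n + 1)) ν
  have i2 : ∀ m, Integrable (fun x => Real.log (ν.real (PiNat.cylinder (shift x) m))) ν := fun m =>
    integrable_of_continuous ((continuous_log_cylinder ν m).comp continuous_shift) ν
  rw [e, integral_sub (i1.fun_add (i2 _)) (i2 _), integral_add i1 (i2 _), integral_log_cylinder_shift hν,
    integral_log_cylinder_shift hν] at h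
  have h2 := blockEntropy_eq ν (n + 1)
  have h3 : partitionEntropy ν (pre (n + 2)) = blockEntropy ν (n + 2) := rfl
  linarith

theorem blockEntropy_diff_antitone {ν : Measure (ℕ → Fin d)} (hν : IsInvariantProb ν) :
    Antitone fun n => blockEntropy ν (n + 1) - blockEntropy ν n :=
  antitone_nat_of_succ_le fun n => blockEntropy_concave hν n

theorem blockEntropy_le_add {ν : Measure (ℕ → Fin d)} (hν : IsInvariantProb ν) (n k : ℕ) :
    blockEntropy ν (n + k) ≤ blockEntropy ν n + k * (blockEntropy ν (n + 1) - blockEntropy ν n) := by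
  induction k with
  | zero => simp
  | succ k ih =>
    have := blockEntropy_diff_antitone hν (Nat.le_add_right n k)
    simp only at this
    push_cast
    rw [← add_assoc]
    linarith

/-- Measurable functions with finitely many values are approximated by functions of finitely many
digits. -/
theorem exists_digit_approx (ν : Measure (ℕ → Fin d)) [IsProbabilityMeasure ν] {k : ℕ}
    {p : (ℕ → Fin d) → Fin k} (hp : Measurable p) {η : ℝ} (hη : 0 < η) :
    ∃ (K : ℕ) (q : (Fin K → Fin d) → Fin k), ν.real {x | p x ≠ q (pre K x)} ≤ η := by
  classical
  obtain ⟨z⟩ := nonempty_of_isProbabilityMeasure ν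
  have hf : Measurable fun x => ((p x : ℕ) : ℝ) :=
    (Measurable.of_discrete (f := fun a : Fin k => ((a : ℕ) : ℝ))).comp hp
  have hfi : Integrable (fun x => ((p x : ℕ) : ℝ)) ν := by
    refine Integrable.of_bound hf.aestronglyMeasurable k (ae_of_all _ fun x => ?_)
    rw [Real.norm_natCast]
    exact_mod_cast (p x).2.le
  obtain ⟨h, hint, -⟩ := hfi.exists_boundedContinuous_integral_sub_le (ε := η / 4) (by positivity)
  obtain ⟨K, hK⟩ := exists_close_of_continuous h.continuous (ε := η / 4) (by positivity)
  -- Round the continuous approximation `h` to a label within `1 / 2`; such a label is unique.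
  -- Rounding can miss `p x` only where the approximation error is at least `1 / 2`, and Markov's
  -- inequality bounds that set by twice the mean error `η / 2`.
  let q : (Fin K → Fin d) → Fin k := fun w =>
    if H : ∃ a : Fin k, |((a : ℕ) : ℝ) - h (app w z)| < 1 / 2 then H.choose else p z
  refine ⟨K, q, ?_⟩
  have hq : ∀ x, p x ≠ q (pre K x) → 1 / 2 ≤ |((p x : ℕ) : ℝ) - h (app (pre K x) z)| := by
    intro x hx
    by_contra! hlt
    have H : ∃ a : Fin k, |((a : ℕ) : ℝ) - h (app (pre K x) z)| < 1 / 2 := ⟨p x, hlt⟩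
    refine hx ?_
    have hq' : q (pre K x) = H.choose := dif_pos H
    rw [hq']
    have h1 := abs_lt.1 H.choose_spec
    have h2 := abs_lt.1 hlt
    have h3 : ((p x : ℕ) : ℝ) < (H.choose : ℕ) + 1 := by linarith [h1.1, h2.2]
    have h4 : ((H.choose : ℕ) : ℝ) < (p x : ℕ) + 1 := by linarith [h1.2, h2.1]
    have h5 : (p x : ℕ) < (H.choose : ℕ) + 1 := by exact_mod_cast h3
    have h6 : (H.choose : ℕ) < (p x : ℕ) + 1 := by exact_mod_cast h4
    exact Fin.ext (by omega)
  have hc : Continuous fun x => h (app (pre K x) z) := continuous_comp_pre fun w => h (app w z)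
  have hi : Integrable (fun x => ((p x : ℕ) : ℝ) - h (app (pre K x) z)) ν :=
    hfi.sub (integrable_of_continuous hc ν)
  have hm := mul_meas_ge_le_integral_of_nonneg (μ := ν)
    (f := fun x => |((p x : ℕ) : ℝ) - h (app (pre K x) z)|)
    (ae_of_all _ fun x => abs_nonneg _) hi.abs (1 / 2)
  have hle : ∫ x, |((p x : ℕ) : ℝ) - h (app (pre K x) z)| ∂ν ≤ η / 4 + η / 4 := by
    calc _ ≤ ∫ x, (‖((p x : ℕ) : ℝ) - h x‖ + η / 4) ∂ν := by
          refine integral_mono hi.abs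
            ((hfi.sub (integrable_of_continuous h.continuous ν)).norm.add (integrable_const _))
            fun x => ?_
          have h1 := hK K le_rfl x (app (pre K x) z) (pre_app _ _).symm
          have h2 := abs_add_le (((p x : ℕ) : ℝ) - h x) (h x - h (app (pre K x) z))
          rw [sub_add_sub_cancel] at h2
          exact h2.trans (add_le_add (Real.norm_eq_abs _).ge h1.le)
      _ ≤ _ := by
          rw [integral_add (f := fun x => ‖((p x : ℕ) : ℝ) - h x‖)
            (hfi.sub (integrable_of_continuous h.continuous ν)).norm (integrable_const _)]
          simpa using hint
  have hsub : ν.real {x | p x ≠ q (pre K x)}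
      ≤ ν.real {x | 1 / 2 ≤ |((p x : ℕ) : ℝ) - h (app (pre K x) z)|} :=
    measureReal_mono hq
  linarith

theorem integral_birkhoff {ν : Measure (ℕ → Fin d)} (hν : IsInvariantProb ν)
    {φ : (ℕ → Fin d) → ℝ} (hφ : Measurable φ) (hint : Integrable φ ν) (n : ℕ) :
    ∫ x, birkhoff φ n x ∂ν = n * ∫ x, φ x ∂ν := by
  simp only [birkhoff]
  rw [integral_finsetSum (f := fun i x => φ (shift^[i] x)) _ fun i _ =>
    (hν.invariant.iterate i).integrable_comp_of_integrable hint]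
  simp [integral_comp_shift hν.invariant _ hφ.stronglyMeasurable]

/-- The entropy of a partition is controlled by the entropies of the cylinder partitions. -/
theorem exists_partitionEntropy_le {ν : Measure (ℕ → Fin d)} (hν : IsInvariantProb ν) {k : ℕ}
    {p : (ℕ → Fin d) → Fin k} (hp : Measurable p) {ε : ℝ} (hε : 0 < ε) :
    ∃ K : ℕ, ∀ n : ℕ, partitionEntropy ν (fun x (i : Fin n) => p (shift^[i] x))
      ≤ blockEntropy ν (n + K) + n * ε := by
  have := hν.prob
  obtain ⟨z⟩ := nonempty_of_isProbabilityMeasure ν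
  have hk : 0 < k := (p z).pos
  set δ : ℝ := 1 - Real.exp (-(ε / 2)) with hδ
  have hδ0 : 0 < δ := by
    have := Real.exp_lt_one_iff.2 (by linarith : -(ε / 2) < 0)
    linarith
  have hδ1 : 1 - δ = Real.exp (-(ε / 2)) := by rw [hδ]; ring
  have hkR : (0 : ℝ) < k := by exact_mod_cast hk
  set M : ℝ := |Real.log (δ / k)| + 1 with hM
  have hM0 : 0 < M := by positivity
  obtain ⟨K, q, hq⟩ := exists_digit_approx ν hp (η := ε / 2 / M) (by positivity)
  -- A noisy channel predicting the true label `a` from the approximate label `b`. Agreement costs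
  -- `-log (1 - δ) = ε / 2`; disagreement costs at most `M` on a set of measure at most `ε / 2 / M`.
  -- So the mean cost per symbol is at most `ε`.
  let R : Fin k → Fin k → ℝ := fun a b => if a = b then 1 - δ else δ / k
  have hRpos : ∀ a b, 0 < R a b := by
    intro a b
    simp only [R]
    split_ifs
    · rw [hδ1]; exact Real.exp_pos _
    · positivity
  have hRsum : ∀ b, ∑ a, R a b ≤ 1 := by
    intro b
    calc ∑ a, R a b ≤ ∑ a, ((if a = b then 1 - δ else 0) + δ / k) := by
          refine Finset.sum_le_sum fun a _ => ?_
          simp only [R]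
          split_ifs
          · have : 0 < δ / k := by positivity
            linarith
          · linarith
      _ = 1 := by
          rw [Finset.sum_add_distrib]
          simp
          field_simp
          ring
  have hRlog : ∫ x, -Real.log (R (p x) (q (pre K x))) ∂ν ≤ ε := by
    have hmeas : MeasurableSet {x | p x ≠ q (pre K x)} :=
      (measurableSet_eq_fun hp ((Measurable.of_discrete (f := q)).comp (measurable_pre K))).compl
    calc ∫ x, -Real.log (R (p x) (q (pre K x))) ∂ν
        ≤ ∫ x, (ε / 2 + {x | p x ≠ q (pre K x)}.indicator (fun _ => M) x) ∂ν := by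
          have hRm : Measurable fun x => -Real.log (R (p x) (q (pre K x))) :=
            (Measurable.of_discrete (f := fun a : Fin k × (Fin K → Fin d) =>
              -Real.log (R a.1 (q a.2)))).comp (hp.prodMk (measurable_pre K))
          refine integral_mono ?_ ((integrable_const _).add
            ((integrable_const M).indicator hmeas)) fun x => ?_
          · refine Integrable.of_bound hRm.aestronglyMeasurable
              (max (ε / 2) M) (ae_of_all _ fun x => ?_)
            simp only [R, norm_neg]
            split_ifs
            · rw [hδ1, Real.log_exp, norm_neg, Real.norm_eq_abs, abs_of_pos (by positivity)]
              exact le_max_left _ _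
            · rw [Real.norm_eq_abs]
              exact le_max_of_le_right (by rw [hM]; linarith)
          · by_cases hx : p x = q (pre K x)
            · simp only [R]
              rw [if_pos hx, Set.indicator_of_notMem
                (show x ∉ {x | p x ≠ q (pre K x)} from fun h => h hx), hδ1, Real.log_exp]
              linarith
            · simp only [R]
              rw [if_neg hx, Set.indicator_of_mem (show x ∈ {x | p x ≠ q (pre K x)} from hx)]
              have := neg_abs_le (Real.log (δ / k))
              rw [hM]
              linarith
      _ ≤ ε := by
          rw [integral_add (integrable_const _) ((integrable_const M).indicator hmeas),
            integral_indicator_const _ hmeas]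
          have h1 : ν.real {x | p x ≠ q (pre K x)} * M ≤ ε / 2 := by
            rwa [le_div_iff₀ hM0] at hq
          simp
          linarith
  refine ⟨K, fun n => ?_⟩
  let ρ : (ℕ → Fin d) → ℝ := fun x => Real.log (R (p x) (q (pre K x)))
  let W : (Fin (n + K) → Fin d) → (Fin n → Fin k) → ℝ := fun w a =>
    ∏ i : Fin n, R (a i) (q (pre K (shift^[i] (app w z))))
  -- Draw the first `n + K` digits from `ν` and send the `n` approximate labels they determine
  -- through the channel. Gibbs' inequality is applied to the law of the output, bounded below by
  -- the single term of the word of `x`.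
  let Q : (Fin n → Fin k) → ℝ := fun a =>
    ∑ w : Fin (n + K) → Fin d, ν.real (pre (n + K) ⁻¹' {w}) * W w a
  have hW0 : ∀ w a, 0 < W w a := fun w a => Finset.prod_pos fun i _ => hRpos _ _
  have hQ0 : ∀ a, 0 ≤ Q a := fun a =>
    Finset.sum_nonneg fun w _ => mul_nonneg measureReal_nonneg (hW0 w a).le
  have hQ1 : ∑ a, Q a ≤ 1 := by
    rw [Finset.sum_comm, ← sum_measureReal_pre (n + K) ν]
    refine Finset.sum_le_sum fun w _ => ?_
    rw [← Finset.mul_sum]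
    refine mul_le_of_le_one_right measureReal_nonneg ?_
    have : ∑ a, W w a = ∏ i : Fin n, ∑ b, R b (q (pre K (shift^[i] (app w z)))) := by
      rw [Finset.prod_univ_sum, Fintype.piFinset_univ]
    rw [this]
    exact Finset.prod_le_one (fun i _ => Finset.sum_nonneg fun b _ => (hRpos _ _).le)
      fun i _ => hRsum _
  have hpn : Measurable fun (x : ℕ → Fin d) (i : Fin n) => p (shift^[i] x) :=
    measurable_pi_lambda _ fun i => hp.comp (measurable_shift.iterate _)
  have hlow : ∀ x, ν.real (PiNat.cylinder x (n + K)) * Real.exp (birkhoff ρ n x)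
      ≤ Q fun i => p (shift^[i] x) := by
    intro x
    have hterm : ν.real (PiNat.cylinder x (n + K)) * Real.exp (birkhoff ρ n x)
        = ν.real (pre (n + K) ⁻¹' {pre (n + K) x})
          * W (pre (n + K) x) fun i => p (shift^[i] x) := by
      rw [cylinder_eq_preimage]
      congr 1
      rw [birkhoff, Real.exp_sum, Finset.prod_range]
      refine Finset.prod_congr rfl fun i _ => ?_
      simp only [ρ]
      rw [Real.exp_log (hRpos _ _)]
      congr 2
      refine pre_eq_iff.2 fun l hl => ?_
      rw [shift_iterate_apply, shift_iterate_apply]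
      exact (pre_eq_iff.1 (pre_app (pre (n + K) x) z) _ (by omega)).symm
    rw [hterm]
    exact Finset.single_le_sum
      (f := fun w => ν.real (pre (n + K) ⁻¹' {w}) * W w fun i => p (shift^[i] x))
      (fun w _ => mul_nonneg measureReal_nonneg (hW0 w _).le) (Finset.mem_univ _)
  have hpos : ∀ᵐ x ∂ν, 0 < Q fun i => p (shift^[i] x) := by
    filter_upwards [ae_cylinder_pos ν (n + K)] with x hx
    exact (mul_pos hx (Real.exp_pos _)).trans_le (hlow x)
  refine (partitionEntropy_le hpn hQ0 hQ1 hpos).trans ?_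
  have hρm : Measurable ρ := (Measurable.of_discrete (f := fun a : Fin k × (Fin K → Fin d) =>
      Real.log (R a.1 (q a.2)))).comp (hp.prodMk (measurable_pre K))
  obtain ⟨B, hB⟩ : ∃ B, ∀ a b, |Real.log (R a b)| ≤ B :=
    ⟨∑ a, ∑ b, |Real.log (R a b)|, fun a b =>
      (Finset.single_le_sum (f := fun b => |Real.log (R a b)|) (fun _ _ => abs_nonneg _)
        (Finset.mem_univ b)).trans (Finset.single_le_sum (f := fun a => ∑ b, |Real.log (R a b)|)
          (fun _ _ => Finset.sum_nonneg fun _ _ => abs_nonneg _) (Finset.mem_univ a))⟩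
  have hρi : Integrable ρ ν := Integrable.of_bound hρm.aestronglyMeasurable B
    (ae_of_all _ fun x => hB _ _)
  have hbi : Integrable (birkhoff ρ n) ν := integrable_finsetSum _ fun i _ =>
    (hν.invariant.iterate i).integrable_comp_of_integrable hρi
  have hQi : Integrable (fun x => Real.log (Q fun i => p (shift^[i] x))) ν :=
    (Integrable.of_finite (f := fun a => Real.log (Q a))).comp_measurable hpn
  have hci := integrable_of_continuous (continuous_log_cylinder ν (n + K)) ν
  have hmono : ∫ x, (Real.log (ν.real (PiNat.cylinder x (n + K))) + birkhoff ρ n x) ∂ν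
      ≤ ∫ x, Real.log (Q fun i => p (shift^[i] x)) ∂ν := by
    refine integral_mono_ae (hci.add hbi) hQi ?_
    filter_upwards [ae_cylinder_pos ν (n + K)] with x hx
    rw [← Real.log_exp (birkhoff ρ n x), ← Real.log_mul hx.ne' (Real.exp_pos _).ne']
    exact Real.log_le_log (mul_pos hx (Real.exp_pos _)) (hlow x)
  rw [integral_add hci hbi, integral_birkhoff hν hρm hρi] at hmono
  rw [integral_neg] at hRlog
  have hn : (n : ℝ) * -∫ x, ρ x ∂ν ≤ n * ε := mul_le_mul_of_nonneg_left hRlog n.cast_nonneg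
  rw [blockEntropy_eq]
  linarith

/-- The Kolmogorov–Sinai entropy is at most each conditional entropy of the generating
partition. -/
theorem ksEntropy_le {ν : Measure (ℕ → Fin d)} (hν : IsInvariantProb ν) (m : ℕ) :
    ksEntropy shift ν ≤ ((blockEntropy ν (m + 1) - blockEntropy ν m : ℝ) : EReal) := by
  refine iSup_le fun k => iSup_le fun p => iSup_le fun hp => ?_
  set Δ := blockEntropy ν (m + 1) - blockEntropy ν m with hΔ
  -- For `t > Δ` the approximation error per symbol may be `t - Δ`. Since cylinder entropies grow
  -- from `m` on by at most `Δ` per digit, the normalised entropies have upper limit at most `t`.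
  refine EReal.le_of_forall_lt_iff_le.1 fun t ht => ?_
  have ht' : 0 < t - Δ := by
    have := EReal.coe_lt_coe_iff.1 ht
    linarith
  obtain ⟨K, hK⟩ := exists_partitionEntropy_le hν hp ht'
  have hlim : Tendsto (fun n : ℕ =>
      (((blockEntropy ν m + ((K : ℝ) - m) * Δ) / n + (Δ + (t - Δ)) : ℝ) : EReal)) atTop
      (𝓝 ((t : ℝ) : EReal)) := by
    refine (continuous_coe_real_ereal.tendsto _).comp ?_
    simpa using (tendsto_const_div_atTop_nhds_zero_nat
      (blockEntropy ν m + ((K : ℝ) - m) * Δ)).add_const (Δ + (t - Δ))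
  rw [← hlim.limsup_eq]
  refine limsup_le_limsup ?_
  filter_upwards [eventually_ge_atTop (m + 1)] with n hn
  have hn0 : (0 : ℝ) < n := by
    have : 0 < n := by omega
    exact_mod_cast this
  rw [EReal.coe_le_coe_iff, div_add' _ _ _ hn0.ne']
  refine div_le_div_of_nonneg_right ((hK n).trans ?_) hn0.le
  obtain ⟨l, rfl⟩ := Nat.exists_eq_add_of_le (show m ≤ n by omega)
  have := blockEntropy_le_add hν m (l + K)
  rw [← add_assoc] at this
  push_cast at this ⊢
  linarith

/-- The partition by the digit in position `0` is tested: its joins are the cylinder partitions. -/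
theorem le_ksEntropy (ν : Measure (ℕ → Fin d)) {h D : ℝ}
    (hle : ∀ n : ℕ, n * h - D ≤ blockEntropy ν n) : (h : EReal) ≤ ksEntropy shift ν := by
  have hp : Measurable fun x : ℕ → Fin d => x 0 := measurable_pi_apply 0
  refine le_trans ?_ (le_iSup_of_le d (le_iSup_of_le (fun x : ℕ → Fin d => x 0)
    (le_iSup_of_le hp le_rfl)))
  have hlim : Tendsto (fun n : ℕ => ((h - D / n : ℝ) : EReal)) atTop (𝓝 ((h : ℝ) : EReal)) := by
    refine (continuous_coe_real_ereal.tendsto _).comp ?_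
    simpa using (tendsto_const_div_atTop_nhds_zero_nat D).const_sub h
  rw [← hlim.limsup_eq]
  refine limsup_le_limsup ?_
  filter_upwards [eventually_ge_atTop 1] with n hn
  have hn0 : (0 : ℝ) < n := by exact_mod_cast hn
  have e : (fun (x : ℕ → Fin d) (i : Fin n) => shift^[i] x 0) = pre n := by
    funext x i
    simp [shift_iterate_apply, pre]
  rw [EReal.coe_le_coe_iff, e, sub_div' hn0.ne']
  refine div_le_div_of_nonneg_right ?_ hn0.le
  have := hle n
  rw [blockEntropy] at this
  linarith

end Entropy

/-! ## Equilibrium states -/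

section Equilibrium

variable {d : ℕ} {g : (ℕ → Fin d) → ℝ} {μ : Measure (ℕ → Fin d)}

theorem IsGMeasure.blockEntropy_le (hg : IsHolderG g) (hμ : IsGMeasure g μ) :
    ∃ D : ℝ, ∀ ν : Measure (ℕ → Fin d), IsInvariantProb ν → ∀ n : ℕ,
      blockEntropy ν n ≤ D - n * ∫ x, Real.log (g x) ∂ν := by
  obtain ⟨D, -, hD⟩ := hμ.exists_bounds hg
  have := hμ.prob
  refine ⟨D, fun ν hν n => ?_⟩
  have := hν.prob
  have hpos : ∀ x, 0 < μ.real (pre n ⁻¹' {pre n x}) := fun x => by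
    rw [← cylinder_eq_preimage]; exact hμ.cylinder_pos hg x n
  -- The cylinder masses of `μ` serve as the reference law for every `ν`, so the constant `D` does
  -- not depend on `ν`.
  refine (partitionEntropy_le (ν := ν) (measurable_pre n) (Q := fun w => μ.real (pre n ⁻¹' {w}))
    (fun w => measureReal_nonneg) (sum_measureReal_pre n μ).le (ae_of_all _ hpos)).trans ?_
  have hb := integrable_of_continuous (continuous_birkhoff hg.continuous_log n) ν
  have h : ∫ x, (-D + birkhoff (fun x => Real.log (g x)) n x) ∂ν
      ≤ ∫ x, Real.log (μ.real (pre n ⁻¹' {pre n x})) ∂ν := by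
    refine integral_mono ((integrable_const _).add hb)
      (integrable_of_continuous (continuous_comp_pre fun w => Real.log (μ.real (pre n ⁻¹' {w}))) ν)
      fun x => ?_
    rw [Real.le_log_iff_exp_le (hpos x), Real.exp_add, ← cylinder_eq_preimage]
    exact (hD n x).1
  rw [integral_add (integrable_const _) hb, integral_birkhoff hν hg.continuous_log.measurable
    (integrable_of_continuous hg.continuous_log ν)] at h
  simp only [integral_const, probReal_univ, one_smul] at h
  linarith

theorem IsGMeasure.le_blockEntropy (hg : IsHolderG g) (hμ : IsGMeasure g μ) :
    ∃ D : ℝ, ∀ n : ℕ, n * (-∫ x, Real.log (g x) ∂μ) - D ≤ blockEntropy μ n := by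
  obtain ⟨D, -, hD⟩ := hμ.exists_bounds hg
  have := hμ.prob
  refine ⟨D, fun n => ?_⟩
  have hb := integrable_of_continuous (continuous_birkhoff hg.continuous_log n) μ
  have h : ∫ x, Real.log (μ.real (PiNat.cylinder x n)) ∂μ
      ≤ ∫ x, (D + birkhoff (fun x => Real.log (g x)) n x) ∂μ := by
    refine integral_mono (integrable_of_continuous (continuous_log_cylinder μ n) μ)
      ((integrable_const _).add hb) fun x => ?_
    rw [Real.log_le_iff_le_exp (hμ.cylinder_pos hg x n), Real.exp_add]
    exact (hD n x).2
  rw [integral_add (integrable_const _) hb, integral_birkhoff hμ.isInvariantProb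
    hg.continuous_log.measurable (integrable_of_continuous hg.continuous_log μ)] at h
  simp only [integral_const, probReal_univ, one_smul] at h
  rw [blockEntropy_eq]
  linarith

theorem IsGMeasure.ksEntropy_le_integral (hg : IsHolderG g) (hμ : IsGMeasure g μ)
    {ν : Measure (ℕ → Fin d)} (hν : IsInvariantProb ν) :
    ksEntropy shift ν ≤ ((-∫ x, Real.log (g x) ∂ν : ℝ) : EReal) := by
  obtain ⟨D, hD⟩ := hμ.blockEntropy_le hg
  refine EReal.le_of_forall_lt_iff_le.1 fun t ht => ?_
  rw [EReal.coe_lt_coe_iff] at ht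
  obtain ⟨m, hm⟩ : ∃ m, blockEntropy ν (m + 1) - blockEntropy ν m ≤ t := by
    -- If every increment exceeded `t > -∫ log g`, the cylinder entropies would outgrow their linear
    -- upper bound.
    by_contra! hcon
    have hlow : ∀ n : ℕ, blockEntropy ν 0 + n * t ≤ blockEntropy ν n := by
      intro n
      induction n with
      | zero => simp
      | succ n ih => push_cast; linarith [hcon n]
    obtain ⟨n, hn⟩ := exists_nat_gt ((D - blockEntropy ν 0) / (t + ∫ x, Real.log (g x) ∂ν))
    rw [div_lt_iff₀ (by linarith)] at hn
    linarith [hlow n, hD ν hν n]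
  exact (ksEntropy_le hν m).trans (EReal.coe_le_coe_iff.2 hm)

theorem IsGMeasure.isEquilibriumState (hg : IsHolderG g) (hμ : IsGMeasure g μ) :
    IsEquilibriumState (fun x => Real.log (g x)) 0 μ := by
  have hle : ∀ ν, IsInvariantProb ν → freeEnergy (fun x => Real.log (g x)) ν ≤ 0 := by
    intro ν hν
    refine (add_le_add_left (hμ.ksEntropy_le_integral hg hν) _).trans ?_
    rw [← EReal.coe_add, neg_add_cancel, EReal.coe_zero]
  have hval : freeEnergy (fun x => Real.log (g x)) μ = 0 := by
    refine le_antisymm (hle μ hμ.isInvariantProb) ?_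
    obtain ⟨D, hD⟩ := hμ.le_blockEntropy hg
    refine le_trans ?_ (add_le_add_left (le_ksEntropy μ hD) _)
    rw [← EReal.coe_add, neg_add_cancel, EReal.coe_zero]
  refine ⟨hμ.isInvariantProb, by rw [hval, EReal.coe_zero], ?_, ?_⟩
  · rintro _ ⟨ν, hν, rfl⟩
    rw [EReal.coe_zero]
    exact hle ν hν
  · exact fun b hb => hb ⟨μ, hμ.isInvariantProb, by rw [hval, EReal.coe_zero]⟩

/-- A form of Pinsker's inequality. -/
theorem sq_sum_abs_sub_le {ι : Type*} [Fintype ι] {V A : ι → ℝ} (hV : ∀ i, 0 ≤ V i)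
    (hA : ∀ i, 0 ≤ A i) (hpos : ∀ i, 0 < V i → 0 < A i) (hV1 : ∑ i, V i = 1) (hA1 : ∑ i, A i = 1)
    {ε : ℝ} (h : ∑ i, V i * (Real.log (V i) - Real.log (A i)) ≤ ε) :
    (∑ i, |A i - V i|) ^ 2 ≤ 4 * ε := by
  -- Relative entropy bounds the Hellinger distance, by `log t ≤ t - 1` at `t = √(A i / V i)`.
  -- Cauchy–Schwarz with `|A - V| = |√A - √V| (√A + √V)` passes to the `ℓ¹` distance.
  have key : ∀ i, (√(A i) - √(V i)) ^ 2 ≤ A i - V i + V i * (Real.log (V i) - Real.log (A i)) := by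
    intro i
    have hVs := Real.sq_sqrt (hV i)
    have hAs := Real.sq_sqrt (hA i)
    rcases eq_or_lt_of_le (hV i) with h0 | h0
    · rw [← h0] at hVs ⊢
      simp [hAs]
    · have hA0 := hpos i h0
      have hv := Real.sqrt_pos.2 h0
      have ha := Real.sqrt_pos.2 hA0
      have h1 := Real.log_le_sub_one_of_pos (div_pos ha hv)
      rw [Real.log_div ha.ne' hv.ne', Real.log_sqrt hA0.le, Real.log_sqrt h0.le] at h1
      have h2 := mul_le_mul_of_nonneg_left h1 h0.le
      have h3 : V i * (√(A i) / √(V i) - 1) = √(V i) * √(A i) - V i := by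
        nth_rewrite 1 [← hVs]
        field_simp
        rw [mul_sub, ← sq, hVs]
      rw [h3] at h2
      nlinarith
  have h1 : ∑ i, (√(A i) - √(V i)) ^ 2 ≤ ε := by
    refine (Finset.sum_le_sum fun i _ => key i).trans ?_
    rw [Finset.sum_add_distrib, Finset.sum_sub_distrib, hV1, hA1]
    linarith
  have h2 : ∑ i, (√(A i) + √(V i)) ^ 2 ≤ 4 := by
    calc _ ≤ ∑ i, (2 * A i + 2 * V i) := Finset.sum_le_sum fun i _ => by
          nlinarith [Real.sq_sqrt (hV i), Real.sq_sqrt (hA i), sq_nonneg (√(A i) - √(V i))]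
      _ = 4 := by rw [Finset.sum_add_distrib, ← Finset.mul_sum, ← Finset.mul_sum, hV1, hA1]; norm_num
  have h3 : ∀ i, |A i - V i| = |√(A i) - √(V i)| * (√(A i) + √(V i)) := by
    intro i
    rw [← abs_of_nonneg (add_nonneg (Real.sqrt_nonneg (A i)) (Real.sqrt_nonneg (V i))), ← abs_mul]
    congr 1
    linear_combination -Real.sq_sqrt (hA i) + Real.sq_sqrt (hV i)
  have h4 := Finset.sum_mul_sq_le_sq_mul_sq Finset.univ (fun i => |√(A i) - √(V i)|)
    (fun i => √(A i) + √(V i))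
  simp only [sq_abs, ← h3] at h4
  have h5 : 0 ≤ ∑ i, (√(A i) - √(V i)) ^ 2 := Finset.sum_nonneg fun i _ => sq_nonneg _
  nlinarith

/-- Two laws on words of length `n + 1` are compared: `V`, the cylinder masses of `ν`, and `A`,
where the last `n` digits follow `ν` and the first is drawn with `g`. The hypothesis bounds their
relative entropy by the error of replacing `log g` by its value at the truncated point, which tends
to zero. Integrals against `V` and `A` approximate `∫ φ` and `∫ L_g φ`. -/
theorem isGMeasure_of_entropy (hg : IsHolderG g) {ν : Measure (ℕ → Fin d)}
    (hν : IsInvariantProb ν)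
    (h : ∀ n, -∫ x, Real.log (g x) ∂ν ≤ blockEntropy ν (n + 1) - blockEntropy ν n) :
    IsGMeasure g ν := by
  have := hν.prob
  obtain ⟨z⟩ := nonempty_of_isProbabilityMeasure ν
  let V : (n : ℕ) → (Fin (n + 1) → Fin d) → ℝ := fun n w =>
    ν.real (PiNat.cylinder (app w z) (n + 1))
  let A : (n : ℕ) → (Fin (n + 1) → Fin d) → ℝ := fun n w =>
    g (app w z) * ν.real (PiNat.cylinder (shift (app w z)) n)
  have hAF : ∀ n (φ : (ℕ → Fin d) → ℝ), ∑ w, A n w * φ (app w z)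
      = ∫ x, transfer g φ (app (pre n x) z) ∂ν := by
    intro n φ
    rw [integral_comp_pre ν fun w => transfer g φ (app w z), sum_word_succ]
    refine Finset.sum_congr rfl fun b _ => ?_
    simp only [transfer, A, app_cons, shift_prepend, ← preimage_pre_eq_cylinder, Finset.mul_sum]
    exact Finset.sum_congr rfl fun j _ => by ring
  have hVF : ∀ n (φ : (ℕ → Fin d) → ℝ), ∑ w, V n w * φ (app w z)
      = ∫ x, φ (app (pre (n + 1) x) z) ∂ν := by
    intro n φ
    rw [integral_comp_pre ν fun w => φ (app w z)]
    simp only [V, ← preimage_pre_eq_cylinder]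
  have hA1 : ∀ n, ∑ w, A n w = 1 := by
    intro n
    simpa [transfer, hg.sum_eq_one] using hAF n fun _ => 1
  have hV1 : ∀ n, ∑ w, V n w = 1 := fun n => by simpa using hVF n fun _ => 1
  have hclose : ∀ (φ : (ℕ → Fin d) → ℝ), Continuous φ → ∀ ε > 0, ∃ N : ℕ, ∀ n ≥ N,
      |∫ x, φ (app (pre n x) z) ∂ν - ∫ x, φ x ∂ν| ≤ ε := by
    intro φ hφ ε hε
    obtain ⟨N, hN⟩ := exists_close_of_continuous hφ hε
    refine ⟨N, fun n hn => ?_⟩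
    rw [← integral_sub (integrable_of_continuous (continuous_comp_pre fun w => φ (app w z)) ν)
      (integrable_of_continuous hφ ν), ← Real.norm_eq_abs]
    simpa using norm_integral_le_of_norm_le_const (μ := ν)
      (f := fun x => φ (app (pre n x) z) - φ x)
      (ae_of_all _ fun x => (hN n hn (app (pre n x) z) x (pre_app _ _)).le)
  have hkl : ∀ n, ∑ w, V n w * (Real.log (V n w) - Real.log (A n w))
      = -blockEntropy ν (n + 1) + blockEntropy ν n
        - ∫ x, Real.log (g (app (pre (n + 1) x) z)) ∂ν := by
    intro n
    have e1 : ∑ w, V n w * Real.log (V n w) = -blockEntropy ν (n + 1) := by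
      rw [blockEntropy, partitionEntropy, ← Finset.sum_neg_distrib]
      refine Finset.sum_congr rfl fun w _ => ?_
      rw [preimage_pre_eq_cylinder w z, Real.negMulLog]
      simp only [V]
      ring
    have e2 : ∑ w, V n w * Real.log (ν.real (PiNat.cylinder (shift (app w z)) n))
        = -blockEntropy ν n := by
      rw [hVF n fun x => Real.log (ν.real (PiNat.cylinder (shift x) n)),
        ← integral_log_cylinder_shift hν]
      simp only [cylinder_shift_app_pre _ _ le_rfl]
    rw [← hVF n fun x => Real.log (g x), ← e1, ← sub_neg_eq_add, ← e2, ← Finset.sum_sub_distrib,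
      ← Finset.sum_sub_distrib]
    refine Finset.sum_congr rfl fun w _ => ?_
    rcases eq_or_lt_of_le (measureReal_nonneg (μ := ν) (s := PiNat.cylinder (app w z) (n + 1)))
      with h0 | h0
    · simp only [V, ← h0]; simp
    · have h1 := h0.trans_le (cylinder_le_shift hν n (app w z))
      simp only [A]
      rw [Real.log_mul (hg.pos _).ne' h1.ne']
      ring
  refine ⟨hg.isGFunction, inferInstance, fun φ hφ => ?_⟩
  obtain ⟨B, hB0, hB⟩ := exists_bound_of_continuous hφ
  refine eq_of_forall_dist_le fun ε hε => ?_
  rw [Real.dist_eq]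
  obtain ⟨N₁, h₁⟩ := hclose _ (continuous_transfer hg.continuous hφ) (ε / 4) (by positivity)
  obtain ⟨N₂, h₂⟩ := hclose _ hφ (ε / 4) (by positivity)
  -- Makes the Pinsker bound `4 * δ` equal to `(ε / (2 * B)) ^ 2`; times `sup |φ| ≤ B` this leaves
  -- `ε / 2`.
  set δ := (ε / (2 * B)) ^ 2 / 4 with hδ
  have hδ0 : 0 < δ := by positivity
  obtain ⟨N₃, h₃⟩ := hclose _ hg.continuous_log δ hδ0
  set n := max N₁ (max N₂ N₃) with hn
  have hn1 : N₁ ≤ n := le_max_left _ _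
  have hn2 : N₂ ≤ n := (le_max_left _ _).trans (le_max_right _ _)
  have hn3 : N₃ ≤ n := (le_max_right _ _).trans (le_max_right _ _)
  have hpin : (∑ w, |A n w - V n w|) ^ 2 ≤ 4 * δ := by
    refine sq_sum_abs_sub_le (fun w => measureReal_nonneg)
      (fun w => mul_nonneg (hg.pos _).le measureReal_nonneg)
      (fun w h0 => mul_pos (hg.pos _) (h0.trans_le (cylinder_le_shift hν n (app w z))))
      (hV1 n) (hA1 n) ?_
    rw [hkl]
    linarith [(abs_le.1 (h₃ (n + 1) (by omega))).1, h n]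
  have hsum : ∑ w, |A n w - V n w| ≤ ε / (2 * B) := by
    refine abs_le_of_sq_le_sq' ?_ (by positivity) |>.2
    rw [hδ] at hpin
    linarith
  have hdiff : |∫ x, transfer g φ (app (pre n x) z) ∂ν - ∫ x, φ (app (pre (n + 1) x) z) ∂ν|
      ≤ ε / 2 := by
    rw [← hAF, ← hVF, ← Finset.sum_sub_distrib]
    refine (Finset.abs_sum_le_sum_abs _ _).trans ?_
    calc _ ≤ ∑ w, |A n w - V n w| * B := by
          refine Finset.sum_le_sum fun w _ => ?_
          rw [← sub_mul, abs_mul]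
          exact mul_le_mul_of_nonneg_left (hB _) (abs_nonneg _)
      _ ≤ ε / (2 * B) * B := by
          rw [← Finset.sum_mul]
          exact mul_le_mul_of_nonneg_right hsum hB0.le
      _ = ε / 2 := by field_simp
  have f1 := abs_le.1 (h₁ n hn1)
  have f2 := abs_le.1 (h₂ (n + 1) (by omega))
  have f3 := abs_le.1 hdiff
  exact abs_le.2 ⟨by linarith [f1.1, f1.2, f2.1, f2.2, f3.1, f3.2],
    by linarith [f1.1, f1.2, f2.1, f2.2, f3.1, f3.2]⟩

theorem IsGMeasure.eq_of_isEquilibriumState (hg : IsHolderG g) (hμ : IsGMeasure g μ)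
    {ν : Measure (ℕ → Fin d)} (hν : IsEquilibriumState (fun x => Real.log (g x)) 0 ν) : ν = μ := by
  refine (isGMeasure_of_entropy hg hν.invariantProb fun n => ?_).eq hg hμ
  have h1 := hν.value
  have h2 : freeEnergy (fun x => Real.log (g x)) ν ≤
      ((blockEntropy ν (n + 1) - blockEntropy ν n : ℝ) : EReal)
        + ((∫ x, Real.log (g x) ∂ν : ℝ) : EReal) :=
    add_le_add_left (ksEntropy_le hν.invariantProb n) _
  rw [h1, ← EReal.coe_add, EReal.coe_le_coe_iff] at h2
  linarith

end Equilibrium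

/-! ## Approximate Birkhoff sums -/

/-- A sequence that is a Birkhoff cocycle up to geometrically small errors stays at bounded distance
from the Birkhoff sums. It is applied to logarithms of interval lengths, with digits stripped from
either end. -/
theorem abs_sub_birkhoff_le {d : ℕ} {φ : (ℕ → Fin d) → ℝ} {a : ℕ → (ℕ → Fin d) → ℝ} {C τ : ℝ}
    (hC : 0 ≤ C) (h0 : 0 ≤ τ) (h1 : τ < 1) (ha0 : ∀ x, a 0 x = 0)
    (ha : ∀ n x, |a (n + 1) x - a n (shift x) - φ x| ≤ C * τ ^ n) (n : ℕ) (x : ℕ → Fin d) :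
    |a n x - birkhoff φ n x| ≤ C / (1 - τ) := by
  have hτ : 0 < 1 - τ := by linarith
  have key : ∀ (n : ℕ) (x : ℕ → Fin d),
      |a n x - birkhoff φ n x| ≤ C / (1 - τ) * (1 - τ ^ n) := by
    intro n
    induction n with
    | zero => intro x; simp [ha0, birkhoff]
    | succ n ih =>
      intro x
      have e : C / (1 - τ) * (1 - τ ^ (n + 1)) = C * τ ^ n + C / (1 - τ) * (1 - τ ^ n) := by
        field_simp
        ring
      rw [e, birkhoff_succ, show a (n + 1) x - (φ x + birkhoff φ n (shift x))
        = (a (n + 1) x - a n (shift x) - φ x) + (a n (shift x) - birkhoff φ n (shift x)) by ring]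
      exact (abs_add_le _ _).trans (add_le_add (ha n x) (ih _))
  refine (key n x).trans (mul_le_of_le_one_right (by positivity) ?_)
  linarith [pow_nonneg h0 n]

theorem isSymbolicHolder_exp {d : ℕ} {u : (ℕ → Fin d) → ℝ} (hu : IsSymbolicHolder u) :
    IsSymbolicHolder fun x => Real.exp (u x) := by
  obtain ⟨B, -, hB⟩ := exists_bound_of_continuous (continuous_of_holder hu)
  obtain ⟨C, hC, τ, h0, h1, h⟩ := hu
  have key : ∀ x y, Real.exp (u x) - Real.exp (u y) ≤ Real.exp B * |u x - u y| := by
    intro x y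
    have h2 := Real.add_one_le_exp (u y - u x)
    have h3 : Real.exp (u y) = Real.exp (u x) * Real.exp (u y - u x) := by
      rw [← Real.exp_add]; ring_nf
    have h4 : Real.exp (u x) ≤ Real.exp B := Real.exp_le_exp.2 (abs_le.1 (hB x)).2
    have h5 := le_abs_self (u x - u y)
    have h6 := Real.exp_pos (u x)
    have h7 : Real.exp (u x) - Real.exp (u y) ≤ Real.exp (u x) * |u x - u y| := by
      rw [h3]; nlinarith
    exact h7.trans (mul_le_mul_of_nonneg_right h4 (abs_nonneg _))
  refine ⟨Real.exp B * C, by positivity, τ, h0, h1, fun n x y hxy => ?_⟩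
  have hb := mul_le_mul_of_nonneg_left (h n x y hxy) (Real.exp_pos B).le
  rw [← mul_assoc] at hb
  refine abs_le.2 ⟨?_, (key x y).trans hb⟩
  have := key y x
  rw [abs_sub_comm] at this
  linarith

/-! ## Words of digits -/

section DigitWords

variable {d : ℕ}

theorem rightWord_succ (x : ℕ → Fin d) (n : ℕ) :
    rightWord x (n + 1) = rightWord (shift x) n ++ [x 0] := by
  simp [rightWord, List.range_succ_eq_map, shift, Function.comp_def]

theorem rightWord_succ' (x : ℕ → Fin d) (n : ℕ) : rightWord x (n + 1) = x n :: rightWord x n := by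
  simp [rightWord, List.range_succ]

theorem leftWord_succ (x : ℕ → Fin d) (n : ℕ) :
    leftWord x (n + 1) = x 0 :: leftWord (shift x) n := by
  simp [leftWord, List.range_succ_eq_map, shift, Function.comp_def]

theorem rightWord_length (x : ℕ → Fin d) (n : ℕ) : (rightWord x n).length = n := by
  simp [rightWord]

theorem leftWord_length (x : ℕ → Fin d) (n : ℕ) : (leftWord x n).length = n := by
  simp [leftWord]

theorem rightWord_congr {x y : ℕ → Fin d} {n : ℕ} (h : ∀ k < n, x k = y k) :
    rightWord x n = rightWord y n := by
  rw [rightWord, rightWord, List.map_congr_left fun k hk => h k (List.mem_range.1 hk)]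

theorem leftWord_congr {x y : ℕ → Fin d} {n : ℕ} (h : ∀ k < n, x k = y k) :
    leftWord x n = leftWord y n :=
  List.map_congr_left fun k hk => h k (List.mem_range.1 hk)

end DigitWords

/-! ## Markov partitions of circle endomorphisms -/

namespace CircleEndo

variable {d : ℕ} (f : CircleEndo d)

theorem lift_add_natCast (x : ℝ) (k : ℕ) : f.lift (x + k) = f.lift x + (k * d : ℕ) := by
  induction k with
  | zero => simp
  | succ k ih =>
    rw [Nat.cast_succ, ← add_assoc, f.map_add_one, ih]
    push_cast
    ring

theorem lift_iterate_add_natCast (n : ℕ) (x : ℝ) (k : ℕ) :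
    f.lift^[n] (x + k) = f.lift^[n] x + (k * d ^ n : ℕ) := by
  induction n generalizing x k with
  | zero => simp
  | succ n ih =>
    rw [Function.iterate_succ_apply, lift_add_natCast, ih, ← Function.iterate_succ_apply f.lift,
      pow_succ', mul_assoc]

theorem exists_lift_iterate_branch (w : List (Fin d)) :
    ∃ k : ℕ, ∀ x, f.lift^[w.length] (f.branch w x) = x + k := by
  induction w with
  | nil => exact ⟨0, fun x => by simp [branch]⟩
  | cons i v ih =>
    obtain ⟨k, hk⟩ := ih
    refine ⟨k + i * d ^ v.length, fun x => ?_⟩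
    rw [List.length_cons, Function.iterate_succ_apply, branch, OrderIso.apply_symm_apply,
      lift_iterate_add_natCast, hk]
    push_cast
    ring

theorem branch_mem (w : List (Fin d)) {x : ℝ} (hx : x ∈ Set.Icc (0 : ℝ) 1) :
    f.branch w x ∈ Set.Icc (0 : ℝ) 1 := by
  induction w with
  | nil => exact hx
  | cons i v ih =>
    have h0 : f.lift 0 = 0 := f.map_zero
    have h1 : f.lift 1 = d := by simpa using f.lift_natCast 1
    have hi : ((i : ℕ) : ℝ) + 1 ≤ d := by exact_mod_cast i.2
    have hi0 : (0 : ℝ) ≤ (i : ℕ) := Nat.cast_nonneg _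
    constructor
    · rw [branch, f.lift.le_symm_apply, h0]
      linarith [ih.1]
    · rw [branch, f.lift.symm_apply_le, h1]
      linarith [ih.2]

theorem interval_append_subset (v w : List (Fin d)) : f.interval (v ++ w) ⊆ f.interval v := by
  have hm := (f.branch_strictMono v).monotone
  simp only [interval, branch_append]
  exact Set.Icc_subset_Icc (hm (f.branch_mem w ⟨le_rfl, zero_le_one⟩).1)
    (hm (f.branch_mem w ⟨zero_le_one, le_rfl⟩).2)

theorem length_pos (w : List (Fin d)) : 0 < f.length w :=
  sub_pos.2 (f.branch_strictMono w zero_lt_one)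

theorem length_nil : f.length [] = 1 := by simp [length, branch]

theorem sum_length_append (w : List (Fin d)) : ∑ j : Fin d, f.length (w ++ [j]) = f.length w := by
  have h1 : f.lift.symm d = 1 := by
    rw [OrderIso.symm_apply_eq]
    simpa using (f.lift_natCast 1).symm
  have h0 : f.lift.symm 0 = 0 := by rw [OrderIso.symm_apply_eq, f.map_zero]
  -- The points `F⁻¹ j` cut `[0, 1]` into the first-level intervals, so their images under the
  -- branch telescope.
  have e : ∀ j : Fin d, f.length (w ++ [j])
      = f.branch w (f.lift.symm ((j : ℕ) + 1 : ℕ)) - f.branch w (f.lift.symm (j : ℕ)) := by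
    intro j
    simp [length, branch_append, branch, add_comm]
  rw [Finset.sum_congr rfl fun j _ => e j, Fin.sum_univ_eq_sum_range fun j =>
    f.branch w (f.lift.symm (j + 1 : ℕ)) - f.branch w (f.lift.symm (j : ℕ)),
    Finset.sum_range_sub fun j => f.branch w (f.lift.symm (j : ℕ))]
  simp [length, h0, h1]

variable {f}

theorem IsC1PlusExpanding.differentiable (hf : f.IsC1PlusExpanding) : Differentiable ℝ f.lift :=
  hf.contDiff.differentiable one_ne_zero

theorem IsC1PlusExpanding.exists_deriv_lower_bound (hf : f.IsC1PlusExpanding) :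
    ∃ c : ℝ, 0 < c ∧ ∀ x, c ≤ deriv f.lift x := by
  obtain ⟨C, hC, lam, hlam, h⟩ := hf.expanding
  exact ⟨C * lam ^ 1, by positivity, fun x => by simpa using h 1 le_rfl x⟩

theorem IsC1PlusExpanding.exists_length_le (hf : f.IsC1PlusExpanding) :
    ∃ M : ℝ, 0 < M ∧ ∃ r : ℝ, 0 < r ∧ r < 1 ∧ ∀ w : List (Fin d),
      f.length w ≤ M * r ^ w.length := by
  obtain ⟨C, hC, lam, hlam, h⟩ := hf.expanding
  refine ⟨max 1 C⁻¹, by positivity, lam⁻¹, by positivity, inv_lt_one_of_one_lt₀ hlam, fun w => ?_⟩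
  rcases Nat.eq_zero_or_pos w.length with h0 | h0
  · rw [List.length_eq_zero_iff.1 h0, length_nil]
    simp
  · obtain ⟨k, hk⟩ := f.exists_lift_iterate_branch w
    -- `F^n` maps `I_w` onto an integer translate of `[0, 1]` with derivative at least `C λ^n`. The
    -- maximum with `1` in the constant covers the empty word.
    have h1 := mul_sub_le_image_sub_of_le_deriv (hf.differentiable.iterate w.length)
      (h w.length h0) ((f.branch_strictMono w).monotone zero_le_one)
    rw [hk, hk, add_sub_add_right_eq_sub, sub_zero] at h1
    have h2 : f.length w ≤ C⁻¹ * lam⁻¹ ^ w.length := by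
      rw [inv_pow, ← mul_inv, ← one_div, le_div_iff₀ (by positivity), mul_comm]
      exact h1
    exact h2.trans (mul_le_mul_of_nonneg_right (le_max_right _ _) (by positivity))

/-- The oscillation of `log F'` on the intervals of the Markov partition decays
exponentially. -/
theorem IsC1PlusExpanding.exists_log_deriv_osc (hf : f.IsC1PlusExpanding) :
    ∃ K : ℝ, 0 < K ∧ ∃ τ : ℝ, 0 < τ ∧ τ < 1 ∧ ∀ w : List (Fin d), ∀ ξ ∈ f.interval w,
      ∀ η ∈ f.interval w,
      |Real.log (deriv f.lift ξ) - Real.log (deriv f.lift η)| ≤ K * τ ^ w.length := by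
  obtain ⟨c, hc, hder⟩ := hf.exists_deriv_lower_bound
  obtain ⟨M, hM, r, hr0, hr1, hlen⟩ := hf.exists_length_le
  obtain ⟨α, hα0, -, K, hK⟩ := hf.holder
  refine ⟨(|K| + 1) * M ^ α / c, by positivity, r ^ α, Real.rpow_pos_of_pos hr0 α,
    Real.rpow_lt_one hr0.le hr1 hα0, fun w => ?_⟩
  have key : ∀ ξ ∈ f.interval w, ∀ η ∈ f.interval w,
      Real.log (deriv f.lift ξ) - Real.log (deriv f.lift η)
        ≤ (|K| + 1) * M ^ α / c * (r ^ α) ^ w.length := by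
    intro ξ hξ η hη
    have hξ0 := hc.trans_le (hder ξ)
    have hη0 := hc.trans_le (hder η)
    have hd : |ξ - η| ≤ M * r ^ w.length := by
      refine le_trans ?_ (hlen w)
      rw [length, abs_le]
      constructor <;> linarith [hξ.1, hξ.2, hη.1, hη.2]
    have h1 : |deriv f.lift ξ - deriv f.lift η| ≤ (|K| + 1) * (M ^ α * (r ^ α) ^ w.length) := by
      have e : M ^ α * (r ^ α) ^ w.length = (M * r ^ w.length) ^ α := by
        rw [Real.mul_rpow hM.le (by positivity), ← Real.rpow_natCast, ← Real.rpow_natCast,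
          ← Real.rpow_mul hr0.le, ← Real.rpow_mul hr0.le, mul_comm α]
      rw [e]
      refine (hK ξ η).trans ?_
      exact mul_le_mul (by linarith [le_abs_self K])
        (Real.rpow_le_rpow (abs_nonneg _) hd hα0.le) (by positivity) (by positivity)
    rw [← Real.log_div hξ0.ne' hη0.ne']
    have h2 := Real.log_le_sub_one_of_pos (div_pos hξ0 hη0)
    have h3 : deriv f.lift ξ / deriv f.lift η - 1
        = (deriv f.lift ξ - deriv f.lift η) / deriv f.lift η := by
      rw [sub_div, div_self hη0.ne']
    rw [h3] at h2
    calc _ ≤ (deriv f.lift ξ - deriv f.lift η) / deriv f.lift η := h2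
      _ ≤ |deriv f.lift ξ - deriv f.lift η| / deriv f.lift η := by
          gcongr
          exact le_abs_self _
      _ ≤ |deriv f.lift ξ - deriv f.lift η| / c := by
          gcongr
          exact hder η
      _ ≤ (|K| + 1) * (M ^ α * (r ^ α) ^ w.length) / c := by gcongr
      _ = _ := by ring
  intro ξ hξ η hη
  refine abs_le.2 ⟨?_, key ξ hξ η hη⟩
  linarith [key η hη ξ hξ]

/-- Mean value theorem: `F` maps the interval of `i :: v` onto an integer translate of that of `v`.
-/
theorem IsC1PlusExpanding.exists_log_length_cons (hf : f.IsC1PlusExpanding) (i : Fin d)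
    (v : List (Fin d)) : ∃ ξ ∈ f.interval (i :: v),
      Real.log (f.length v) - Real.log (f.length (i :: v)) = Real.log (deriv f.lift ξ) := by
  obtain ⟨ξ, hξ, h⟩ := exists_deriv_eq_slope f.lift (f.branch_strictMono (i :: v) zero_lt_one)
    f.lift.continuous.continuousOn hf.differentiable.differentiableOn
  refine ⟨ξ, Set.Ioo_subset_Icc_self hξ, ?_⟩
  have e : f.lift (f.branch (i :: v) 1) - f.lift (f.branch (i :: v) 0) = f.length v := by
    simp [branch, length]
  rw [h, e, ← Real.log_div (f.length_pos _).ne' (f.length_pos _).ne']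
  rfl

/-- The logarithm of the quotients that define the dual derivative. -/
noncomputable def logRatio (f : CircleEndo d) (n : ℕ) (x : ℕ → Fin d) : ℝ :=
  Real.log (f.length (rightWord (shift x) n)) - Real.log (f.length (rightWord x (n + 1)))

theorem logRatio_eq (n : ℕ) (x : ℕ → Fin d) : f.logRatio n x =
    Real.log (f.length (rightWord (shift x) n) / f.length (rightWord x (n + 1))) :=
  (Real.log_div (f.length_pos _).ne' (f.length_pos _).ne').symm

theorem exp_logRatio (n : ℕ) (x : ℕ → Fin d) : Real.exp (f.logRatio n x) =
    f.length (rightWord (shift x) n) / f.length (rightWord x (n + 1)) := by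
  rw [logRatio_eq, Real.exp_log (div_pos (f.length_pos _) (f.length_pos _))]

/-- The logarithms of the quotients converge, at an exponential rate. -/
theorem IsC1PlusExpanding.exists_tendsto_logRatio (hf : f.IsC1PlusExpanding) :
    ∃ u : (ℕ → Fin d) → ℝ, (∀ x, Tendsto (fun n => f.logRatio n x) atTop (𝓝 (u x))) ∧
      ∃ K : ℝ, 0 < K ∧ ∃ τ : ℝ, 0 < τ ∧ τ < 1 ∧
        ∀ n x, |f.logRatio n x - u x| ≤ K * τ ^ n := by
  obtain ⟨K, hK, τ, h0, h1, hosc⟩ := hf.exists_log_deriv_osc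
  -- Consecutive quotients differ by one digit added on the left of both words. The two resulting
  -- values of `F'` are taken at `ξ` and `η` in the same interval of level `n + 1`.
  have step : ∀ x n, dist (f.logRatio n x) (f.logRatio (n + 1) x) ≤ K * τ ^ n := by
    intro x n
    set v := rightWord (shift x) n with hv
    obtain ⟨ξ, hξ, e1⟩ := hf.exists_log_length_cons (shift x n) v
    obtain ⟨η, hη, e2⟩ := hf.exists_log_length_cons (shift x n) (v ++ [x 0])
    have hη' : η ∈ f.interval (shift x n :: v) :=
      f.interval_append_subset (shift x n :: v) [x 0] hη
    have h2 := hosc _ ξ hξ η hη'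
    rw [List.length_cons, hv, rightWord_length] at h2
    have h3 : f.logRatio n x - f.logRatio (n + 1) x
        = Real.log (deriv f.lift ξ) - Real.log (deriv f.lift η) := by
      rw [← e1, ← e2, logRatio, logRatio, rightWord_succ x (n + 1), rightWord_succ x n,
        rightWord_succ' (shift x) n, ← hv, List.cons_append]
      ring
    rw [Real.dist_eq, h3]
    refine h2.trans (mul_le_mul_of_nonneg_left ?_ hK.le)
    exact pow_le_pow_of_le_one h0.le h1.le n.le_succ
  choose u hu using fun x => cauchySeq_tendsto_of_complete
    (cauchySeq_of_le_geometric τ K h1 (step x))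
  refine ⟨u, hu, K / (1 - τ), div_pos hK (by linarith), τ, h0, h1, fun n x => ?_⟩
  have := dist_le_of_le_geometric_of_tendsto τ K h1 (step x) (hu x) n
  rw [Real.dist_eq] at this
  refine this.trans (le_of_eq ?_)
  ring

theorem IsC1PlusExpanding.exists_isDualDerivative (hf : f.IsC1PlusExpanding) :
    ∃ Ψ : DualSymSpace d → ℝ, f.IsDualDerivative Ψ := by
  obtain ⟨u, hu, -⟩ := hf.exists_tendsto_logRatio
  refine ⟨fun x => Real.exp (u x), fun x => ?_⟩
  simp only [← exp_logRatio]
  exact (Real.continuous_exp.tendsto _).comp (hu x)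

theorem IsDualDerivative.pos_and_log_approx (hf : f.IsC1PlusExpanding) {Ψ : DualSymSpace d → ℝ}
    (hΨ : f.IsDualDerivative Ψ) : (∀ x, 0 < Ψ x) ∧
      ∃ K : ℝ, 0 < K ∧ ∃ τ : ℝ, 0 < τ ∧ τ < 1 ∧
        ∀ n x, |f.logRatio n x - Real.log (Ψ x)| ≤ K * τ ^ n := by
  obtain ⟨u, hu, h⟩ := hf.exists_tendsto_logRatio
  have e : ∀ x, Ψ x = Real.exp (u x) := fun x => by
    refine tendsto_nhds_unique (hΨ x) ?_
    simp only [← exp_logRatio]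
    exact (Real.continuous_exp.tendsto _).comp (hu x)
  refine ⟨fun x => by rw [e]; exact Real.exp_pos _, ?_⟩
  simp only [e, Real.log_exp]
  exact h

theorem IsDualDerivative.isSymbolicHolder_log (hf : f.IsC1PlusExpanding)
    {Ψ : DualSymSpace d → ℝ} (hΨ : f.IsDualDerivative Ψ) :
    IsSymbolicHolder fun x => Real.log (Ψ x) := by
  obtain ⟨-, K, hK, τ, h0, h1, h⟩ := hΨ.pos_and_log_approx hf
  set S := ∑ j : Fin d, |Real.log (f.length [j])| with hS
  have hS0 : 0 ≤ S := Finset.sum_nonneg fun _ _ => abs_nonneg _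
  have hlog0 : ∀ x, |f.logRatio 0 x| ≤ S := by
    intro x
    have : f.logRatio 0 x = -Real.log (f.length [x 0]) := by
      simp [logRatio, rightWord, length_nil]
    rw [this, abs_neg]
    exact Finset.single_le_sum (f := fun j => |Real.log (f.length [j])|)
      (fun _ _ => abs_nonneg _) (Finset.mem_univ (x 0))
  -- `logRatio n` depends only on `n + 1` digits, so agreement of `n + 1` digits costs `2 K τ ^ n`,
  -- whence `2 * K / τ`. The other two terms serve when no digit agrees: `S` bounds the finitely
  -- many values of `logRatio 0`.
  refine ⟨2 * K / τ + 2 * K + 2 * S, by positivity, τ, h0, h1, fun n x y hxy => ?_⟩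
  cases n with
  | zero =>
    have hx := abs_le.1 (h 0 x)
    have hy := abs_le.1 (h 0 y)
    have hx' := abs_le.1 (hlog0 x)
    have hy' := abs_le.1 (hlog0 y)
    have : 0 ≤ 2 * K / τ := by positivity
    rw [pow_zero, mul_one] at *
    refine abs_le.2 ⟨?_, ?_⟩ <;> linarith [hx.1, hx.2, hy.1, hy.2, hx'.1, hx'.2, hy'.1, hy'.2]
  | succ n =>
    have e : f.logRatio n x = f.logRatio n y := by
      rw [logRatio, logRatio, rightWord_congr hxy,
        rightWord_congr (x := shift x) (y := shift y) fun k hk => hxy (k + 1) (by omega)]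
    have hx := abs_le.1 (h n x)
    have hy := abs_le.1 (h n y)
    rw [e] at hx
    have e2 : 2 * K / τ * τ ^ (n + 1) = 2 * (K * τ ^ n) := by
      field_simp
      ring
    have e3 : 0 ≤ (2 * K + 2 * S) * τ ^ (n + 1) := by positivity
    have e4 : (2 * K / τ + 2 * K + 2 * S) * τ ^ (n + 1)
        = 2 * K / τ * τ ^ (n + 1) + (2 * K + 2 * S) * τ ^ (n + 1) := by ring
    rw [e4, e2]
    refine abs_le.2 ⟨?_, ?_⟩ <;> linarith [hx.1, hx.2, hy.1, hy.2]

theorem IsDualDerivative.sum_eq_one {Ψ : DualSymSpace d → ℝ} (hpos : ∀ x, 0 < Ψ x)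
    (hΨ : f.IsDualDerivative Ψ) (x : DualSymSpace d) :
    ∑ j : Fin d, 1 / Ψ (prepend j x) = 1 := by
  have ht : Tendsto (fun n => ∑ j : Fin d, (f.length (rightWord (shift (prepend j x)) n) /
      f.length (rightWord (prepend j x) (n + 1)))⁻¹) atTop
      (𝓝 (∑ j : Fin d, (Ψ (prepend j x))⁻¹)) :=
    tendsto_finsetSum _ fun j _ => (hΨ (prepend j x)).inv₀ (hpos _).ne'
  simp only [one_div]
  -- The identity already holds exactly for the finite quotients, because the subintervals tile.
  refine tendsto_nhds_unique ht (tendsto_const_nhds.congr fun n => ?_)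
  simp only [inv_div, rightWord_succ, shift_prepend]
  rw [← Finset.sum_div]
  have : ∑ j : Fin d, f.length (rightWord x n ++ [prepend j x 0]) = f.length (rightWord x n) :=
    f.sum_length_append _
  rw [this, div_self (f.length_pos _).ne']

theorem IsDualDerivative.isHolderG (hf : f.IsC1PlusExpanding) {Ψ : DualSymSpace d → ℝ}
    (hΨ : f.IsDualDerivative Ψ) : IsHolderG fun x => 1 / Ψ x := by
  have hpos := (hΨ.pos_and_log_approx hf).1
  refine ⟨fun x => one_div_pos.2 (hpos x), ?_, hΨ.sum_eq_one hpos⟩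
  obtain ⟨C, hC, τ, h0, h1, h⟩ := hΨ.isSymbolicHolder_log hf
  refine ⟨C, hC, τ, h0, h1, fun n x y hxy => ?_⟩
  simp only [one_div, Real.log_inv]
  rw [neg_sub_neg, abs_sub_comm]
  exact h n x y hxy

theorem IsDualDerivative.isSymbolicHolder (hf : f.IsC1PlusExpanding)
    {Ψ : DualSymSpace d → ℝ} (hΨ : f.IsDualDerivative Ψ) : IsSymbolicHolder Ψ := by
  have h := isSymbolicHolder_exp (hΨ.isSymbolicHolder_log hf)
  simpa only [Real.exp_log ((hΨ.pos_and_log_approx hf).1 _)] using h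

theorem IsDualDerivative.exists_log_length_rightWord (hf : f.IsC1PlusExpanding)
    {Ψ : DualSymSpace d → ℝ} (hΨ : f.IsDualDerivative Ψ) :
    ∃ E : ℝ, ∀ n x, |Real.log (f.length (rightWord x n))
      - birkhoff (fun x => Real.log (1 / Ψ x)) n x| ≤ E := by
  obtain ⟨-, K, hK, τ, h0, h1, h⟩ := hΨ.pos_and_log_approx hf
  refine ⟨K / (1 - τ), fun n x => abs_sub_birkhoff_le
    (a := fun n x => Real.log (f.length (rightWord x n))) hK.le h0.le h1
    (fun x => by simp [rightWord, length_nil]) (fun n x => ?_) n x⟩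
  have e : Real.log (f.length (rightWord x (n + 1))) - Real.log (f.length (rightWord (shift x) n))
      - Real.log (1 / Ψ x) = -(f.logRatio n x - Real.log (Ψ x)) := by
    rw [logRatio, one_div, Real.log_inv]
    ring
  rw [e, abs_neg]
  exact h n x

theorem IsC1PlusExpanding.exists_log_length_leftWord (hf : f.IsC1PlusExpanding) :
    ∃ E : ℝ, ∀ n w, |Real.log (f.length (leftWord w n))
      - birkhoff (fun w => Real.log (f.weight w)) n w| ≤ E := by
  obtain ⟨K, hK, τ, h0, h1, hosc⟩ := hf.exists_log_deriv_osc
  refine ⟨K / (1 - τ), fun n w => abs_sub_birkhoff_le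
    (a := fun n w => Real.log (f.length (leftWord w n))) hK.le h0.le h1
    (fun x => by simp [leftWord, length_nil]) (fun n w => ?_) n w⟩
  obtain ⟨ξ, hξ, e⟩ := hf.exists_log_length_cons (w 0) (leftWord (shift w) n)
  rw [← leftWord_succ] at hξ e
  have h2 := hosc _ _ (f.proj_mem w (n + 1)) _ hξ
  rw [leftWord_length] at h2
  have e2 : Real.log (f.length (leftWord w (n + 1))) - Real.log (f.length (leftWord (shift w) n))
      - Real.log (f.weight w)
      = Real.log (deriv f.lift (f.proj w)) - Real.log (deriv f.lift ξ) := by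
    rw [← e, weight, one_div, Real.log_inv]
    ring
  rw [e2]
  exact h2.trans (mul_le_mul_of_nonneg_left (pow_le_pow_of_le_one h0.le h1.le n.le_succ) hK.le)

theorem IsC1PlusExpanding.isSymbolicHolder_log_weight (hf : f.IsC1PlusExpanding) :
    IsSymbolicHolder fun w => Real.log (f.weight w) := by
  obtain ⟨K, hK, τ, h0, h1, hosc⟩ := hf.exists_log_deriv_osc
  refine ⟨K, hK, τ, h0, h1, fun n x y hxy => ?_⟩
  have hx := f.proj_mem x n
  rw [leftWord_congr hxy] at hx
  have := hosc _ _ (f.proj_mem y n) _ hx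
  rw [leftWord_length] at this
  simp only [weight, one_div, Real.log_inv]
  rwa [neg_sub_neg]

end CircleEndo

/-! ## The dual of an invariant measure -/

section DualMeasure

variable {d : ℕ}

/-- The first `n` digits in the reverse order (followed by copies of the first digit). -/
def reverseDigits (n : ℕ) (w : ℕ → Fin d) : ℕ → Fin d := fun i => w (n - 1 - i)

theorem continuous_reverseDigits (n : ℕ) : Continuous (reverseDigits (d := d) n) :=
  continuous_pi fun i => continuous_apply (n - 1 - i)

theorem reverseDigits_mem_cylinder {n k : ℕ} (hk : k ≤ n) (x w : ℕ → Fin d) :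
    reverseDigits n x ∈ PiNat.cylinder w k ↔
      shift^[n - k] x ∈ PiNat.cylinder (reverseDigits k w) k := by
  simp only [PiNat.mem_cylinder_iff, reverseDigits, shift_iterate_apply]
  constructor
  · intro h i hi
    rw [← h (k - 1 - i) (by omega)]
    congr 1
    omega
  · intro h i hi
    have := h (k - 1 - i) (by omega)
    rw [show k - 1 - (k - 1 - i) = i by omega] at this
    rw [← this]
    congr 1
    omega

theorem leftWord_eq_rightWord_reverseDigits (n : ℕ) (w : ℕ → Fin d) :
    leftWord w n = rightWord (reverseDigits n w) n := by
  refine List.ext_getElem (by simp [leftWord, rightWord]) fun i h1 h2 => ?_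
  have hi : i < n := by simpa [leftWord] using h1
  simp only [leftWord, rightWord, reverseDigits, List.getElem_reverse, List.getElem_map,
    List.getElem_range, List.length_map, List.length_range]
  congr 1
  omega

/-- An invariant measure has a dual measure. -/
theorem exists_dual_measure {μ : Measure (ℕ → Fin d)} (hμ : IsInvariantProb μ) :
    ∃ m : Measure (ℕ → Fin d), IsInvariantProb m ∧ ∀ (n : ℕ) (w : ℕ → Fin d),
      m.real (PiNat.cylinder w n) = μ.real (PiNat.cylinder (reverseDigits n w) n) := by
  have := hμ.prob
  have hmeas : ∀ n, Measurable (reverseDigits (d := d) n) := fun n =>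
    (continuous_reverseDigits n).measurable
  -- Push `μ` forward by reversal of the first `n` digits. By invariance the mass of a cylinder of
  -- length `k` no longer depends on `n` once `n ≥ k`, so the limit has the prescribed cylinder
  -- masses.
  obtain ⟨m, hm⟩ := exists_tendsto_hyperfilter fun n =>
    (⟨μ.map (reverseDigits n), Measure.isProbabilityMeasure_map (hmeas n).aemeasurable⟩ :
      ProbabilityMeasure (ℕ → Fin d))
  have hcyl : ∀ (n : ℕ) (w : ℕ → Fin d), (m : Measure (ℕ → Fin d)).real (PiNat.cylinder w n)
      = μ.real (PiNat.cylinder (reverseDigits n w) n) := by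
    intro k w
    have h1 := tendsto_integral_of_tendsto hm (continuous_indicator_cylinder w k)
    simp only [integral_indicator_cylinder, ProbabilityMeasure.coe_mk] at h1
    refine tendsto_nhds_unique h1 (Tendsto.congr' ?_ tendsto_const_nhds)
    have hge : ∀ᶠ n in (hyperfilter ℕ : Filter ℕ), k ≤ n :=
      Nat.hyperfilter_le_atTop (eventually_ge_atTop k)
    filter_upwards [hge] with n hn
    rw [map_measureReal_apply (hmeas n) (measurableSet_cylinder w k),
      ← (hμ.invariant.iterate (n - k)).measureReal_preimage
        (measurableSet_cylinder _ _).nullMeasurableSet]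
    congr 1
    ext x
    exact (reverseDigits_mem_cylinder hn x w).symm
  refine ⟨m, ⟨inferInstance, measurable_shift, ?_⟩, hcyl⟩
  -- A digit put in front for `m` is one added at the far end for `μ`, so invariance of `m` is
  -- additivity of `μ`.
  refine eq_of_cylinder_real_eq fun n w => ?_
  rw [map_measureReal_apply measurable_shift (measurableSet_cylinder w n),
    measureReal_shift_preimage_cylinder, hcyl, cylinder_eq_iUnion]
  refine Finset.sum_congr rfl fun j _ => ?_
  rw [hcyl]
  congr 1
  refine cylinder_congr (pre_eq_iff.2 fun k hk => ?_)
  rcases Nat.lt_succ_iff_lt_or_eq.1 hk with h | rfl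
  · rw [Function.update_of_ne h.ne]
    simp only [reverseDigits]
    rw [show n + 1 - 1 - k = (n - 1 - k) + 1 by omega]
    rfl
  · rw [Function.update_self]
    simp only [reverseDigits]
    rw [show k + 1 - 1 - k = 0 by omega]
    rfl

theorem isDualMeasure_of_cylinder {m μ : Measure (ℕ → Fin d)} [IsFiniteMeasure m]
    [IsFiniteMeasure μ] [NeZero d] (h : ∀ (n : ℕ) (w : ℕ → Fin d),
      m.real (PiNat.cylinder w n) = μ.real (PiNat.cylinder (reverseDigits n w) n)) :
    IsDualMeasure m μ := by
  intro n j
  set w : ℕ → Fin d := app (fun i => j i.rev) fun _ => 0 with hw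
  have hwi : ∀ i : Fin n, w i = j i.rev := fun i =>
    congrFun (pre_app (fun i => j i.rev) fun _ => 0) i
  have h1 : {x : ℕ → Fin d | ∀ i : Fin n, x i = j i.rev} = PiNat.cylinder w n := by
    ext x
    simp only [Set.mem_ofPred_eq, PiNat.mem_cylinder_iff]
    exact ⟨fun hx i hi => (hx ⟨i, hi⟩).trans (hwi ⟨i, hi⟩).symm,
      fun hx i => (hx i i.2).trans (hwi i)⟩
  have hrev : ∀ i : Fin n, reverseDigits n w i = j i := by
    intro i
    have := hwi i.rev
    rw [Fin.rev_rev] at this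
    rw [← this, reverseDigits]
    congr 1
    rw [Fin.val_rev]
    omega
  have h2 : {x : ℕ → Fin d | ∀ i : Fin n, x i = j i} = PiNat.cylinder (reverseDigits n w) n := by
    ext x
    simp only [Set.mem_ofPred_eq, PiNat.mem_cylinder_iff]
    exact ⟨fun hx i hi => (hx ⟨i, hi⟩).trans (hrev ⟨i, hi⟩).symm,
      fun hx i => (hx i i.2).trans (hrev i)⟩
  rw [h1, h2, ← ENNReal.toReal_eq_toReal_iff' (measure_ne_top _ _) (measure_ne_top _ _)]
  exact (h n w).symm

/-- The dual of the Gibbs measure for `-log D*(f)` is the Gibbs measure for `-log f'`. -/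
theorem CircleEndo.IsDualDerivative.exists_gibbs_dual [NeZero d] {f : CircleEndo d}
    (hf : f.IsC1PlusExpanding) {Ψ : DualSymSpace d → ℝ} (hΨ : f.IsDualDerivative Ψ)
    {μ : Measure (DualSymSpace d)} (hμ : IsGibbsMeasure (fun x => Real.log (1 / Ψ x)) 0 μ) :
    ∃ m : Measure (SymSpace d), IsGibbsMeasure (fun w => Real.log (f.weight w)) 0 m ∧
      IsDualMeasure m μ := by
  have := hμ.invariantProb.prob
  obtain ⟨m, hm, hcyl⟩ := exists_dual_measure hμ.invariantProb
  have := hm.prob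
  obtain ⟨E, hE⟩ := hΨ.exists_log_length_rightWord hf
  obtain ⟨E', hE'⟩ := hf.exists_log_length_leftWord
  obtain ⟨C, hC, hb⟩ := hμ.exists_bounds
  refine ⟨m, IsGibbsMeasure.of_bounds hm (C := C * Real.exp (E + E')) (by positivity)
    fun n w => ?_, isDualMeasure_of_cylinder hcyl⟩
  have h1 := abs_le.1 (hE n (reverseDigits n w))
  have h2 := abs_le.1 (hE' n w)
  -- Both Birkhoff sums now approximate the logarithm of the length of the same interval, so they
  -- differ by at most `E + E'`.
  rw [← leftWord_eq_rightWord_reverseDigits] at h1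
  obtain ⟨h3, h4⟩ := hb n (reverseDigits n w)
  simp only [neg_zero, zero_mul, zero_add] at h3 h4
  rw [hcyl]
  set a := birkhoff (fun x => Real.log (1 / Ψ x)) n (reverseDigits n w)
  set b := birkhoff (fun w => Real.log (f.weight w)) n w
  have e1 : Real.exp b ≤ Real.exp (E + E') * Real.exp a := by
    rw [← Real.exp_add]
    exact Real.exp_le_exp.2 (by linarith [h1.1, h1.2, h2.1, h2.2])
  have e2 : Real.exp a ≤ Real.exp (E + E') * Real.exp b := by
    rw [← Real.exp_add]
    exact Real.exp_le_exp.2 (by linarith [h1.1, h1.2, h2.1, h2.2])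
  constructor
  · calc Real.exp b ≤ Real.exp (E + E') * Real.exp a := e1
      _ ≤ Real.exp (E + E') * (C * μ.real (PiNat.cylinder (reverseDigits n w) n)) := by gcongr
      _ = _ := by ring
  · calc _ ≤ C * Real.exp a := h4
      _ ≤ C * (Real.exp (E + E') * Real.exp b) := by gcongr
      _ = _ := by ring

end DualMeasure

end DualGibbs

/-! ### The main theorem: results on `g`-functions applied to `1 / Ψ` -/

open DualGibbs
theorem mainTheorem9 (d : ℕ) (hd : 2 ≤ d) :
    -- every `f ∈ 𝒞^{1+}` has a dual derivative
    (∀ f : CircleEndo d, f.IsC1PlusExpanding →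
      ∃ Ψ : DualSymSpace d → ℝ, f.IsDualDerivative Ψ) ∧
    ∀ Ψ ∈ teichC1Plus d,
      ∃ μ : Measure (DualSymSpace d),
        -- a non-atomic probability measure with full support
        (IsProbabilityMeasure μ ∧ NullSingletonClass μ ∧ μ.IsOpenPosMeasure) ∧
        -- the shift is `C^{1+}` with derivative `Ψ` for the induced metric
        (∀ x, HasMetricDerivAt μ x (Ψ x)) ∧ (∀ x, HasCylinderDerivAt μ x (Ψ x)) ∧
        (∀ x, 0 < Ψ x) ∧ IsSymbolicHolder Ψ ∧ IsInducedHolder μ Ψ ∧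
        -- uniqueness of the measure
        (∀ ν : Measure (DualSymSpace d), IsProbabilityMeasure ν → NullSingletonClass ν →
          ν.IsOpenPosMeasure → (∀ x, HasCylinderDerivAt ν x (Ψ x)) → ν = μ) ∧
        -- `μ` is the dual of the Gibbs measure of each `f` representing `Ψ`
        (∀ f : CircleEndo d, f.IsC1PlusExpanding → f.IsDualDerivative Ψ →
          ∃ m : Measure (SymSpace d),
            IsGibbsMeasure (fun w => Real.log (f.weight w)) 0 m ∧
            (∀ m' : Measure (SymSpace d),
              IsGibbsMeasure (fun w => Real.log (f.weight w)) 0 m' → m' = m) ∧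
            IsDualMeasure m μ) ∧
        -- `μ` is the Gibbs measure for `-log Ψ`, and the pressure is `0`
        IsGibbsMeasure (fun x => -Real.log (Ψ x)) 0 μ ∧
        (∀ (P : ℝ) (ν : Measure (DualSymSpace d)),
          IsGibbsMeasure (fun x => -Real.log (Ψ x)) P ν → P = 0 ∧ ν = μ) ∧
        HasPressure (fun x : DualSymSpace d => -Real.log (Ψ x)) 0 ∧
        -- `μ` is a `g`-measure for `1 / Ψ`, which is its Radon–Nikodym derivative
        IsGMeasure (fun x => 1 / Ψ x) μ ∧
        μ ≪ tildeMeasure μ ∧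
        (μ.rnDeriv (tildeMeasure μ) =ᵐ[tildeMeasure μ] fun x => ENNReal.ofReal (1 / Ψ x)) ∧
        -- `μ` is the unique equilibrium state for `-log Ψ`
        IsEquilibriumState (fun x => -Real.log (Ψ x)) 0 μ ∧
        (∀ ν : Measure (DualSymSpace d),
          IsEquilibriumState (fun x => -Real.log (Ψ x)) 0 ν → ν = μ) := by
  have : NeZero d := ⟨by omega⟩
  refine ⟨fun f hf => hf.exists_isDualDerivative, ?_⟩
  rintro Ψ ⟨f, hf, hΨ⟩
  have hpos := (hΨ.pos_and_log_approx hf).1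
  have hg := hΨ.isHolderG hf
  have hlog : (fun x => -Real.log (Ψ x)) = fun x => Real.log (1 / Ψ x) := by
    funext x
    rw [one_div, Real.log_inv]
  obtain ⟨μ, hμ⟩ := exists_isGMeasure hg
  have hprob := hμ.prob
  have hcd : ∀ x, HasCylinderDerivAt μ x (Ψ x) := fun x => by
    simpa only [one_div_one_div] using hμ.hasCylinderDerivAt hg x
  have hgibbs := hμ.isGibbsMeasure hg
  have hsym := hΨ.isSymbolicHolder hf
  have htilde := hμ.eq_withDensity_tildeMeasure hg
  have hfin : IsFiniteMeasure (tildeMeasure μ) := by unfold tildeMeasure; infer_instance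
  rw [hlog]
  refine ⟨μ, ⟨hprob, hμ.nullSingletonClass hd hg, hμ.isOpenPosMeasure hg⟩,
    fun x => (hcd x).hasMetricDerivAt, hcd, hpos, hsym, hμ.isInducedHolder hd hg hsym,
    fun ν hν _ hν' hder => ?_, fun f' hf' hΨ' => ?_, hgibbs, fun P ν hν => ?_, hg.hasPressure, hμ,
    ?_, ?_, hμ.isEquilibriumState hg, fun ν hν => hμ.eq_of_isEquilibriumState hg hν⟩
  · refine (isGMeasure_of_hasCylinderDerivAt hg fun x => ?_).eq hg hμ
    simpa only [one_div_one_div] using hder x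
  · obtain ⟨m, hm, hdual⟩ := hΨ'.exists_gibbs_dual hf' hgibbs
    exact ⟨m, hm, fun m' hm' => hm.eq hf'.isSymbolicHolder_log_weight hm', hdual⟩
  · have hP : P = 0 := le_antisymm (hν.le_constant hgibbs) (hgibbs.le_constant hν)
    subst hP
    exact ⟨rfl, hgibbs.eq hg.holder hν⟩
  · have h := withDensity_absolutelyContinuous (tildeMeasure μ) fun x => ENNReal.ofReal (1 / Ψ x)
    rwa [← htilde] at h
  · have h := Measure.rnDeriv_withDensity (tildeMeasure μ)
      (f := fun x => ENNReal.ofReal (1 / Ψ x)) hg.continuous.measurable.ennreal_ofReal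
    rwa [← htilde] at h
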